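/- Let $U(2,1)=\{g\in GL(3,\mathbb C): g^*Jg=J\}$, where $J$ is the matrix with rows $(0,0,-1),(0,1,0),(-1,0,0)$. For $Z=(z_1,z_2)$ and $W=(w_1,w_2)$ in $\mathbb C^2$ put $\rho(Z,W)=\overline{z_1}+w_1-\overline{z_2}w_2$ and $\rho(Z)=\rho(Z,Z)$. Let $\mathfrak S_2=\{Z\in\mathbb C^2:\rho(Z)>0\}$ be the Siegel domain and $\partial\mathfrak S_2=\{Z:\rho(Z)=0\}$, and let $X=\mathfrak S_2$, with geodesic boundary $\partial X=\partial\mathfrak S_2\cup\{\infty\}$; here $X\cup\partial X$ is the one-point compactification of $\mathfrak S_2\cup\partial\mathfrak S_2$, and $U(2,1)$ acts on it by fractional linear maps ($(z_1,z_2)$ being $[z_1:z_2:1]$, and $\infty$ being $[1:0:0]$). For $\gamma\in U(2,1)$ with last row $(c_1,c_2,c_3)$ put $j(\gamma,Z)=c_1z_1+c_2z_2+c_3$. Let $dm$ be the measure $dm(w)\,dt$ on $\partial\mathfrak S_2$ in the coordinates $W=(\tfrac12|w|^2+it,\,w)$, $w\in\mathbb C$, $t\in\mathbb R$, where $dm(w)$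 is Lebesgue measure on $\mathbb C$. For a discrete subgroup $\Gamma\subset U(2,1)$ let $\Lambda(\Gamma)\subset\partial X$ be the set of accumulation points of $\Gamma$-orbits in $X$, and $\Omega(\Gamma)=\partial X\setminus\Lambda(\Gamma)$. Call $\Gamma$ convex cocompact if it is discrete and torsion-free, $\Omega(\Gamma)\neq\emptyset$, and $\Gamma$ acts freely and cocompactly on $X\cup\Omega(\Gamma)$. Put $\sigma(Z,Z')=|\rho(Z,Z')|^2/(\rho(Z)\rho(Z'))$, and let the critical exponent $\delta(\Gamma)$ be the infimum of all $s>0$ such that $\sum_{\gamma\in\Gamma}\sigma(Z,\gamma(Z'))^{-s}<\infty$ for some (equivalently, any) $Z,Z'\in\mathfrak S_2$. With $P(Z,W)=\rho(Z)/|\rho(Z,W)|^2$, define for $\operatorname{Re}(s)>\delta(\Gamma)$ $$E(Z,W;s)=\sum_{\gamma\in\Gamma}P(\gamma(Z),W)^s,\qquad S(W,W';s)=\sum_{\gamma\in\Gamma}|\rho(\gamma(W),W')|^{-2s}\,|j(\gamma,W)|^{-2s}$$ for $Z\in\mathfrak S_2$ and $W,W'\in\Omega(\Gamma)\setminus\{\infty\}$.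 (A term of $S$ with $\gamma(W)\in\{\infty,W'\}$ is given the value $0$; for fixed $W'$ this concerns only countably many $W$.) **Theorem.** Let $\Gamma\subset U(2,1)$ be convex cocompact with $\delta(\Gamma)<1$, let $1<\operatorname{Re}(s)<2-\delta(\Gamma)$, $Z\in\mathfrak S_2$ and $W'\in\Omega(\Gamma)\setminus\{\infty\}$. Then the series $E(Z,W;s)$ and $S(W,W';2-s)$, for all $W\in\Omega(\Gamma)\setminus\{\infty\}$, and the series $E(Z,W';2-s)$ converge absolutely, and $$\int_{\Gamma\backslash\Omega(\Gamma)}E(Z,W;s)\,S(W,W';2-s)\,dm(W)=\frac{4^{s-1}\pi}{s-1}\,\frac{\sqrt\pi\,\Gamma(s-\frac12)}{\Gamma(s)}\,E(Z,W';2-s).$$ Here the integral over $\Gamma\backslash\Omega(\Gamma)$ means the integral over a measurable fundamental domain, that is, a Borel set $D\subset\Omega(\Gamma)\setminus\{\infty\}$ such that for $m$-almost every $W\in\Omega(\Gamma)$ exactly one $\gamma\in\Gamma$ has $\gamma(W)\in D$; such $D$ exist, and for each of them the integrand is integrable on $D$ and the formula holds. -/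

import Mathlib

open MeasureTheory Complex
open scoped OnePoint

noncomputable section

namespace SiegelU21

/-- The Hermitian matrix `J` of signature `(2, 1)`. -/
def formJ : Matrix (Fin 3) (Fin 3) ℂ :=
  !![0, 0, -1; 0, 1, 0; -1, 0, 0]

/-- The unitary group `U(2, 1) = {g ∈ GL(3, ℂ) : g* J g = J}`. -/
def U21 : Subgroup (GL (Fin 3) ℂ) where
  carrier := {g | (g : Matrix (Fin 3) (Fin 3) ℂ).conjTranspose * formJ * g = formJ}
  one_mem' := by simp
  mul_mem' := by
    intro a b ha hb
    simp only [Set.mem_ofPred_eq, Units.val_mul, Matrix.conjTranspose_mul] at *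
    calc _ = (b : Matrix (Fin 3) (Fin 3) ℂ).conjTranspose *
          ((a : Matrix (Fin 3) (Fin 3) ℂ).conjTranspose * formJ * a) * b := by
            simp only [Matrix.mul_assoc]
      _ = formJ := by rw [ha, hb]
  inv_mem' := by
    intro a ha
    simp only [Set.mem_ofPred_eq] at *
    have h1 : (a : Matrix (Fin 3) (Fin 3) ℂ) * ((a⁻¹ : GL (Fin 3) ℂ) : Matrix _ _ ℂ) = 1 := by
      rw [← Units.val_mul, mul_inv_cancel, Units.val_one]
    have h2 : ((a⁻¹ : GL (Fin 3) ℂ) : Matrix (Fin 3) (Fin 3) ℂ).conjTranspose *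
        (a : Matrix (Fin 3) (Fin 3) ℂ).conjTranspose = 1 := by
      rw [← Matrix.conjTranspose_mul, h1, Matrix.conjTranspose_one]
    calc _ = ((a⁻¹ : GL (Fin 3) ℂ) : Matrix (Fin 3) (Fin 3) ℂ).conjTranspose *
          ((a : Matrix (Fin 3) (Fin 3) ℂ).conjTranspose * formJ * a) *
            ((a⁻¹ : GL (Fin 3) ℂ) : Matrix (Fin 3) (Fin 3) ℂ) := by rw [ha]
      _ = (((a⁻¹ : GL (Fin 3) ℂ) : Matrix (Fin 3) (Fin 3) ℂ).conjTranspose *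
          (a : Matrix (Fin 3) (Fin 3) ℂ).conjTranspose) * formJ *
            ((a : Matrix (Fin 3) (Fin 3) ℂ) *
              ((a⁻¹ : GL (Fin 3) ℂ) : Matrix (Fin 3) (Fin 3) ℂ)) := by
            simp only [Matrix.mul_assoc]
      _ = formJ := by rw [h1, h2, Matrix.one_mul, Matrix.mul_one]

/-- `ρ(Z, W) = conj z₁ + w₁ - conj z₂ * w₂`. -/
def rho (Z W : ℂ × ℂ) : ℂ :=
  (starRingEnd ℂ) Z.1 + W.1 - (starRingEnd ℂ) Z.2 * W.2

/-- `ρ(Z) = ρ(Z, Z) = z₁ + conj z₁ - |z₂|²`, which is real. -/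
def height (Z : ℂ × ℂ) : ℝ := (rho Z Z).re

/-- The Siegel domain `𝔖₂`. -/
def siegel : Set (ℂ × ℂ) := {Z | 0 < height Z}

/-- The finite part `∂𝔖₂` of the boundary of the Siegel domain. -/
def siegelBoundary : Set (ℂ × ℂ) := {Z | height Z = 0}

/-- The geodesic boundary `∂X = ∂𝔖₂ ∪ {∞}` of `X = 𝔖₂`. The space `X ∪ ∂X` carries the topology
of the one-point compactification of the closure of `𝔖₂`, that is, the one induced from
`OnePoint (ℂ × ℂ)`. -/
def boundary : Set (OnePoint (ℂ × ℂ)) :=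
  insert ∞ (OnePoint.some '' siegelBoundary)

/-- The automorphy factor `j(g, Z) = c₁ z₁ + c₂ z₂ + c₃`, with `(c₁, c₂, c₃)` the last row. -/
def autJ (g : GL (Fin 3) ℂ) (Z : ℂ × ℂ) : ℂ :=
  g 2 0 * Z.1 + g 2 1 * Z.2 + g 2 2

/-- The fractional linear action `Z ↦ g(Z)`, meaningful where `j(g, Z) ≠ 0`. -/
def moebius (g : GL (Fin 3) ℂ) (Z : ℂ × ℂ) : ℂ × ℂ :=
  ((g 0 0 * Z.1 + g 0 1 * Z.2 + g 0 2) / autJ g Z,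
    (g 1 0 * Z.1 + g 1 1 * Z.2 + g 1 2) / autJ g Z)

open Classical in
/-- The action of `g ∈ U(2, 1)` on `X ∪ ∂X`, where `∞` is the point `[1 : 0 : 0]`. A point `Z` of
the closure of `𝔖₂` is sent to `∞` exactly if `j(g, Z) = 0`. -/
def act (g : GL (Fin 3) ℂ) (x : OnePoint (ℂ × ℂ)) : OnePoint (ℂ × ℂ) :=
  x.elim
    (if g 2 0 = 0 then ∞ else OnePoint.some (g 0 0 / g 2 0, g 1 0 / g 2 0))
    (fun Z => if autJ g Z = 0 then ∞ else OnePoint.some (moebius g Z))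

/-- The limit set `Λ(Γ)`: the accumulation points in `∂X` of the `Γ`-orbits in `X`. -/
def limitSet (Γ : Subgroup (GL (Fin 3) ℂ)) : Set (OnePoint (ℂ × ℂ)) :=
  {ξ ∈ boundary | ∃ Z ∈ siegel, ξ ∈ closure (Set.range fun γ : Γ => act γ (Z : OnePoint (ℂ × ℂ)))}

/-- The discontinuity set `Ω(Γ) = ∂X ∖ Λ(Γ)`. -/
def discontinuitySet (Γ : Subgroup (GL (Fin 3) ℂ)) : Set (OnePoint (ℂ × ℂ)) :=
  boundary \ limitSet Γ

/-- Convex cocompact subgroups of `U(2, 1)`: discrete and torsion-free, with `Ω(Γ)` non-empty,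
acting freely and cocompactly on `X ∪ Ω(Γ)`. -/
structure IsConvexCocompact (Γ : Subgroup (GL (Fin 3) ℂ)) : Prop where
  le_U21 : Γ ≤ U21
  discrete : DiscreteTopology Γ
  torsionFree : ∀ γ ∈ Γ, IsOfFinOrder γ → γ = 1
  nonempty : (discontinuitySet Γ).Nonempty
  free : ∀ γ ∈ Γ, ∀ x ∈ OnePoint.some '' siegel ∪ discontinuitySet Γ, act γ x = x → γ = 1
  cocompact : ∃ K : Set (OnePoint (ℂ × ℂ)), IsCompact K ∧
    K ⊆ OnePoint.some '' siegel ∪ discontinuitySet Γ ∧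
    ∀ x ∈ OnePoint.some '' siegel ∪ discontinuitySet Γ, ∃ γ ∈ Γ, act γ x ∈ K

/-- The point-pair invariant `σ(Z, Z') = |ρ(Z, Z')|² / (ρ(Z) ρ(Z'))`. -/
def sigma (Z Z' : ℂ × ℂ) : ℝ := ‖rho Z Z'‖ ^ 2 / (height Z * height Z')

/-- The critical exponent `δ(Γ)`: the infimum of all `s > 0` such that the series
`∑ σ(Z, γ(Z'))^(-s)` converges for some (equivalently, any) `Z, Z' ∈ 𝔖₂`. -/
def criticalExponent (Γ : Subgroup (GL (Fin 3) ℂ)) : EReal :=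
  sInf {x : EReal | ∃ s : ℝ, x = s ∧ 0 < s ∧ ∃ Z ∈ siegel, ∃ Z' ∈ siegel,
    Summable fun γ : Γ => sigma Z (moebius γ Z') ^ (-s)}

/-- The Poisson kernel `P(Z, W) = ρ(Z) / |ρ(Z, W)|²`. -/
def poisson (Z W : ℂ × ℂ) : ℝ := height Z / ‖rho Z W‖ ^ 2

/-- The term of index `γ` of the Eisenstein series. -/
def eisensteinTerm (Z W : ℂ × ℂ) (s : ℂ) (γ : GL (Fin 3) ℂ) : ℂ :=
  (poisson (moebius γ Z) W : ℂ) ^ s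

/-- The Eisenstein series `E(Z, W; s) = ∑_γ P(γ(Z), W)^s`. -/
def eisenstein (Γ : Subgroup (GL (Fin 3) ℂ)) (Z W : ℂ × ℂ) (s : ℂ) : ℂ :=
  ∑' γ : Γ, eisensteinTerm Z W s γ

/-- The term of index `γ` of the S-matrix. -/
def sMatrixTerm (W W' : ℂ × ℂ) (s : ℂ) (γ : GL (Fin 3) ℂ) : ℂ :=
  (‖rho (moebius γ W) W'‖ : ℂ) ^ (-2 * s) * (‖autJ γ W‖ : ℂ) ^ (-2 * s)

/-- The S-matrix `S(W, W'; s) = ∑_γ |ρ(γ(W), W')|^(-2s) |j(γ, W)|^(-2s)`. -/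
def sMatrix (Γ : Subgroup (GL (Fin 3) ℂ)) (W W' : ℂ × ℂ) (s : ℂ) : ℂ :=
  ∑' γ : Γ, sMatrixTerm W W' s γ

/-- The Lebesgue measure `dm(W) = dm(w) dt` on `∂𝔖₂`, in the coordinates
`W = (|w|²/2 + i t, w)` with `w ∈ ℂ` and `t ∈ ℝ`. -/
def boundaryMeasure : Measure (ℂ × ℂ) :=
  (volume : Measure (ℂ × ℝ)).map fun p => (((‖p.1‖ ^ 2 / 2 : ℝ) : ℂ) + p.2 * I, p.1)

/-- A measurable fundamental domain for the action of `Γ` on `Ω(Γ)`: almost every point of `Ω(Γ)`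
is moved into `D` by exactly one element of `Γ`. The integral of a `Γ`-invariant density
over `Γ \ Ω(Γ)` is its integral over such a `D`. -/
structure IsFundDomain (Γ : Subgroup (GL (Fin 3) ℂ)) (D : Set (ℂ × ℂ)) : Prop where
  measurableSet : MeasurableSet D
  subset : OnePoint.some '' D ⊆ discontinuitySet Γ
  existsUnique : ∀ᵐ W : ℂ × ℂ ∂boundaryMeasure, OnePoint.some W ∈ discontinuitySet Γ →
    ∃! γ : Γ, act γ (OnePoint.some W) ∈ OnePoint.some '' D

end SiegelU21

end

/-! ### The Hermitian form, the fractional linear action and the kernels. -/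

namespace SiegelU21

/-! The formula is an unfolding. On the boundary `γ` has Jacobian |j(γ, W)|⁻⁴, while P(γZ, γW) =
P(Z, W)|j(γ, W)|². After the substitution (β, γ) ↦ (γ⁻¹β, γ), each term of the double series E·S is
therefore the Jacobian of γ times f_β ∘ γ, with f_β(W) = P(βZ, W)^s |ρ(W, W')|^(-2(2-s))
(`pullbackTerm_eq`). Integrating over D and summing over γ gives the integral of f_β over the whole
boundary (`hasSum_setIntegral_fundDomain`). An element of U(2,1) moving W' to ∞ turns this into the
integral of a pure power of the Poisson kernel, which is explicit in the coordinates (w, t); the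
result is c(s) P(βZ, W')^(2-s) (`integral_poisson_mul_kernel`). The sum over β is the Eisenstein
series at 2 - s.

Convergence is measured with |ρ|, which obeys a quasi-triangle inequality on the closed domain
(`norm_rho_triangle`). Orbits stay at positive ρ-distance from a point of Ω(Γ), so the terms of E
and S are bounded by multiples of σ(Z, γZ)^(-Re s), for all but finitely many γ in the case of S
(`exists_poisson_le_sigma`, `exists_pairing_le`). The interchanges of sum and integral rest on the
same unfolding applied to absolute values.

Unfolding to the whole boundary requires the limit set to be null (`ae_mem_finiteDisc`), and this is
where cocompactness enters. The measures P(Z, ·)² dm all have the same total mass, and the mass they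
give to Ω(Γ) is a Γ-invariant function of Z. By cocompactness it is bounded below by some κ > 0
(`exists_le_visualDisc`). Averaging over points at height h above a bounded piece A of the limit set
and letting h → 0 makes that mass disappear, so κ m(A) = 0.

Fundamental domains exist by a Dirichlet construction with a Borel tie-break
(`exists_isFundDomain`); freeness makes the selected element unique. -/

theorem height_eq (Z : ℂ × ℂ) : height Z = 2 * Z.1.re - ‖Z.2‖ ^ 2 := by
  rw [← Complex.normSq_eq_norm_sq, Complex.normSq_apply]
  simp [height, rho]
  ring

theorem rho_self (Z : ℂ × ℂ) : rho Z Z = (height Z : ℂ) := by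
  apply Complex.ext
  · simp [height]
  · simp [rho]; ring

theorem rho_symm (Z W : ℂ × ℂ) : rho W Z = (starRingEnd ℂ) (rho Z W) := by
  simp [rho]; ring

theorem norm_rho_comm (Z W : ℂ × ℂ) : ‖rho W Z‖ = ‖rho Z W‖ := by
  rw [rho_symm, RCLike.norm_conj]

/-- Source of all size estimates: on the closed domain the real part is a sum of nonnegative terms,
so |ρ| controls both heights and the horizontal distance. -/
theorem re_rho (Z W : ℂ × ℂ) :
    (rho Z W).re = (height Z + height W + ‖Z.2 - W.2‖ ^ 2) / 2 := by
  simp only [height_eq, ← Complex.normSq_eq_norm_sq, Complex.normSq_apply]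
  simp [rho]
  ring

theorem height_add_le_norm_rho (Z W : ℂ × ℂ) :
    height Z + height W + ‖Z.2 - W.2‖ ^ 2 ≤ 2 * ‖rho Z W‖ := by
  have h := Complex.re_le_norm (rho Z W)
  rw [re_rho] at h
  linarith

theorem height_le_norm_rho {Z W : ℂ × ℂ} (hW : 0 ≤ height W) : height Z ≤ 2 * ‖rho Z W‖ := by
  have h := height_add_le_norm_rho Z W
  nlinarith [sq_nonneg ‖Z.2 - W.2‖]

theorem norm_rho_pos {Z W : ℂ × ℂ} (hZ : 0 < height Z) (hW : 0 ≤ height W) : 0 < ‖rho Z W‖ := by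
  have h := height_le_norm_rho (Z := Z) hW
  linarith

/-- The quasi-triangle inequality for `‖ρ‖` on the closure of the Siegel domain. -/
theorem norm_rho_triangle {A B C : ℂ × ℂ} (hA : 0 ≤ height A) (hB : 0 ≤ height B)
    (hC : 0 ≤ height C) : ‖rho A C‖ ≤ 3 * (‖rho A B‖ + ‖rho B C‖) := by
  -- The defect from additivity consists of `height B` and a product of horizontal differences. Both
  -- are absorbed by `height_add_le_norm_rho`, the product via the arithmetic-geometric mean
  -- inequality.
  have e : rho A C = rho A B + rho B C - (height B : ℂ)
      - (starRingEnd ℂ) (A.2 - B.2) * (C.2 - B.2) := by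
    rw [← rho_self]; simp [rho]; ring
  have h1 := height_add_le_norm_rho A B
  have h2 := height_add_le_norm_rho B C
  have n1 : ‖(height B : ℂ)‖ = height B := by
    rw [Complex.norm_real, Real.norm_of_nonneg hB]
  have n2 : ‖(starRingEnd ℂ) (A.2 - B.2) * (C.2 - B.2)‖ = ‖A.2 - B.2‖ * ‖B.2 - C.2‖ := by
    rw [norm_mul, RCLike.norm_conj, norm_sub_rev C.2]
  calc ‖rho A C‖ ≤ ‖rho A B‖ + ‖rho B C‖ + ‖(height B : ℂ)‖
        + ‖(starRingEnd ℂ) (A.2 - B.2) * (C.2 - B.2)‖ := by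
        rw [e]
        exact (norm_sub_le _ _).trans (add_le_add_left ((norm_sub_le _ _).trans
          (add_le_add_left (norm_add_le _ _) _)) _)
    _ ≤ _ := by
        rw [n1, n2]
        nlinarith [sq_nonneg (‖A.2 - B.2‖ - ‖B.2 - C.2‖), sq_nonneg ‖A.2 - B.2‖,
          sq_nonneg ‖B.2 - C.2‖]

theorem continuous_rho : Continuous fun p : (ℂ × ℂ) × (ℂ × ℂ) => rho p.1 p.2 := by
  unfold rho; fun_prop

theorem continuous_height : Continuous height := by
  have : height = fun Z => (rho Z Z).re := rfl
  rw [this]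
  unfold rho; fun_prop

/-- Away from `B`, `‖ρ(A, ·)‖` is controlled by `‖ρ(B, ·)‖`. -/
theorem norm_rho_le_mul {A B V : ℂ × ℂ} {ε : ℝ} (hA : 0 ≤ height A) (hB : 0 ≤ height B)
    (hV : 0 ≤ height V) (hε : 0 < ε) (h : ε ≤ ‖rho B V‖) :
    ‖rho A V‖ ≤ 3 * (‖rho A B‖ / ε + 1) * ‖rho B V‖ := by
  have h1 := norm_rho_triangle hA hB hV
  have h2 : ‖rho A B‖ ≤ ‖rho A B‖ / ε * ‖rho B V‖ := by
    rw [div_mul_eq_mul_div, le_div_iff₀ hε]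
    exact mul_le_mul_of_nonneg_left h (norm_nonneg _)
  linarith

theorem dist_le_of_norm_rho {V W : ℂ × ℂ} (hV : 0 ≤ height V) (hW : height W = 0) :
    ‖V.2 - W.2‖ ^ 2 ≤ 2 * ‖rho V W‖ ∧
    ‖V.1 - W.1‖ ≤ ‖rho V W‖ + ‖W.2‖ * ‖V.2 - W.2‖ := by
  have h1 := height_add_le_norm_rho V W
  refine ⟨by linarith, ?_⟩
  have e : V.1 - W.1 = rho W V + (starRingEnd ℂ) W.2 * (V.2 - W.2) := by
    have : rho W W = 0 := by rw [rho_self, hW]; simp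
    have h2 : rho W V + (starRingEnd ℂ) W.2 * (V.2 - W.2) - rho W W = V.1 - W.1 := by
      simp [rho]; ring
    rw [← h2, this, sub_zero]
  rw [e]
  refine (norm_add_le _ _).trans ?_
  rw [norm_rho_comm V W, norm_mul, RCLike.norm_conj]

/-- Near a boundary point, small `‖ρ(·, W)‖` means close to `W`. -/
theorem exists_norm_rho_lt_imp_dist_lt {W : ℂ × ℂ} (hW : height W = 0) {r : ℝ} (hr : 0 < r) :
    ∃ ε > 0, ∀ V, 0 ≤ height V → ‖rho V W‖ < ε → dist V W < r := by
  obtain ⟨d, hd, hdr⟩ : ∃ d > 0, d < r ∧ d + ‖W.2‖ * d < r := by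
    refine ⟨r / 2 / (1 + ‖W.2‖), by positivity, ?_, ?_⟩
    · rw [div_lt_iff₀ (by positivity)]
      nlinarith [norm_nonneg W.2]
    · have : r / 2 / (1 + ‖W.2‖) + ‖W.2‖ * (r / 2 / (1 + ‖W.2‖)) = r / 2 := by
        field_simp
      rw [this]; linarith
  refine ⟨min d (d ^ 2 / 2), by positivity, fun V hV h => ?_⟩
  obtain ⟨h1, h2⟩ := dist_le_of_norm_rho hV hW
  have h3 : ‖V.2 - W.2‖ < d := by
    have := h.trans_le (min_le_right _ _)
    exact lt_of_pow_lt_pow_left₀ 2 hd.le (by linarith)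
  have h4 := h.trans_le (min_le_left _ _)
  rw [Prod.dist_eq, max_lt_iff, dist_eq_norm, dist_eq_norm]
  refine ⟨?_, by linarith [hdr.1]⟩
  have : ‖W.2‖ * ‖V.2 - W.2‖ ≤ ‖W.2‖ * d := mul_le_mul_of_nonneg_left h3.le (norm_nonneg _)
  linarith [hdr.2]

theorem exists_dist_lt_imp_norm_rho_lt (W : ℂ × ℂ) (hW : height W = 0) {ε : ℝ} (hε : 0 < ε) :
    ∃ r > 0, ∀ V, dist V W < r → ‖rho V W‖ < ε := by
  have hc : ContinuousAt (fun V => ‖rho V W‖) W := by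
    unfold rho; fun_prop
  have h0 : ‖rho W W‖ < ε := by rw [rho_self, hW]; simpa using hε
  exact Metric.eventually_nhds_iff.1 (hc.eventually (gt_mem_nhds h0)) |>.imp
    fun r hr => ⟨hr.1, fun V hV => hr.2 hV⟩

theorem rho_eq_zero_iff {V W : ℂ × ℂ} (hV : 0 ≤ height V) (hW : height W = 0) :
    rho V W = 0 ↔ V = W := by
  constructor
  · intro h
    obtain ⟨h1, h2⟩ := dist_le_of_norm_rho hV hW
    rw [h, norm_zero] at h1 h2
    have h3 : ‖V.2 - W.2‖ = 0 := by
      have := norm_nonneg (V.2 - W.2); nlinarith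
    rw [h3] at h2
    have h4 : ‖V.1 - W.1‖ = 0 := le_antisymm (by simpa using h2) (norm_nonneg _)
    exact Prod.ext (sub_eq_zero.1 (norm_eq_zero.1 h4)) (sub_eq_zero.1 (norm_eq_zero.1 h3))
  · rintro rfl
    rw [rho_self, hW]; simp

/-! The numerators of the fractional linear action. -/

/-- The vector `g (z₁, z₂, 1)`. -/
def lift (g : GL (Fin 3) ℂ) (Z : ℂ × ℂ) (i : Fin 3) : ℂ := g i 0 * Z.1 + g i 1 * Z.2 + g i 2

theorem lift_two (g : GL (Fin 3) ℂ) (Z : ℂ × ℂ) : lift g Z 2 = autJ g Z := rfl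

theorem moebius_eq (g : GL (Fin 3) ℂ) (Z : ℂ × ℂ) :
    moebius g Z = (lift g Z 0 / autJ g Z, lift g Z 1 / autJ g Z) := rfl

theorem autJ_one (Z : ℂ × ℂ) : autJ 1 Z = 1 := by simp [autJ]

theorem moebius_one (Z : ℂ × ℂ) : moebius 1 Z = Z := by simp [moebius, autJ_one]

theorem lift_mul (g h : GL (Fin 3) ℂ) (Z : ℂ × ℂ) (hj : autJ h Z ≠ 0) (i : Fin 3) :
    lift (g * h) Z i = lift g (moebius h Z) i * autJ h Z := by
  have e1 : (moebius h Z).1 * autJ h Z = lift h Z 0 := by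
    rw [moebius_eq]; exact div_mul_cancel₀ _ hj
  have e2 : (moebius h Z).2 * autJ h Z = lift h Z 1 := by
    rw [moebius_eq]; exact div_mul_cancel₀ _ hj
  have : lift g (moebius h Z) i * autJ h Z =
      g i 0 * lift h Z 0 + g i 1 * lift h Z 1 + g i 2 * autJ h Z := by
    rw [← e1, ← e2, lift]; ring
  rw [this]
  simp only [lift, autJ, Units.val_mul, Matrix.mul_apply, Fin.sum_univ_three]
  ring

theorem autJ_mul (g h : GL (Fin 3) ℂ) (Z : ℂ × ℂ) (hj : autJ h Z ≠ 0) :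
    autJ (g * h) Z = autJ g (moebius h Z) * autJ h Z := lift_mul g h Z hj 2

theorem moebius_mul (g h : GL (Fin 3) ℂ) (Z : ℂ × ℂ) (hj : autJ h Z ≠ 0) :
    moebius (g * h) Z = moebius g (moebius h Z) := by
  rw [moebius_eq, moebius_eq g, lift_mul _ _ _ hj, lift_mul _ _ _ hj, autJ_mul _ _ _ hj,
    mul_div_mul_right _ _ hj, mul_div_mul_right _ _ hj]

theorem moebius_inv_moebius (g : GL (Fin 3) ℂ) (Z : ℂ × ℂ) (hj : autJ g Z ≠ 0) :
    moebius g⁻¹ (moebius g Z) = Z := by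
  rw [← moebius_mul _ _ _ hj, inv_mul_cancel, moebius_one]

theorem autJ_inv_moebius (g : GL (Fin 3) ℂ) (Z : ℂ × ℂ) (hj : autJ g Z ≠ 0) :
    autJ g⁻¹ (moebius g Z) * autJ g Z = 1 := by
  rw [← autJ_mul _ _ _ hj, inv_mul_cancel, autJ_one]

/-- The Hermitian pairing of `g (z₁, z₂, 1)` with `(w₁, w₂, 1)`, up to sign. -/
def pairing (g : GL (Fin 3) ℂ) (Z W : ℂ × ℂ) : ℂ :=
  (starRingEnd ℂ) (lift g Z 0) + (starRingEnd ℂ) (lift g Z 2) * W.1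
    - (starRingEnd ℂ) (lift g Z 1) * W.2

theorem pairing_eq (g : GL (Fin 3) ℂ) (Z W : ℂ × ℂ) (hj : autJ g Z ≠ 0) :
    pairing g Z W = (starRingEnd ℂ) (autJ g Z) * rho (moebius g Z) W := by
  have hj' : (starRingEnd ℂ) (autJ g Z) ≠ 0 := by simpa using hj
  simp only [pairing, rho, moebius_eq, lift_two, map_div₀]
  field_simp

theorem norm_pairing (g : GL (Fin 3) ℂ) (Z W : ℂ × ℂ) (hj : autJ g Z ≠ 0) :
    ‖pairing g Z W‖ = ‖autJ g Z‖ * ‖rho (moebius g Z) W‖ := by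
  rw [pairing_eq _ _ _ hj, norm_mul, RCLike.norm_conj]

theorem mem_U21_iff {g : GL (Fin 3) ℂ} :
    g ∈ U21 ↔ (g : Matrix (Fin 3) (Fin 3) ℂ).conjTranspose * formJ * g = formJ := Iff.rfl

theorem U21_entry {g : GL (Fin 3) ℂ} (hg : g ∈ U21) (i k : Fin 3) :
    -(starRingEnd ℂ) (g 2 i) * g 0 k + (starRingEnd ℂ) (g 1 i) * g 1 k
      - (starRingEnd ℂ) (g 0 i) * g 2 k = formJ i k := by
  have h := congrFun (congrFun (mem_U21_iff.1 hg) i) k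
  rw [← h]
  simp [Matrix.mul_apply, Fin.sum_univ_three, formJ]
  ring

/-- This is invariance of the Hermitian form before division by `j`, so it also applies to points
sent to `∞`. -/
theorem lift_form {g : GL (Fin 3) ℂ} (hg : g ∈ U21) (Z W : ℂ × ℂ) :
    (starRingEnd ℂ) (lift g Z 0) * lift g W 2 + (starRingEnd ℂ) (lift g Z 2) * lift g W 0
      - (starRingEnd ℂ) (lift g Z 1) * lift g W 1 = rho Z W := by
  have e := U21_entry hg
  have e00 := e 0 0
  have e01 := e 0 1
  have e02 := e 0 2
  have e10 := e 1 0
  have e11 := e 1 1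
  have e12 := e 1 2
  have e20 := e 2 0
  have e21 := e 2 1
  have e22 := e 2 2
  simp only [formJ, Matrix.of_apply, Matrix.cons_val', Matrix.cons_val_zero, Matrix.cons_val_one,
    Matrix.cons_val] at e00 e01 e02 e10 e11 e12 e20 e21 e22
  simp only [lift, rho, map_add, map_mul]
  linear_combination -(starRingEnd ℂ) Z.1 * W.1 * e00 - (starRingEnd ℂ) Z.1 * W.2 * e01
    - (starRingEnd ℂ) Z.1 * e02 - (starRingEnd ℂ) Z.2 * W.1 * e10
    - (starRingEnd ℂ) Z.2 * W.2 * e11 - (starRingEnd ℂ) Z.2 * e12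
    - W.1 * e20 - W.2 * e21 - e22

theorem rho_moebius {g : GL (Fin 3) ℂ} (hg : g ∈ U21) {Z W : ℂ × ℂ} (hZ : autJ g Z ≠ 0)
    (hW : autJ g W ≠ 0) :
    (starRingEnd ℂ) (autJ g Z) * autJ g W * rho (moebius g Z) (moebius g W) = rho Z W := by
  rw [← lift_form hg Z W, lift_two, lift_two]
  have hj' : (starRingEnd ℂ) (autJ g Z) ≠ 0 := by simpa using hZ
  simp only [rho, moebius_eq, map_div₀]
  field_simp

theorem norm_rho_moebius {g : GL (Fin 3) ℂ} (hg : g ∈ U21) {Z W : ℂ × ℂ} (hZ : autJ g Z ≠ 0)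
    (hW : autJ g W ≠ 0) :
    ‖autJ g Z‖ * ‖autJ g W‖ * ‖rho (moebius g Z) (moebius g W)‖ = ‖rho Z W‖ := by
  rw [← rho_moebius hg hZ hW, norm_mul, norm_mul, RCLike.norm_conj]

theorem height_moebius_mul {g : GL (Fin 3) ℂ} (hg : g ∈ U21) {Z : ℂ × ℂ} (hZ : autJ g Z ≠ 0) :
    ‖autJ g Z‖ ^ 2 * height (moebius g Z) = height Z := by
  have h := rho_moebius hg hZ hZ
  rw [rho_self, rho_self, mul_comm ((starRingEnd ℂ) _), Complex.mul_conj,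
    Complex.normSq_eq_norm_sq] at h
  exact_mod_cast h

theorem height_moebius {g : GL (Fin 3) ℂ} (hg : g ∈ U21) {Z : ℂ × ℂ} (hZ : autJ g Z ≠ 0) :
    height (moebius g Z) = height Z / ‖autJ g Z‖ ^ 2 := by
  rw [← height_moebius_mul hg hZ, mul_div_cancel_left₀]
  positivity

/-- If the last coordinate of the image vector vanished, the invariant form there would be minus a
square, whereas it equals the positive height of `Z`. -/
theorem autJ_ne_zero {g : GL (Fin 3) ℂ} (hg : g ∈ U21) {Z : ℂ × ℂ} (hZ : 0 < height Z) :
    autJ g Z ≠ 0 := by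
  intro h
  have e := lift_form hg Z Z
  rw [lift_two, h, rho_self] at e
  simp only [map_zero, zero_mul, add_zero, zero_sub, mul_comm ((starRingEnd ℂ) _),
    Complex.mul_conj] at e
  have e' : -(Complex.normSq (lift g Z 1)) = height Z := by exact_mod_cast e
  have := Complex.normSq_nonneg (lift g Z 1)
  linarith

theorem height_moebius_pos {g : GL (Fin 3) ℂ} (hg : g ∈ U21) {Z : ℂ × ℂ} (hZ : 0 < height Z) :
    0 < height (moebius g Z) := by
  have h := autJ_ne_zero hg hZ
  rw [height_moebius hg h]
  positivity

theorem lift_one_eq_zero {g : GL (Fin 3) ℂ} (hg : g ∈ U21) {W : ℂ × ℂ} (hW : height W = 0)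
    (h : autJ g W = 0) : lift g W 1 = 0 := by
  have e := lift_form hg W W
  rw [lift_two, h, rho_self, hW] at e
  simpa using e

/-- At most one boundary point is sent to `∞`. -/
theorem autJ_eq_zero_unique {g : GL (Fin 3) ℂ} (hg : g ∈ U21) {V W : ℂ × ℂ} (hV : height V = 0)
    (hW : height W = 0) (h : autJ g V = 0) (h' : autJ g W = 0) : V = W := by
  have e := lift_form hg V W
  rw [lift_two, lift_two, h, h', lift_one_eq_zero hg hV h] at e
  exact (rho_eq_zero_iff hV.ge hW).1 (by rw [← e]; simp)

/-- Unitarity moves `g` to the other argument of the form as its inverse. Working with `pairing`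
instead of `rho ∘ moebius` keeps this valid when `g⁻¹` sends `W` to `∞`. -/
theorem norm_pairing_inv {g : GL (Fin 3) ℂ} (hg : g ∈ U21) (Z W : ℂ × ℂ) (hZ : 0 < height Z) :
    ‖pairing g⁻¹ W Z‖ = ‖pairing g Z W‖ := by
  have hj := autJ_ne_zero hg hZ
  by_cases hW : autJ g⁻¹ W = 0
  · have hg' := U21.inv_mem hg
    have e := lift_form hg' W (moebius g Z)
    have hj' : autJ g⁻¹ (moebius g Z) ≠ 0 := by
      intro h; have := autJ_inv_moebius g Z hj; rw [h] at this; simp at this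
    have e1 : lift g⁻¹ (moebius g Z) 1 = autJ g⁻¹ (moebius g Z) * Z.2 := by
      have := congrArg Prod.snd (moebius_inv_moebius g Z hj)
      rw [← this, moebius_eq g⁻¹ (moebius g Z), mul_div_cancel₀ _ hj']
    rw [norm_pairing _ _ _ hj, norm_rho_comm, ← e, lift_two, lift_two, hW, e1]
    have e2 := autJ_inv_moebius g Z hj
    simp only [pairing, lift_two, hW, map_zero, zero_mul, add_zero]
    rw [← norm_mul]
    have : autJ g Z * ((starRingEnd ℂ) (lift g⁻¹ W 0) * autJ g⁻¹ (moebius g Z) -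
        (starRingEnd ℂ) (lift g⁻¹ W 1) * (autJ g⁻¹ (moebius g Z) * Z.2)) =
        ((starRingEnd ℂ) (lift g⁻¹ W 0) - (starRingEnd ℂ) (lift g⁻¹ W 1) * Z.2) *
          (autJ g⁻¹ (moebius g Z) * autJ g Z) := by ring
    rw [this, e2, mul_one]
  · have hj2 : autJ g (moebius g⁻¹ W) ≠ 0 := by
      have := autJ_inv_moebius g⁻¹ W hW
      rw [inv_inv] at this
      intro h; rw [h] at this; simp at this
    have e := norm_rho_moebius hg hj hj2
    have e2 := autJ_inv_moebius g⁻¹ W hW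
    have e3 := moebius_inv_moebius g⁻¹ W hW
    rw [inv_inv] at e2 e3
    rw [e3] at e
    have e4 : ‖autJ g (moebius g⁻¹ W)‖ * ‖autJ g⁻¹ W‖ = 1 := by rw [← norm_mul, e2, norm_one]
    rw [norm_pairing _ _ _ hj, norm_pairing _ _ _ hW, norm_rho_comm, ← e]
    linear_combination ‖autJ g Z‖ * ‖rho (moebius g Z) W‖ * e4

/-! The Poisson kernel and the point-pair invariant. -/

theorem poisson_pos {Z W : ℂ × ℂ} (hZ : 0 < height Z) (hW : 0 ≤ height W) : 0 < poisson Z W := by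
  have := norm_rho_pos hZ hW
  unfold poisson; positivity

theorem poisson_le {Z W : ℂ × ℂ} (hZ : 0 < height Z) (hW : 0 ≤ height W) :
    poisson Z W ≤ 2 / ‖rho Z W‖ := by
  have h := norm_rho_pos hZ hW
  rw [poisson, div_le_div_iff₀ (by positivity) h, pow_two, ← mul_assoc]
  exact mul_le_mul_of_nonneg_right (height_le_norm_rho hW) h.le

theorem poisson_moebius {g : GL (Fin 3) ℂ} (hg : g ∈ U21) {Z W : ℂ × ℂ} (hZ : 0 < height Z)
    (hW : autJ g W ≠ 0) :
    poisson (moebius g Z) (moebius g W) = poisson Z W * ‖autJ g W‖ ^ 2 := by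
  have hj := autJ_ne_zero hg hZ
  have h1 : ‖autJ g Z‖ ≠ 0 := by simpa using hj
  have h2 : ‖autJ g W‖ ≠ 0 := by simpa using hW
  rw [poisson, poisson, ← norm_rho_moebius hg hj hW, ← height_moebius_mul hg hj]
  field_simp

theorem poisson_moebius_right {g : GL (Fin 3) ℂ} (hg : g ∈ U21) {Z W : ℂ × ℂ} (hZ : 0 < height Z)
    (hW : autJ g W ≠ 0) :
    poisson Z (moebius g W) = poisson (moebius g⁻¹ Z) W * ‖autJ g W‖ ^ 2 := by
  have hZ' := height_moebius_pos (U21.inv_mem hg) hZ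
  rw [← poisson_moebius hg hZ' hW]
  congr 1
  have := moebius_inv_moebius g⁻¹ Z (autJ_ne_zero (U21.inv_mem hg) hZ)
  rw [inv_inv] at this
  exact this.symm

theorem one_le_sigma {Z W : ℂ × ℂ} (hZ : 0 < height Z) (hW : 0 < height W) : 1 ≤ sigma Z W := by
  rw [sigma, le_div_iff₀ (by positivity), one_mul]
  have h := height_add_le_norm_rho Z W
  nlinarith [sq_nonneg (height Z - height W), sq_nonneg ‖Z.2 - W.2‖]

theorem sigma_comm (Z W : ℂ × ℂ) : sigma Z W = sigma W Z := by
  rw [sigma, sigma, norm_rho_comm, mul_comm]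

theorem sigma_moebius {g : GL (Fin 3) ℂ} (hg : g ∈ U21) {Z W : ℂ × ℂ} (hZ : 0 < height Z)
    (hW : 0 < height W) : sigma (moebius g Z) (moebius g W) = sigma Z W := by
  have hj := autJ_ne_zero hg hZ
  have hj' := autJ_ne_zero hg hW
  have h1 : ‖autJ g Z‖ ≠ 0 := by simpa using hj
  have h2 : ‖autJ g W‖ ≠ 0 := by simpa using hj'
  rw [sigma, sigma, ← norm_rho_moebius hg hj hj', ← height_moebius_mul hg hj,
    ← height_moebius_mul hg hj']
  field_simp

end SiegelU21

/-! ### The discontinuity set and the convergence of the series. -/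

namespace SiegelU21

theorem act_coe (g : GL (Fin 3) ℂ) (W : ℂ × ℂ) :
    act g (W : OnePoint (ℂ × ℂ)) =
      if autJ g W = 0 then ∞ else ((moebius g W : ℂ × ℂ) : OnePoint (ℂ × ℂ)) := rfl

theorem act_coe_of_ne {g : GL (Fin 3) ℂ} {W : ℂ × ℂ} (h : autJ g W ≠ 0) :
    act g (W : OnePoint (ℂ × ℂ)) = ((moebius g W : ℂ × ℂ) : OnePoint (ℂ × ℂ)) := by
  rw [act_coe, if_neg h]

theorem act_mem_coe_image {g : GL (Fin 3) ℂ} {W : ℂ × ℂ} {D : Set (ℂ × ℂ)} :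
    act g (W : OnePoint (ℂ × ℂ)) ∈ OnePoint.some '' D ↔ autJ g W ≠ 0 ∧ moebius g W ∈ D := by
  rw [act_coe]
  split_ifs with h
  · simp [h]
  · simp [h]

theorem coe_mem_boundary {W : ℂ × ℂ} :
    (W : OnePoint (ℂ × ℂ)) ∈ boundary ↔ height W = 0 := by
  simp [boundary, siegelBoundary]

variable {Γ : Subgroup (GL (Fin 3) ℂ)}

theorem coe_mem_closure_orbit (hΓ : Γ ≤ U21) {Z : ℂ × ℂ} (hZ : 0 < height Z) (W : ℂ × ℂ) :
    (W : OnePoint (ℂ × ℂ)) ∈ closure (Set.range fun γ : Γ => act γ (Z : OnePoint (ℂ × ℂ))) ↔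
      W ∈ closure (Set.range fun γ : Γ => moebius γ Z) := by
  have : (Set.range fun γ : Γ => act γ (Z : OnePoint (ℂ × ℂ))) =
      OnePoint.some '' (Set.range fun γ : Γ => moebius γ Z) := by
    rw [← Set.range_comp]
    congr 1
    funext γ
    exact act_coe_of_ne (autJ_ne_zero (hΓ γ.2) hZ)
  rw [this, OnePoint.isOpenEmbedding_coe.isInducing.closure_eq_preimage_closure_image
    (Set.range fun γ : Γ => moebius γ Z)]
  rfl

theorem exists_le_norm_rho_iff (hΓ : Γ ≤ U21) {Z : ℂ × ℂ} (hZ : 0 < height Z) {W : ℂ × ℂ}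
    (hW : height W = 0) :
    (∃ ε > 0, ∀ γ : Γ, ε ≤ ‖rho (moebius γ Z) W‖) ↔
      W ∉ closure (Set.range fun γ : Γ => moebius γ Z) := by
  have hpos : ∀ γ : Γ, 0 ≤ height (moebius γ Z) := fun γ => (height_moebius_pos (hΓ γ.2) hZ).le
  rw [Metric.mem_closure_iff]
  push Not
  constructor
  · rintro ⟨ε, hε, h⟩
    obtain ⟨r, hr, hr'⟩ := exists_dist_lt_imp_norm_rho_lt W hW hε
    refine ⟨r, hr, ?_⟩
    rintro _ ⟨γ, rfl⟩
    by_contra! hlt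
    rw [dist_comm] at hlt
    exact absurd (hr' _ hlt) (h γ).not_gt
  · rintro ⟨r, hr, h⟩
    obtain ⟨ε, hε, hε'⟩ := exists_norm_rho_lt_imp_dist_lt hW hr
    refine ⟨ε, hε, fun γ => ?_⟩
    by_contra! hlt
    have := hε' _ (hpos γ) hlt
    rw [dist_comm] at this
    exact absurd this (h _ ⟨γ, rfl⟩).not_gt

/-- Two orbits have the same boundary accumulation points: |ρ(γZ, γZ')|² is the invariant σ times
the two heights, so it degenerates when the orbit approaches the boundary. The quasi-triangle
inequality then transfers the lower bound. -/
theorem exists_le_norm_rho_transfer (hΓ : Γ ≤ U21) {Z Z' : ℂ × ℂ} (hZ : 0 < height Z)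
    (hZ' : 0 < height Z') {W : ℂ × ℂ} (hW : height W = 0)
    (h : ∃ ε > 0, ∀ γ : Γ, ε ≤ ‖rho (moebius γ Z) W‖) :
    ∃ ε > 0, ∀ γ : Γ, ε ≤ ‖rho (moebius γ Z') W‖ := by
  obtain ⟨ε, hε, h⟩ := h
  have hσ := one_le_sigma hZ hZ'
  refine ⟨ε / (3 * (4 * sigma Z Z' + 1)), by positivity, fun γ => ?_⟩
  have h1 := height_moebius_pos (hΓ γ.2) hZ
  have h2 := height_moebius_pos (hΓ γ.2) hZ'
  set A := moebius γ Z
  set B := moebius γ Z'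
  -- Bound `height A` by `2‖rho A B‖` and `height B` by `2‖rho B W‖`, then cancel one factor `‖rho A
  -- B‖`.
  have h3 : ‖rho A B‖ ≤ 4 * sigma Z Z' * ‖rho B W‖ := by
    have e : ‖rho A B‖ ^ 2 = sigma Z Z' * (height A * height B) := by
      rw [← sigma_moebius (hΓ γ.2) hZ hZ', sigma, div_mul_cancel₀ _ (by positivity)]
    have h4 := height_le_norm_rho (Z := A) h2.le
    have h5 := height_le_norm_rho (Z := B) hW.ge
    have h6 := norm_rho_pos h1 h2.le
    have h7 : ‖rho A B‖ * ‖rho A B‖ ≤ (4 * sigma Z Z' * ‖rho B W‖) * ‖rho A B‖ := by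
      rw [← pow_two, e]
      calc sigma Z Z' * (height A * height B)
          ≤ sigma Z Z' * ((2 * ‖rho A B‖) * (2 * ‖rho B W‖)) := by gcongr
        _ = _ := by ring
    exact le_of_mul_le_mul_right h7 h6
  rw [div_le_iff₀ (by positivity)]
  have h8 := norm_rho_triangle h1.le h2.le hW.ge
  have h9 := h γ
  linarith

theorem coe_mem_discontinuitySet_iff (hΓ : Γ ≤ U21) {Z : ℂ × ℂ} (hZ : 0 < height Z) {W : ℂ × ℂ} :
    (W : OnePoint (ℂ × ℂ)) ∈ discontinuitySet Γ ↔
      height W = 0 ∧ ∃ ε > 0, ∀ γ : Γ, ε ≤ ‖rho (moebius γ Z) W‖ := by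
  rw [discontinuitySet, Set.mem_sdiff, coe_mem_boundary]
  refine and_congr_right fun hW => ?_
  constructor
  · intro h
    rw [exists_le_norm_rho_iff hΓ hZ hW, ← coe_mem_closure_orbit hΓ hZ]
    exact fun hc => h ⟨coe_mem_boundary.2 hW, Z, hZ, hc⟩
  · rintro h ⟨_, Z', hZ', hc⟩
    rw [coe_mem_closure_orbit hΓ hZ'] at hc
    exact (exists_le_norm_rho_iff hΓ hZ' hW).1 (exists_le_norm_rho_transfer hΓ hZ hZ' hW h) hc

theorem setOf_coe_mem_discontinuitySet (hΓ : Γ ≤ U21) {Z : ℂ × ℂ} (hZ : 0 < height Z) :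
    {W : ℂ × ℂ | (W : OnePoint (ℂ × ℂ)) ∈ discontinuitySet Γ} =
      siegelBoundary \ closure (Set.range fun γ : Γ => moebius γ Z) := by
  ext W
  rw [Set.mem_ofPred_eq, coe_mem_discontinuitySet_iff hΓ hZ, Set.mem_sdiff]
  refine and_congr_right fun hW => exists_le_norm_rho_iff hΓ hZ hW

/-- A base point of the Siegel domain. -/
noncomputable def basePoint : ℂ × ℂ := (1 / 2, 0)

theorem height_basePoint : height basePoint = 1 := by simp [height_eq, basePoint]

theorem height_basePoint_pos : 0 < height basePoint := by rw [height_basePoint]; norm_num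

/-- The finite part of the discontinuity set. -/
def finiteDisc (Γ : Subgroup (GL (Fin 3) ℂ)) : Set (ℂ × ℂ) :=
  {W | (W : OnePoint (ℂ × ℂ)) ∈ discontinuitySet Γ}

theorem isClosed_siegelBoundary : IsClosed siegelBoundary :=
  isClosed_eq continuous_height continuous_const

theorem finiteDisc_eq (hΓ : Γ ≤ U21) : finiteDisc Γ =
    siegelBoundary \ closure (Set.range fun γ : Γ => moebius γ basePoint) :=
  setOf_coe_mem_discontinuitySet hΓ height_basePoint_pos

theorem measurableSet_finiteDisc (hΓ : Γ ≤ U21) : MeasurableSet (finiteDisc Γ) := by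
  rw [finiteDisc_eq hΓ]
  exact isClosed_siegelBoundary.measurableSet.diff isClosed_closure.measurableSet

theorem height_of_mem_finiteDisc {W : ℂ × ℂ} (hW : W ∈ finiteDisc Γ) : height W = 0 :=
  coe_mem_boundary.1 hW.1

theorem exists_le_norm_rho (hΓ : Γ ≤ U21) {Z W : ℂ × ℂ} (hZ : 0 < height Z)
    (hW : W ∈ finiteDisc Γ) : ∃ ε > 0, ∀ γ : Γ, ε ≤ ‖rho (moebius γ Z) W‖ :=
  ((coe_mem_discontinuitySet_iff hΓ hZ).1 hW).2

theorem continuousAt_moebius (g : GL (Fin 3) ℂ) {W : ℂ × ℂ} (h : autJ g W ≠ 0) :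
    ContinuousAt (moebius g) W := by
  unfold moebius
  have : ContinuousAt (autJ g) W := by unfold autJ; fun_prop
  refine ContinuousAt.prodMk ?_ ?_ <;> exact ContinuousAt.div (by fun_prop) this h

theorem moebius_mem_finiteDisc (hΓ : Γ ≤ U21) {γ : GL (Fin 3) ℂ} (hγ : γ ∈ Γ) {W : ℂ × ℂ}
    (hW : W ∈ finiteDisc Γ) (hj : autJ γ W ≠ 0) : moebius γ W ∈ finiteDisc Γ := by
  rw [finiteDisc_eq hΓ] at *
  obtain ⟨hW0, hW⟩ := hW
  have hh : height (moebius γ W) = 0 := by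
    rw [height_moebius (hΓ hγ) hj, show height W = 0 from hW0, zero_div]
  refine ⟨hh, fun hc => hW ?_⟩
  have hj' : autJ γ⁻¹ (moebius γ W) ≠ 0 := by
    intro h; have := autJ_inv_moebius γ W hj; rw [h] at this; simp at this
  have := mem_closure_image (continuousAt_moebius γ⁻¹ hj') hc
  rw [moebius_inv_moebius γ W hj] at this
  refine closure_mono ?_ this
  rintro _ ⟨_, ⟨β, rfl⟩, rfl⟩
  refine ⟨⟨γ⁻¹, Γ.inv_mem hγ⟩ * β, ?_⟩
  exact moebius_mul _ _ _ (autJ_ne_zero (hΓ β.2) height_basePoint_pos)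

/-! Convergence of the series. -/

theorem criticalExponent_nonneg : 0 ≤ criticalExponent Γ := by
  refine le_sInf ?_
  rintro _ ⟨s, rfl, hs, _⟩
  exact_mod_cast hs.le

theorem exists_summable_of_criticalExponent_lt {t : ℝ} (ht : criticalExponent Γ < (t : EReal)) :
    ∃ s : ℝ, 0 < s ∧ s < t ∧ ∃ Z ∈ siegel, ∃ Z' ∈ siegel,
      Summable fun γ : Γ => sigma Z (moebius γ Z') ^ (-s) := by
  obtain ⟨_, ⟨s, rfl, hs, h⟩, hlt⟩ := sInf_lt_iff.1 ht
  exact ⟨s, hs, by exact_mod_cast hlt, h⟩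

theorem sigma_le_mul {A B V : ℂ × ℂ} (hA : 0 < height A) (hB : 0 < height B) (hV : 0 < height V) :
    sigma A V ≤ (3 * (‖rho A B‖ / (height B / 2) + 1)) ^ 2 * (height B / height A) * sigma B V := by
  have h := norm_rho_le_mul (A := A) (B := B) (V := V) hA.le hB.le hV.le (half_pos hB)
    (by have := height_le_norm_rho (Z := B) hV.le; linarith)
  have h2 := pow_le_pow_left₀ (norm_nonneg _) h 2
  rw [mul_pow] at h2
  rw [sigma, sigma, div_le_iff₀ (by positivity)]
  refine h2.trans (le_of_eq ?_)
  field_simp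

theorem rpow_neg_le_of_le_mul {a b C t : ℝ} (hb : 0 < b) (hC : 0 < C) (ht : 0 ≤ t) (ha : 0 < a)
    (h : b ≤ C * a) : a ^ (-t) ≤ C ^ t * b ^ (-t) := by
  rw [Real.rpow_neg ha.le, Real.rpow_neg hb.le, ← div_eq_mul_inv,
    le_div_iff₀ (Real.rpow_pos_of_pos hb t), inv_mul_eq_div, div_le_iff₀ (Real.rpow_pos_of_pos ha t),
    ← Real.mul_rpow hC.le ha.le]
  exact Real.rpow_le_rpow hb.le h ht

theorem summable_sigma_of_base (hΓ : Γ ≤ U21) {t : ℝ} (ht : 0 ≤ t) {A B V : ℂ × ℂ}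
    (hA : 0 < height A) (hB : 0 < height B) (hV : 0 < height V)
    (h : Summable fun γ : Γ => sigma A (moebius γ V) ^ (-t)) :
    Summable fun γ : Γ => sigma B (moebius γ V) ^ (-t) := by
  have hp : 0 < (3 * (‖rho A B‖ / (height B / 2) + 1)) ^ 2 * (height B / height A) := by positivity
  refine Summable.of_nonneg_of_le (fun γ => ?_) (fun γ => ?_)
    (h.mul_left (((3 * (‖rho A B‖ / (height B / 2) + 1)) ^ 2 * (height B / height A)) ^ t))
  · have := one_le_sigma hB (height_moebius_pos (hΓ γ.2) hV)
    positivity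
  · have hγ := height_moebius_pos (hΓ γ.2) hV
    have h1 := one_le_sigma hA hγ
    have h2 := one_le_sigma hB hγ
    exact rpow_neg_le_of_le_mul (by linarith) hp ht (by linarith) (sigma_le_mul hA hB hγ)

theorem summable_sigma_swap (hΓ : Γ ≤ U21) {t : ℝ} {A V : ℂ × ℂ}
    (hA : 0 < height A) (hV : 0 < height V)
    (h : Summable fun γ : Γ => sigma A (moebius γ V) ^ (-t)) :
    Summable fun γ : Γ => sigma V (moebius γ A) ^ (-t) := by
  rw [← (Equiv.inv Γ).summable_iff] at h
  refine h.congr fun γ => ?_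
  have hγ' := height_moebius_pos (hΓ γ.2) hA
  have h1 := sigma_moebius (U21.inv_mem (hΓ γ.2)) hγ' hV
  rw [moebius_inv_moebius _ _ (autJ_ne_zero (hΓ γ.2) hA)] at h1
  simp only [Function.comp, Equiv.inv_apply, InvMemClass.coe_inv]
  rw [h1, sigma_comm]

/-- The quasi-triangle inequality changes the first base point, and γ ↦ γ⁻¹ exchanges the two;
applying this twice reaches arbitrary base points. Passing from the exponent given by the infimum to
`t` uses σ ≥ 1. -/
theorem summable_sigma (hΓ : Γ ≤ U21) {t : ℝ} (ht : criticalExponent Γ < (t : EReal))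
    {A V : ℂ × ℂ} (hA : 0 < height A) (hV : 0 < height V) :
    Summable fun γ : Γ => sigma A (moebius γ V) ^ (-t) := by
  obtain ⟨s, hs, hst, Z, hZ, Z', hZ', h⟩ := exists_summable_of_criticalExponent_lt ht
  have h1 := summable_sigma_of_base hΓ hs.le hZ hV hZ' h
  have h2 := summable_sigma_swap hΓ hV hZ' h1
  have h3 := summable_sigma_of_base hΓ hs.le hZ' hA hV h2
  refine Summable.of_nonneg_of_le (fun γ => ?_) (fun γ => ?_) h3
  · have := one_le_sigma hA (height_moebius_pos (hΓ γ.2) hV)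
    positivity
  · exact Real.rpow_le_rpow_of_exponent_le (one_le_sigma hA (height_moebius_pos (hΓ γ.2) hV))
      (by linarith)

/-- A summable family has countable support, and here every term is positive. -/
theorem countable_of_criticalExponent_lt (hΓ : Γ ≤ U21) {t : ℝ}
    (ht : criticalExponent Γ < (t : EReal)) : Countable Γ := by
  have h := summable_sigma hΓ ht height_basePoint_pos height_basePoint_pos
  have hs := h.countable_support
  have : Function.support (fun γ : Γ => sigma basePoint (moebius γ basePoint) ^ (-t)) =
      Set.univ := by
    refine Set.eq_univ_of_forall fun γ => ?_
    have := one_le_sigma height_basePoint_pos (height_moebius_pos (hΓ γ.2) height_basePoint_pos)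
    exact (Real.rpow_pos_of_pos (by linarith) _).ne'
  rw [this] at hs
  exact Set.countable_univ_iff.1 hs

/-- Since γZ stays away from `W`, |ρ(Z, γZ)| is at most a constant times |ρ(W, γZ)|; this compares
the Eisenstein series with the σ-series. -/
theorem exists_poisson_le_sigma (hΓ : Γ ≤ U21) {Z W : ℂ × ℂ} (hZ : 0 < height Z)
    (hW : W ∈ finiteDisc Γ) :
    ∃ C > 0, ∀ γ : Γ, sigma Z (moebius γ Z) ≤ C * (poisson (moebius γ Z) W)⁻¹ := by
  obtain ⟨ε, hε, h⟩ := exists_le_norm_rho hΓ hZ hW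
  have hW0 := height_of_mem_finiteDisc hW
  refine ⟨(3 * (‖rho Z W‖ / ε + 1)) ^ 2 / height Z, by positivity, fun γ => ?_⟩
  have hγ := height_moebius_pos (hΓ γ.2) hZ
  have h1 := norm_rho_le_mul (A := Z) (B := W) (V := moebius γ Z) hZ.le hW0.ge hγ.le hε
    (by rw [norm_rho_comm]; exact h γ)
  have h2 := pow_le_pow_left₀ (norm_nonneg _) h1 2
  rw [mul_pow, norm_rho_comm _ W] at h2
  rw [sigma, div_le_iff₀ (by positivity), poisson]
  refine h2.trans (le_of_eq ?_)
  field_simp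

theorem summable_poisson (hΓ : Γ ≤ U21) {t : ℝ} (ht : criticalExponent Γ < (t : EReal))
    {Z W : ℂ × ℂ} (hZ : 0 < height Z) (hW : W ∈ finiteDisc Γ) :
    Summable fun γ : Γ => poisson (moebius γ Z) W ^ t := by
  obtain ⟨C, hC, h⟩ := exists_poisson_le_sigma hΓ hZ hW
  have ht0 : (0 : ℝ) < t := by
    exact_mod_cast (criticalExponent_nonneg (Γ := Γ)).trans_lt ht
  have hW0 := height_of_mem_finiteDisc hW
  refine Summable.of_nonneg_of_le (fun γ => ?_) (fun γ => ?_)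
    ((summable_sigma hΓ ht hZ hZ).mul_left (C ^ t))
  · exact Real.rpow_nonneg (poisson_pos (height_moebius_pos (hΓ γ.2) hZ) hW0.ge).le _
  · have hγ := height_moebius_pos (hΓ γ.2) hZ
    have hp := poisson_pos hγ hW0.ge
    have h1 := one_le_sigma hZ hγ
    have := rpow_neg_le_of_le_mul (t := t) (by linarith) hC ht0.le (inv_pos.2 hp) (h γ)
    rwa [Real.inv_rpow hp.le, Real.rpow_neg hp.le, inv_inv] at this

theorem norm_eisensteinTerm {Z W : ℂ × ℂ} {s : ℂ} {g : GL (Fin 3) ℂ} (hg : g ∈ U21)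
    (hZ : 0 < height Z) (hW : height W = 0) :
    ‖eisensteinTerm Z W s g‖ = poisson (moebius g Z) W ^ s.re :=
  Complex.norm_cpow_eq_rpow_re_of_pos (poisson_pos (height_moebius_pos hg hZ) hW.ge) _

theorem summable_norm_eisensteinTerm (hΓ : Γ ≤ U21) {s : ℂ}
    (hs : criticalExponent Γ < (s.re : EReal)) {Z W : ℂ × ℂ} (hZ : 0 < height Z)
    (hW : W ∈ finiteDisc Γ) : Summable fun γ : Γ => ‖eisensteinTerm Z W s γ‖ :=
  (summable_poisson hΓ hs hZ hW).congr fun γ =>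
    (norm_eisensteinTerm (hΓ γ.2) hZ (height_of_mem_finiteDisc hW)).symm

theorem eventually_poisson_lt (hΓ : Γ ≤ U21) (hδ : criticalExponent Γ < 1)
    {Z W : ℂ × ℂ} (hZ : 0 < height Z) (hW : W ∈ finiteDisc Γ) {τ : ℝ} (hτ : 0 < τ) :
    ∀ᶠ γ : Γ in Filter.cofinite, poisson (moebius γ Z) W < τ := by
  have h := summable_poisson (t := 1) hΓ (by exact_mod_cast hδ) hZ hW
  simp only [Real.rpow_one] at h
  exact h.tendsto_cofinite_zero.eventually (gt_mem_nhds hτ)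

/-- `Γ` acts properly discontinuously on `Ω(Γ)`. -/
theorem eventually_le_norm_rho (hΓ : Γ ≤ U21) (hδ : criticalExponent Γ < 1)
    {W W' : ℂ × ℂ} (hW : W ∈ finiteDisc Γ) (hW' : W' ∈ finiteDisc Γ) :
    ∃ ε > 0, ∀ᶠ γ : Γ in Filter.cofinite, autJ γ W' ≠ 0 → ε ≤ ‖rho (moebius γ W') W‖ := by
  set Z := basePoint
  have hZ : 0 < height Z := height_basePoint_pos
  have hW0 := height_of_mem_finiteDisc hW
  have hW'0 := height_of_mem_finiteDisc hW'
  obtain ⟨ε, hε, h⟩ := exists_le_norm_rho hΓ hZ hW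
  refine ⟨ε / 12, by positivity, ?_⟩
  set M := 3 * (‖rho Z W‖ + ε / 12)
  have hM : 0 < M := by positivity
  have hP := poisson_pos hZ hW'0.ge
  -- Assume V = γW' is within ε/12 of W. Then P(Z, V) is bounded below, yet it is at most τ|j|², so
  -- |j| is large and P(γZ, V) = P(Z, W')|j|² ≥ L. By `poisson_le`, γZ is within 2/L = ε/12 of V,
  -- hence within ε/2 of W, against the choice of ε.
  set L := 24 / ε
  obtain ⟨τ, hτ, hτ'⟩ : ∃ τ > 0, τ * L ≤ poisson Z W' * (height Z / M ^ 2) :=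
    ⟨poisson Z W' * (height Z / M ^ 2) / L, by positivity, (div_mul_cancel₀ _ (by positivity)).le⟩
  -- The smallness is needed for γ⁻¹Z, because P(Z, γW') is expressed through γ⁻¹Z; inversion
  -- preserves cofinite sets.
  have hev := eventually_poisson_lt hΓ hδ hZ hW' hτ
  have hev' := (inv_injective (G := Γ)).tendsto_cofinite.eventually hev
  filter_upwards [hev'] with γ hγ hj
  by_contra! hlt
  set V := moebius γ W'
  have hV0 : height V = 0 := by rw [height_moebius (hΓ γ.2) hj, hW'0, zero_div]
  have hB := height_moebius_pos (hΓ γ.2) hZ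
  set B := moebius γ Z
  have h1 : ‖rho Z V‖ ≤ M := by
    have := norm_rho_triangle (A := Z) (B := W) (C := V) hZ.le hW0.ge hV0.ge
    rw [norm_rho_comm V W] at this
    exact this.trans (by simp only [M]; linarith)
  have h1' := norm_rho_pos hZ hV0.ge
  have h2 : height Z / M ^ 2 ≤ poisson Z V := by
    unfold poisson; gcongr
  have h3 : poisson Z V ≤ τ * ‖autJ γ W'‖ ^ 2 := by
    rw [poisson_moebius_right (hΓ γ.2) hZ hj]
    gcongr
    simpa using hγ.le
  have h4 : L ≤ poisson B V := by
    rw [poisson_moebius (hΓ γ.2) hZ hj]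
    have : τ * L ≤ τ * (poisson Z W' * ‖autJ γ W'‖ ^ 2) := by
      calc _ ≤ _ := hτ'
        _ ≤ poisson Z W' * (τ * ‖autJ γ W'‖ ^ 2) := by gcongr; exact h2.trans h3
        _ = _ := by ring
    exact le_of_mul_le_mul_left this hτ
  have h5 := h4.trans (poisson_le hB hV0.ge)
  have h6 := norm_rho_pos hB hV0.ge
  have h7 : ‖rho B V‖ ≤ ε / 12 := by
    rw [le_div_iff₀ h6] at h5
    simp only [L] at h5
    rw [div_mul_eq_mul_div, div_le_iff₀ hε] at h5
    linarith
  have h8 := norm_rho_triangle (A := B) (B := V) (C := W) hB.le hV0.ge hW0.ge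
  have h9 : ε ≤ ‖rho B W‖ := h γ
  linarith

/-- Compares S-matrix terms with σ(Z, γZ). `W'` may be replaced by `Z` because γW stays away from W'
for almost all γ. After passing to the adjoint, `W` may be replaced by `Z` because γ⁻¹Z stays away
from W. -/
theorem exists_pairing_le (hΓ : Γ ≤ U21) (hδ : criticalExponent Γ < 1)
    {Z W W' : ℂ × ℂ} (hZ : 0 < height Z) (hW : W ∈ finiteDisc Γ) (hW' : W' ∈ finiteDisc Γ) :
    ∃ C > 0, ∀ᶠ γ : Γ in Filter.cofinite,
      ‖pairing γ Z Z‖ ≤ C * ‖pairing γ W W'‖ := by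
  have hW0 := height_of_mem_finiteDisc hW
  have hW'0 := height_of_mem_finiteDisc hW'
  obtain ⟨ε, hε, h⟩ := exists_le_norm_rho hΓ hZ hW
  obtain ⟨ε', hε', h'⟩ := eventually_le_norm_rho hΓ hδ hW' hW
  set C₁ := 3 * (‖rho Z W‖ / ε + 1)
  set C₂ := 3 * (‖rho Z W'‖ / ε' + 1)
  have hC₁ : 0 < C₁ := by positivity
  have hC₂ : 1 ≤ C₂ := by
    have : 0 ≤ ‖rho Z W'‖ / ε' := by positivity
    simp only [C₂]; linarith
  refine ⟨C₁ * C₂, by positivity, ?_⟩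
  filter_upwards [h'] with γ hγ
  have h1 : ‖pairing γ W Z‖ ≤ C₂ * ‖pairing γ W W'‖ := by
    -- If γW = ∞, the image vector is a multiple of (1, 0, 0) and the pairing does not depend on its
    -- second argument.
    by_cases hj : autJ γ W = 0
    · have : ∀ A, pairing γ W A = (starRingEnd ℂ) (lift γ W 0) := fun A => by
        simp [pairing, lift_two, hj, lift_one_eq_zero (hΓ γ.2) hW0 hj]
      rw [this, this]
      exact le_mul_of_one_le_left (norm_nonneg _) hC₂
    · rw [norm_pairing _ _ _ hj, norm_pairing _ _ _ hj]
      have hV : height (moebius γ W) = 0 := by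
        rw [height_moebius (hΓ γ.2) hj, hW0, zero_div]
      have := norm_rho_le_mul (A := Z) (B := W') (V := moebius γ W) hZ.le hW'0.ge hV.ge hε'
        (by rw [norm_rho_comm]; exact hγ hj)
      rw [norm_rho_comm, norm_rho_comm (moebius γ W) W'] at this
      calc _ ≤ ‖autJ γ W‖ * (C₂ * ‖rho (moebius γ W) W'‖) := by gcongr
        _ = _ := by ring
  have h2 : ‖pairing γ Z Z‖ ≤ C₁ * ‖pairing γ W Z‖ := by
    have hi := U21.inv_mem (hΓ γ.2)
    rw [← norm_pairing_inv (hΓ γ.2) Z Z hZ]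
    have e := norm_pairing_inv hi Z W hZ
    rw [inv_inv] at e
    rw [e]
    have hj := autJ_ne_zero hi hZ
    rw [norm_pairing _ _ _ hj, norm_pairing _ _ _ hj]
    have := norm_rho_le_mul (A := Z) (B := W) (V := moebius (γ : GL (Fin 3) ℂ)⁻¹ Z) hZ.le hW0.ge
      (height_moebius_pos hi hZ).le hε
      (by rw [norm_rho_comm]; exact h (γ⁻¹))
    rw [norm_rho_comm, norm_rho_comm _ W] at this
    calc _ ≤ ‖autJ (γ : GL (Fin 3) ℂ)⁻¹ Z‖ * (C₁ * ‖rho (moebius (γ : GL (Fin 3) ℂ)⁻¹ Z) W‖) := by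
          gcongr
      _ = _ := by ring
  calc _ ≤ _ := h2
    _ ≤ C₁ * (C₂ * ‖pairing γ W W'‖) := by gcongr
    _ = _ := by ring

theorem sigma_eq_pairing {g : GL (Fin 3) ℂ} (hg : g ∈ U21) {Z : ℂ × ℂ} (hZ : 0 < height Z) :
    sigma Z (moebius g Z) = ‖pairing g Z Z‖ ^ 2 / height Z ^ 2 := by
  have hj := autJ_ne_zero hg hZ
  have h1 : ‖autJ g Z‖ ≠ 0 := by simpa using hj
  rw [norm_pairing _ _ _ hj, sigma, height_moebius hg hj, norm_rho_comm]
  field_simp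

theorem norm_sMatrixTerm {W W' : ℂ × ℂ} {s : ℂ} {g : GL (Fin 3) ℂ} (hs : 0 < s.re) :
    ‖sMatrixTerm W W' s g‖ = (‖rho (moebius g W) W'‖ * ‖autJ g W‖) ^ (-2 * s.re) := by
  have hre : (-2 * s).re = -2 * s.re := by simp
  have key : ∀ x : ℝ, 0 ≤ x → ‖(x : ℂ) ^ (-2 * s)‖ = x ^ (-2 * s.re) := by
    intro x hx
    rw [← hre]
    refine Complex.norm_cpow_eq_rpow_re_of_nonneg hx ?_
    rw [hre]; linarith
  rw [sMatrixTerm, norm_mul, key _ (norm_nonneg _), key _ (norm_nonneg _),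
    Real.mul_rpow (norm_nonneg _) (norm_nonneg _)]

theorem summable_norm_sMatrixTerm (hΓ : Γ ≤ U21) (hδ : criticalExponent Γ < 1) {s : ℂ}
    (hs : criticalExponent Γ < (s.re : EReal)) {W W' : ℂ × ℂ}
    (hW : W ∈ finiteDisc Γ) (hW' : W' ∈ finiteDisc Γ) :
    Summable fun γ : Γ => ‖sMatrixTerm W W' s γ‖ := by
  set Z := basePoint
  have hZ : 0 < height Z := height_basePoint_pos
  have hs0 : (0 : ℝ) < s.re := by
    exact_mod_cast (criticalExponent_nonneg (Γ := Γ)).trans_lt hs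
  obtain ⟨C, hC, h⟩ := exists_pairing_le hΓ hδ hZ hW hW'
  refine Summable.of_norm_bounded_eventually
    ((summable_sigma hΓ hs hZ hZ).mul_left ((C ^ 2 / height Z ^ 2) ^ s.re)) ?_
  filter_upwards [h] with γ hγ
  have h1 := one_le_sigma hZ (height_moebius_pos (hΓ γ.2) hZ)
  rw [norm_norm, norm_sMatrixTerm hs0]
  -- These are the terms with γW equal to W' or ∞; a zero base with nonzero exponent gives the value
  -- 0.
  by_cases hp : ‖rho (moebius γ W) W'‖ * ‖autJ γ W‖ = 0
  · rw [hp, Real.zero_rpow (by linarith)]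
    positivity
  · have hp' : 0 < ‖rho (moebius γ W) W'‖ * ‖autJ γ W‖ := lt_of_le_of_ne (by positivity) (Ne.symm hp)
    have hj : autJ γ W ≠ 0 := by rintro h0; simp [h0] at hp
    rw [norm_pairing _ _ _ hj, mul_comm ‖autJ _ _‖] at hγ
    have e : (‖rho (moebius γ W) W'‖ * ‖autJ γ W‖) ^ (-2 * s.re) =
        ((‖rho (moebius γ W) W'‖ * ‖autJ γ W‖) ^ 2) ^ (-s.re) := by
      rw [← Real.rpow_natCast, ← Real.rpow_mul hp'.le]
      norm_num
    rw [e]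
    refine rpow_neg_le_of_le_mul (by linarith) (by positivity) hs0.le (by positivity) ?_
    rw [sigma_eq_pairing (hΓ γ.2) hZ, div_mul_eq_mul_div, ← mul_pow]
    gcongr

end SiegelU21

/-! ### The boundary measure and its transformation under U(2,1). -/

namespace SiegelU21

open scoped ENNReal NNReal

/-! Change of variables on `ℂ` and `ℝ`. -/

theorem lintegral_image_holomorphic {S : Set ℂ} (hS : MeasurableSet S) {f f' : ℂ → ℂ}
    (hf : ∀ z ∈ S, HasDerivAt f (f' z) z) (hinj : Set.InjOn f S) (G : ℂ → ℝ≥0∞) :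
    ∫⁻ z in f '' S, G z = ∫⁻ z in S, ENNReal.ofReal (‖f' z‖ ^ 2) * G (f z) := by
  have h := lintegral_image_eq_lintegral_abs_det_fderiv_mul volume hS
    (f' := fun z => (ContinuousLinearMap.toSpanSingleton ℂ (f' z)).restrictScalars ℝ)
    (fun z hz => ((hf z hz).hasFDerivAt.restrictScalars ℝ).hasFDerivWithinAt) hinj G
  rw [h]
  congr with z
  -- The real determinant is the norm from ℂ to ℝ of the complex determinant.
  have : (ContinuousLinearMap.restrictScalars ℝ
      (ContinuousLinearMap.toSpanSingleton ℂ (f' z))).det = ‖f' z‖ ^ 2 := by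
    have := LinearMap.det_restrictScalars (R := ℝ)
      (f := (ContinuousLinearMap.toSpanSingleton ℂ (f' z)).toLinearMap)
    rw [ContinuousLinearMap.det]
    refine this.trans ?_
    rw [Algebra.norm_complex_apply, Complex.normSq_eq_norm_sq]
    congr 2
    simp
  rw [this, abs_of_nonneg (by positivity)]

theorem lintegral_comp_affine_complex {a : ℂ} (ha : a ≠ 0) (b : ℂ) (G : ℂ → ℝ≥0∞) :
    ∫⁻ z, G z = ∫⁻ z, ENNReal.ofReal (‖a‖ ^ 2) * G (a * z + b) := by
  have h := lintegral_image_holomorphic (S := Set.univ) MeasurableSet.univ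
    (f := fun z => a * z + b) (f' := fun _ => a)
    (fun z _ => by simpa using ((hasDerivAt_id z).const_mul a).add_const b)
    (fun x _ y _ hxy => by simpa [ha] using hxy) G
  have hs : (fun z => a * z + b) '' Set.univ = Set.univ := by
    refine Set.eq_univ_of_forall fun z => ⟨(z - b) / a, trivial, ?_⟩
    field_simp; ring
  rwa [hs, setLIntegral_univ, setLIntegral_univ] at h

/-- This substitution is the effect of the inversion on `w` once `t` is rescaled by `‖w‖²`. It is
antiholomorphic, hence split into a holomorphic inversion and a measure-preserving conjugation. -/
theorem lintegral_comp_inv_conj {a : ℂ} (ha : a ≠ 0) {G : ℂ → ℝ≥0∞} (hG : Measurable G) :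
    ∫⁻ z, G z = ∫⁻ z : ℂ, ENNReal.ofReal ((‖a‖ ^ 2 * ‖z‖ ^ 4)⁻¹) *
      G (-((starRingEnd ℂ) z * a)⁻¹) := by
  have h := lintegral_image_holomorphic (S := {0}ᶜ) (measurableSet_singleton _).compl
    (f := fun z => -(z * a)⁻¹) (f' := fun z => (z ^ 2 * a)⁻¹)
    (fun z hz => by
      have hz : z ≠ 0 := hz
      have h1 := (((hasDerivAt_id z).mul_const a).inv (mul_ne_zero hz ha)).neg
      refine h1.congr_deriv ?_
      simp only [id]
      field_simp)
    (fun x hx y hy hxy => by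
      have hx : x ≠ 0 := hx
      have hy : y ≠ 0 := hy
      simpa [ha] using hxy) G
  have hs : (fun z : ℂ => -(z * a)⁻¹) '' {0}ᶜ = {0}ᶜ := by
    ext z
    constructor
    · rintro ⟨y, hy, rfl⟩
      have hy : y ≠ 0 := hy
      simp [ha, hy]
    · intro hz
      have hz : z ≠ 0 := hz
      refine ⟨-(z * a)⁻¹, by simp [ha, hz], ?_⟩
      simp only; field_simp
  have hr : (volume : Measure ℂ).restrict {0}ᶜ = volume := by
    rw [Measure.restrict_eq_self_of_ae_mem]
    exact compl_mem_ae_iff.2 (measure_singleton 0)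
  rw [hs, hr] at h
  rw [h]
  have hc : MeasurePreserving (starRingEnd ℂ) (volume : Measure ℂ) volume :=
    Complex.conjLIE.measurePreserving
  have hm : Measurable fun z : ℂ => ENNReal.ofReal (‖(z ^ 2 * a)⁻¹‖ ^ 2) * G (-(z * a)⁻¹) := by
    fun_prop
  rw [← hc.lintegral_comp hm]
  congr with z
  congr 2
  rw [norm_inv, norm_mul, norm_pow, RCLike.norm_conj, inv_pow, mul_pow, ← pow_mul, mul_comm]

theorem lintegral_comp_affine_real {r : ℝ} (hr : r ≠ 0) (b : ℝ) (G : ℝ → ℝ≥0∞) :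
    ∫⁻ t, G t = ∫⁻ t, ENNReal.ofReal |r| * G (r * t + b) := by
  have h := lintegral_image_eq_lintegral_abs_deriv_mul (s := Set.univ) MeasurableSet.univ
    (f := fun z => r * z + b) (f' := fun _ => r)
    (fun z _ => by
      have h1 := (((hasDerivAt_id z).const_mul r).add_const b).hasDerivWithinAt (s := Set.univ)
      rwa [mul_one] at h1)
    (fun x _ y _ hxy => by simpa [hr] using hxy) G
  have hs : (fun z => r * z + b) '' Set.univ = Set.univ := by
    refine Set.eq_univ_of_forall fun z => ⟨(z - b) / r, trivial, ?_⟩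
    field_simp; ring
  rwa [hs, setLIntegral_univ, setLIntegral_univ] at h

/-! The boundary measure. -/

/-- The parametrization of the finite boundary. -/
noncomputable def param (p : ℂ × ℝ) : ℂ × ℂ := (((‖p.1‖ ^ 2 / 2 : ℝ) : ℂ) + p.2 * I, p.1)

theorem boundaryMeasure_eq : boundaryMeasure = (volume : Measure (ℂ × ℝ)).map param := rfl

theorem continuous_param : Continuous param := by unfold param; fun_prop

theorem param_coord (p : ℂ × ℝ) : ((param p).2, (param p).1.im) = p := by
  simp [param, -ofReal_pow]

theorem height_param (p : ℂ × ℝ) : height (param p) = 0 := by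
  rw [height_eq]
  simp only [param, add_re, ofReal_re, mul_re, I_re, I_im, ofReal_im]
  ring

theorem param_of_height_eq_zero {W : ℂ × ℂ} (hW : height W = 0) : param (W.2, W.1.im) = W := by
  rw [height_eq] at hW
  refine Prod.ext (Complex.ext ?_ ?_) rfl
  · simp only [param, add_re, ofReal_re, mul_re, I_re, I_im, ofReal_im]
    linarith
  · simp [param, -ofReal_pow]

theorem measurableEmbedding_param : MeasurableEmbedding param :=
  continuous_param.measurable.measurableEmbedding
    (Function.LeftInverse.injective (g := fun W : ℂ × ℂ => (W.2, W.1.im)) param_coord)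

theorem ae_height_eq_zero : ∀ᵐ W ∂boundaryMeasure, height W = 0 := by
  rw [boundaryMeasure_eq, measurableEmbedding_param.ae_map_iff]
  exact ae_of_all _ height_param

theorem lintegral_boundaryMeasure (f : ℂ × ℂ → ℝ≥0∞) :
    ∫⁻ W, f W ∂boundaryMeasure = ∫⁻ p, f (param p) := by
  rw [boundaryMeasure_eq, measurableEmbedding_param.lintegral_map]

theorem lintegral_boundaryMeasure' {f : ℂ × ℂ → ℝ≥0∞} (hf : Measurable f) :
    ∫⁻ W, f W ∂boundaryMeasure = ∫⁻ w : ℂ, ∫⁻ t : ℝ, f (param (w, t)) := by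
  rw [lintegral_boundaryMeasure, Measure.volume_eq_prod,
    lintegral_prod (fun p => f (param p)) (hf.comp continuous_param.measurable).aemeasurable]

instance : SFinite boundaryMeasure := by
  rw [boundaryMeasure_eq]; infer_instance

instance : NullSingletonClass boundaryMeasure := by
  refine ⟨fun W => ?_⟩
  rw [boundaryMeasure_eq, measurableEmbedding_param.map_apply]
  have : (param ⁻¹' {W}).Subsingleton := fun p hp q hq =>
    measurableEmbedding_param.injective ((Set.mem_singleton_iff.1 hp).trans
      (Set.mem_singleton_iff.1 hq).symm)
  rw [Measure.volume_eq_prod]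
  exact this.measure_zero _

theorem ae_autJ_ne_zero {g : GL (Fin 3) ℂ} (hg : g ∈ U21) :
    ∀ᵐ W ∂boundaryMeasure, autJ g W ≠ 0 := by
  have : {W | height W = 0 ∧ autJ g W = 0}.Subsingleton := fun V hV W hW =>
    autJ_eq_zero_unique hg hV.1 hW.1 hV.2 hW.2
  have h0 := this.measure_zero boundaryMeasure
  filter_upwards [ae_height_eq_zero, measure_eq_zero_iff_ae_notMem.1 h0] with W h1 h2 h3
  exact h2 ⟨h1, h3⟩

/-! The Jacobian of the action of `U(2, 1)` on the boundary. -/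

/-- The Jacobian `|j(g, W)|⁻⁴` of `g` on the boundary. -/
noncomputable def jacobian (g : GL (Fin 3) ℂ) (W : ℂ × ℂ) : ℝ≥0 := (‖autJ g W‖₊⁻¹) ^ 4

theorem measurable_autJ (g : GL (Fin 3) ℂ) : Measurable (autJ g) := by
  unfold autJ; fun_prop

theorem measurable_moebius (g : GL (Fin 3) ℂ) : Measurable (moebius g) := by
  have := measurable_autJ g
  unfold moebius; fun_prop

theorem measurable_jacobian (g : GL (Fin 3) ℂ) : Measurable (jacobian g) := by
  have := measurable_autJ g
  unfold jacobian; fun_prop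

theorem coe_jacobian (g : GL (Fin 3) ℂ) (W : ℂ × ℂ) :
    (jacobian g W : ℝ≥0∞) = ENNReal.ofReal ((‖autJ g W‖ ^ 4)⁻¹) := by
  rw [jacobian, ENNReal.ofReal, Real.toNNReal_of_nonneg (by positivity)]
  congr 1
  apply NNReal.eq
  simp

/-- The change of variables formula for `g` on the boundary. -/
def HasBoundaryJacobian (g : GL (Fin 3) ℂ) : Prop :=
  ∀ f : ℂ × ℂ → ℝ≥0∞, Measurable f →
    ∫⁻ W, jacobian g W * f (moebius g W) ∂boundaryMeasure = ∫⁻ W, f W ∂boundaryMeasure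

/-- By the cocycle relation for `j`, the change of variables need only be checked on the stabilizer
of `∞` and on the inversion. -/
theorem HasBoundaryJacobian.mul {g h : GL (Fin 3) ℂ} (hh : h ∈ U21)
    (hg' : HasBoundaryJacobian g) (hh' : HasBoundaryJacobian h) :
    HasBoundaryJacobian (g * h) := by
  intro f hf
  have h1 := measurable_moebius g
  have h2 := measurable_jacobian g
  rw [← hg' f hf, ← hh' (fun W => jacobian g W * f (moebius g W)) (by fun_prop)]
  refine lintegral_congr_ae ?_
  filter_upwards [ae_autJ_ne_zero hh] with W hW
  rw [moebius_mul _ _ _ hW, ← mul_assoc]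
  congr 1
  rw [← ENNReal.coe_mul]
  congr 1
  rw [jacobian, jacobian, jacobian, autJ_mul _ _ _ hW, nnnorm_mul, mul_inv, mul_pow, mul_comm]

/-- Such a `g` fixes `∞` and acts triangularly: affinely on `w`, and on `t` by a dilation `r` plus a
shift depending on `w`. The factors |g₁₁/g₂₂|² and r = |g₀₀|² are both |g₂₂|⁻². -/
theorem hasBoundaryJacobian_of_upper {g : GL (Fin 3) ℂ} (hg : g ∈ U21) (h20 : g 2 0 = 0) :
    HasBoundaryJacobian g := by
  have e00 := U21_entry hg 0 0
  have e01 := U21_entry hg 0 1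
  have e02 := U21_entry hg 0 2
  have e11 := U21_entry hg 1 1
  simp only [formJ, Matrix.of_apply, Matrix.cons_val', Matrix.cons_val_zero, Matrix.cons_val_one,
    Matrix.cons_val, h20, map_zero, neg_zero, zero_mul, mul_zero, zero_add, sub_zero] at e00 e01 e02 e11
  have h10 : g 1 0 = 0 := by simpa using e00
  simp only [h10, map_zero, zero_mul, zero_sub, neg_inj] at e01 e02
  have h00 : g 0 0 ≠ 0 := by rintro h; simp [h] at e02
  have h22 : g 2 2 ≠ 0 := by rintro h; simp [h] at e02
  have h21 : g 2 1 = 0 := by simpa [h00] using e01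
  simp only [h21, map_zero, neg_zero, zero_mul, mul_zero, zero_add, sub_zero] at e11
  have hn11 : ‖g 1 1‖ = 1 := by
    rw [mul_comm, Complex.mul_conj, Complex.normSq_eq_norm_sq] at e11
    have : ‖g 1 1‖ ^ 2 = 1 := by exact_mod_cast e11
    exact (pow_eq_one_iff_of_nonneg (norm_nonneg _) two_ne_zero).1 this
  have h11 : g 1 1 ≠ 0 := by rw [← norm_ne_zero_iff, hn11]; exact one_ne_zero
  have hnn : ‖g 0 0‖ * ‖g 2 2‖ = 1 := by
    have := congrArg norm e02
    simpa using this
  set r : ℝ := ‖g 0 0‖ ^ 2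
  have hr : 0 < r := by positivity
  have hdiv : g 0 0 / g 2 2 = (r : ℂ) := by
    rw [div_eq_iff h22]
    simp only [r]
    have h3 : ((‖g 0 0‖ ^ 2 : ℝ) : ℂ) = g 0 0 * (starRingEnd ℂ) (g 0 0) := by
      rw [Complex.mul_conj, Complex.normSq_eq_norm_sq]
    rw [h3, mul_assoc, e02, mul_one]
  have hj : ∀ W, autJ g W = g 2 2 := fun W => by simp [autJ, h20, h21]
  set φ : ℂ → ℝ := fun w =>
    ((r : ℂ) * ((‖w‖ ^ 2 / 2 : ℝ) : ℂ) + (g 0 1 * w + g 0 2) / g 2 2).im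
  have hmoeb : ∀ w t, moebius g (param (w, t)) =
      param (g 1 1 / g 2 2 * w + g 1 2 / g 2 2, r * t + φ w) := by
    intro w t
    have hh : height (moebius g (param (w, t))) = 0 := by
      rw [height_moebius hg (by rw [hj]; exact h22), height_param, zero_div]
    rw [← param_of_height_eq_zero hh]
    congr 1
    refine Prod.ext ?_ ?_
    · simp only [moebius, hj, h10, param]
      ring
    · simp only [moebius, hj, param, φ]
      have e : (g 0 0 * (((‖w‖ ^ 2 / 2 : ℝ) : ℂ) + t * I) + g 0 1 * w + g 0 2) / g 2 2 =
          (((r : ℂ) * ((‖w‖ ^ 2 / 2 : ℝ) : ℂ) + (g 0 1 * w + g 0 2) / g 2 2))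
            + (r * t : ℝ) * I := by
        rw [← hdiv]; push_cast; rw [← hdiv]; ring
      rw [e, add_im, im_ofReal_mul]
      simp
      ring
  intro f hf
  have h1 := measurable_moebius g
  have h2 := measurable_jacobian g
  have h3 := continuous_param.measurable
  rw [lintegral_boundaryMeasure' (by fun_prop), lintegral_boundaryMeasure' hf,
    lintegral_comp_affine_complex (div_ne_zero h11 h22) (g 1 2 / g 2 2)
      (fun w => ∫⁻ t, f (param (w, t)))]
  refine lintegral_congr fun w => ?_
  rw [lintegral_comp_affine_real hr.ne' (φ w)
    (fun t => f (param (g 1 1 / g 2 2 * w + g 1 2 / g 2 2, t))), ← lintegral_const_mul _ (by fun_prop)]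
  refine lintegral_congr fun t => ?_
  rw [hmoeb, coe_jacobian, hj, ← mul_assoc, ← ENNReal.ofReal_mul (by positivity)]
  congr 2
  rw [norm_div, hn11, abs_of_pos hr]
  have : ‖g 2 2‖ ≠ 0 := by simpa using h22
  have h4 : r * ‖g 2 2‖ ^ 2 = 1 := by simp only [r]; rw [← mul_pow, hnn, one_pow]
  field_simp
  linear_combination -h4

/-- The inversion `(z₁, z₂) ↦ (1 / z₁, - z₂ / z₁)`. -/
noncomputable def inversion : GL (Fin 3) ℂ :=
  ⟨formJ, formJ, by ext i j; fin_cases i <;> fin_cases j <;> simp [formJ, Matrix.mul_apply, Fin.sum_univ_three],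
    by ext i j; fin_cases i <;> fin_cases j <;> simp [formJ, Matrix.mul_apply, Fin.sum_univ_three]⟩

theorem inversion_mem : inversion ∈ U21 := by
  rw [mem_U21_iff]
  ext i j
  fin_cases i <;> fin_cases j <;>
    simp [inversion, formJ, Matrix.mul_apply, Fin.sum_univ_three]

theorem autJ_inversion (Z : ℂ × ℂ) : autJ inversion Z = -Z.1 := by
  simp [autJ, inversion, formJ]

theorem moebius_inversion (Z : ℂ × ℂ) : moebius inversion Z = (Z.1⁻¹, -(Z.2 / Z.1)) := by
  rw [moebius, autJ_inversion]
  simp [inversion, formJ, div_neg, neg_div]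

/-- With `t` measured in units of `‖w‖²`, the inversion leaves the new `t` fixed up to sign and acts
only on `w`. The signs `c = 1` on the source and `c = -1` on the target account for its reversal of
`t`. -/
theorem lintegral_scaled {f : ℂ × ℝ → ℝ≥0∞} (hf : Measurable f) {c : ℝ} (hc : c ≠ 0) :
    ∫⁻ w : ℂ, ∫⁻ t : ℝ, f (w, t) =
      ∫⁻ t : ℝ, ∫⁻ w : ℂ, ENNReal.ofReal (|c| * ‖w‖ ^ 2) * f (w, c * ‖w‖ ^ 2 * t) := by
  rw [lintegral_lintegral_swap (by fun_prop : AEMeasurable (Function.uncurry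
    fun t w => ENNReal.ofReal (|c| * ‖w‖ ^ 2) * f (w, c * ‖w‖ ^ 2 * t)) _)]
  refine lintegral_congr_ae ?_
  have h0 : ∀ᵐ w : ℂ, w ≠ 0 := by
    exact compl_mem_ae_iff.2 (measure_singleton 0)
  filter_upwards [h0] with w hw
  have hw' : 0 < ‖w‖ := by simpa using hw
  rw [lintegral_comp_affine_real (r := c * ‖w‖ ^ 2) (by positivity) 0]
  simp only [add_zero, abs_mul, abs_pow, abs_norm]

theorem hasBoundaryJacobian_inversion : HasBoundaryJacobian inversion := by
  intro f hf
  have h1 := measurable_moebius inversion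
  have h2 := measurable_jacobian inversion
  have h3 := continuous_param.measurable
  rw [lintegral_boundaryMeasure' (by fun_prop), lintegral_boundaryMeasure' hf,
    lintegral_scaled (c := 1) (f := fun p => jacobian inversion (param p) *
      f (moebius inversion (param p))) (by fun_prop) one_ne_zero,
    lintegral_scaled (c := -1) (f := fun p => f (param p)) (by fun_prop) (by norm_num)]
  refine lintegral_congr fun t => ?_
  set a : ℂ := 1 / 2 + t * I
  have ha : a ≠ 0 := by
    intro h
    have := congrArg Complex.re h
    simp [a] at this
  rw [lintegral_comp_inv_conj ha
    (G := fun w => ENNReal.ofReal (|-1| * ‖w‖ ^ 2) * f (param (w, -1 * ‖w‖ ^ 2 * t))) (by fun_prop)]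
  refine lintegral_congr_ae ?_
  have h0 : ∀ᵐ w : ℂ, w ≠ 0 := by
    exact compl_mem_ae_iff.2 (measure_singleton 0)
  filter_upwards [h0] with w hw
  have hw' : ‖w‖ ≠ 0 := by simpa using hw
  have ha' : ‖a‖ ≠ 0 := by simpa using ha
  have hq : (param (w, 1 * ‖w‖ ^ 2 * t)).1 = w * (starRingEnd ℂ) w * a := by
    rw [Complex.mul_conj, Complex.normSq_eq_norm_sq]
    simp only [param, a]
    push_cast
    ring
  have hwc : (starRingEnd ℂ) w ≠ 0 := by simpa using hw
  have hj : autJ inversion (param (w, 1 * ‖w‖ ^ 2 * t)) = -(w * (starRingEnd ℂ) w * a) := by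
    rw [autJ_inversion, hq]
  have hm : moebius inversion (param (w, 1 * ‖w‖ ^ 2 * t)) =
      param (-((starRingEnd ℂ) w * a)⁻¹, -1 * ‖-((starRingEnd ℂ) w * a)⁻¹‖ ^ 2 * t) := by
    have hh : height (moebius inversion (param (w, 1 * ‖w‖ ^ 2 * t))) = 0 := by
      rw [height_moebius inversion_mem (by rw [hj]; simp [hw, ha]), height_param, zero_div]
    rw [← param_of_height_eq_zero hh]
    congr 1
    rw [moebius_inversion, hq]
    refine Prod.ext ?_ ?_
    · simp only [param]; field_simp
    · simp only [Complex.mul_conj, Complex.normSq_eq_norm_sq, mul_inv, ← ofReal_inv, im_ofReal_mul,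
        norm_neg, norm_mul, norm_inv, RCLike.norm_conj, Complex.inv_im, inv_pow, mul_pow]
      simp [a]
      field_simp
  rw [hm, coe_jacobian, hj, ← mul_assoc, ← mul_assoc, ← ENNReal.ofReal_mul (by positivity),
    ← ENNReal.ofReal_mul (by positivity)]
  congr 2
  simp only [norm_neg, norm_mul, norm_inv, RCLike.norm_conj]
  field_simp
  norm_num

/-- An element of `U(2, 1)` moving the boundary point `W` to `∞`. -/
noncomputable def toInfty (W : ℂ × ℂ) : GL (Fin 3) ℂ :=
  inversion * ⟨!![1, -(starRingEnd ℂ) W.2, (starRingEnd ℂ) W.1; 0, 1, -W.2; 0, 0, 1],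
    !![1, (starRingEnd ℂ) W.2, (starRingEnd ℂ) W.2 * W.2 -(starRingEnd ℂ) W.1; 0, 1, W.2; 0, 0, 1],
    by ext i j; fin_cases i <;> fin_cases j <;> simp [Matrix.mul_apply, Fin.sum_univ_three]; ring,
    by ext i j; fin_cases i <;> fin_cases j <;> simp [Matrix.mul_apply, Fin.sum_univ_three]; ring⟩

theorem toInfty_apply (W : ℂ × ℂ) : (toInfty W : Matrix (Fin 3) (Fin 3) ℂ) =
    !![0, 0, -1; 0, 1, -W.2; -1, (starRingEnd ℂ) W.2, -(starRingEnd ℂ) W.1] := by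
  ext i j
  fin_cases i <;> fin_cases j <;>
    simp [toInfty, inversion, formJ, Matrix.mul_apply, Fin.sum_univ_three]

theorem toInfty_mem {W : ℂ × ℂ} (hW : height W = 0) : toInfty W ∈ U21 := by
  have h : W.1 + (starRingEnd ℂ) W.1 = W.2 * (starRingEnd ℂ) W.2 := by
    rw [Complex.mul_conj, Complex.add_conj, Complex.normSq_eq_norm_sq]
    rw [height_eq] at hW
    exact_mod_cast (by linarith : 2 * W.1.re = ‖W.2‖ ^ 2)
  rw [mem_U21_iff, toInfty_apply]
  ext i j
  fin_cases i <;> fin_cases j <;>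
    simp [formJ, Matrix.mul_apply, Fin.sum_univ_three]
  linear_combination -h

theorem autJ_toInfty (W V : ℂ × ℂ) : autJ (toInfty W) V = -rho W V := by
  simp [autJ, toInfty_apply, rho]
  ring

theorem hasBoundaryJacobian_toInfty {W : ℂ × ℂ} (hW : height W = 0) :
    HasBoundaryJacobian (toInfty W) := by
  have h := toInfty_mem hW
  have h1 := U21.mul_mem (U21.inv_mem inversion_mem) h
  rw [toInfty, inv_mul_cancel_left] at h1
  exact hasBoundaryJacobian_inversion.mul h1 (hasBoundaryJacobian_of_upper h1 (by simp))

theorem U21_inv_apply {g : GL (Fin 3) ℂ} (hg : g ∈ U21) :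
    ((g⁻¹ : GL (Fin 3) ℂ) : Matrix (Fin 3) (Fin 3) ℂ) =
      formJ * (g : Matrix (Fin 3) (Fin 3) ℂ).conjTranspose * formJ := by
  have hJ : formJ * formJ = 1 := by
    ext i j; fin_cases i <;> fin_cases j <;> simp [formJ, Matrix.mul_apply, Fin.sum_univ_three]
  rw [Matrix.coe_units_inv]
  refine Matrix.inv_eq_left_inv ?_
  rw [Matrix.mul_assoc formJ, Matrix.mul_assoc formJ, mem_U21_iff.1 hg, hJ]

theorem U21_inv_col {g : GL (Fin 3) ℂ} (hg : g ∈ U21) :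
    (g⁻¹ : GL (Fin 3) ℂ) 0 0 = (starRingEnd ℂ) (g 2 2) ∧
    (g⁻¹ : GL (Fin 3) ℂ) 1 0 = -(starRingEnd ℂ) (g 2 1) ∧
    (g⁻¹ : GL (Fin 3) ℂ) 2 0 = (starRingEnd ℂ) (g 2 0) := by
  rw [U21_inv_apply hg]
  simp only [Matrix.mul_apply, Fin.sum_univ_three, Matrix.conjTranspose_apply]
  simp [formJ]

/-- A Bruhat argument: if `g` moves `∞`, let `W = g⁻¹(∞)`, read off from the first column of `g⁻¹`.
Then `g * (toInfty W)⁻¹` fixes `∞`, and both factors are known. -/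
theorem hasBoundaryJacobian {g : GL (Fin 3) ℂ} (hg : g ∈ U21) : HasBoundaryJacobian g := by
  by_cases h : g 2 0 = 0
  · exact hasBoundaryJacobian_of_upper hg h
  · set c := (starRingEnd ℂ) (g 2 0)
    have hc : (starRingEnd ℂ) (g 2 0) ≠ 0 := by simpa using h
    set W : ℂ × ℂ := ((starRingEnd ℂ) (g 2 2) / c, -(starRingEnd ℂ) (g 2 1) / c)
    have e := U21_entry (U21.inv_mem hg) 0 0
    obtain ⟨c0, c1, c2⟩ := U21_inv_col hg
    rw [c0, c1, c2] at e
    simp only [map_neg, Complex.conj_conj, formJ, Matrix.of_apply, Matrix.cons_val',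
      Matrix.cons_val_zero] at e
    have hW : height W = 0 := by
      have h0 : rho W W = 0 := by
        simp only [W, rho, map_div₀, map_neg, c, Complex.conj_conj]
        field_simp
        linear_combination -e
      rw [height, h0, zero_re]
    have hk := toInfty_mem hW
    have hp := U21.mul_mem hg (U21.inv_mem hk)
    have h20 : (g * (toInfty W)⁻¹) 2 0 = 0 := by
      obtain ⟨c0, c1, c2⟩ := U21_inv_col hk
      rw [Units.val_mul, Matrix.mul_apply, Fin.sum_univ_three, c0, c1, c2, toInfty_apply]
      simp [W, c]
      field_simp
      linear_combination e
    have := (hasBoundaryJacobian_of_upper hp h20).mul hk (hasBoundaryJacobian_toInfty hW)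
    rwa [inv_mul_cancel_right] at this

theorem map_moebius_withDensity {g : GL (Fin 3) ℂ} (hg : g ∈ U21) :
    (boundaryMeasure.withDensity fun W => (jacobian g W : ℝ≥0∞)).map (moebius g) =
      boundaryMeasure := by
  have hm := measurable_moebius g
  have hd := measurable_jacobian g
  refine Measure.ext_of_lintegral _ fun f hf => ?_
  rw [lintegral_map hf hm, lintegral_withDensity_eq_lintegral_mul _ (by fun_prop) (by fun_prop)]
  exact hasBoundaryJacobian hg f hf

theorem integrable_moebius_iff {g : GL (Fin 3) ℂ} (hg : g ∈ U21) {f : ℂ × ℂ → ℂ}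
    (hf : Measurable f) :
    Integrable (fun W => jacobian g W • f (moebius g W)) boundaryMeasure ↔
      Integrable f boundaryMeasure := by
  have hm := measurable_moebius g
  conv_rhs => rw [← map_moebius_withDensity hg]
  rw [integrable_map_measure hf.aestronglyMeasurable hm.aemeasurable,
    integrable_withDensity_iff_integrable_smul (measurable_jacobian g)]
  rfl

theorem integral_moebius {g : GL (Fin 3) ℂ} (hg : g ∈ U21) {f : ℂ × ℂ → ℂ}
    (hf : Measurable f) :
    ∫ W, jacobian g W • f (moebius g W) ∂boundaryMeasure = ∫ W, f W ∂boundaryMeasure := by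
  have hm := measurable_moebius g
  conv_rhs => rw [← map_moebius_withDensity hg]
  rw [integral_map hm.aemeasurable hf.aestronglyMeasurable,
    integral_withDensity_eq_integral_smul (measurable_jacobian g)]

end SiegelU21

/-! ### Explicit integrals and the intertwining formula. -/

namespace SiegelU21

open scoped ENNReal NNReal

theorem norm_one_add_sq_cpow (s : ℂ) (t : ℝ) :
    ‖((1 + t ^ 2 : ℝ) : ℂ) ^ (-s)‖ = (1 + t ^ 2) ^ (-s.re) := by
  rw [Complex.norm_cpow_eq_rpow_re_of_pos (by positivity), neg_re]

theorem continuous_one_add_sq_cpow (s : ℂ) :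
    Continuous fun t : ℝ => ((1 + t ^ 2 : ℝ) : ℂ) ^ (-s) := by
  refine Continuous.cpow (by fun_prop) continuous_const fun t => ?_
  exact Complex.ofReal_mem_slitPlane.2 (by positivity)

theorem integrable_one_add_sq_cpow {s : ℂ} (hs : 1 / 2 < s.re) :
    Integrable fun t : ℝ => ((1 + t ^ 2 : ℝ) : ℂ) ^ (-s) := by
  have h := integrable_rpow_neg_one_add_norm_sq (E := ℝ) (μ := volume) (r := 2 * s.re)
    (by rw [Module.finrank_self]; push_cast; linarith)
  refine h.mono' (continuous_one_add_sq_cpow s).aestronglyMeasurable (ae_of_all _ fun t => ?_)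
  rw [norm_one_add_sq_cpow, Real.norm_eq_abs, sq_abs]
  refine le_of_eq ?_
  congr 1
  ring

/-- Multiply by Γ(s), write the power as a Gamma integral, exchange the integrals and evaluate the
inner Gaussian; a Gamma integral at s - 1/2 remains. -/
theorem integral_one_add_sq_cpow {s : ℂ} (hs : 1 / 2 < s.re) :
    ∫ t : ℝ, ((1 + t ^ 2 : ℝ) : ℂ) ^ (-s) =
      (Real.sqrt Real.pi : ℂ) * Complex.Gamma (s - 1 / 2) / Complex.Gamma s := by
  have hs0 : 0 < s.re := by linarith
  have hG : Complex.Gamma s ≠ 0 := Complex.Gamma_ne_zero_of_re_pos hs0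
  rw [eq_div_iff hG, mul_comm, ← integral_const_mul]
  set F : ℝ → ℝ → ℂ := fun t x => (x : ℂ) ^ (s - 1) * Complex.exp (-(((1 + t ^ 2 : ℝ) : ℂ) * x))
  have h1 : ∀ t : ℝ, Complex.Gamma s * ((1 + t ^ 2 : ℝ) : ℂ) ^ (-s) = ∫ x in Set.Ioi 0, F t x := by
    intro t
    rw [Complex.integral_cpow_mul_exp_neg_mul_Ioi hs0 (by positivity), mul_comm,
      one_div, Complex.cpow_neg, Complex.inv_cpow]
    rw [Complex.arg_ofReal_of_nonneg (by positivity)]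
    exact Real.pi_pos.ne
  have hsplit : ∀ t x : ℝ, F t x =
      (x : ℂ) ^ (s - 1) * (Real.exp (-x) : ℂ) * ((Real.exp (-x * t ^ 2) : ℝ) : ℂ) := by
    intro t x
    simp only [F]
    rw [mul_assoc, Complex.ofReal_exp, Complex.ofReal_exp, ← Complex.exp_add]
    congr 2
    push_cast
    ring
  have h3 : ∀ x ∈ Set.Ioi (0 : ℝ), ∀ c : ℂ, (x : ℂ) ^ (s - 1) * c * (Real.sqrt (Real.pi / x) : ℂ) =
      (Real.sqrt Real.pi : ℂ) * (c * (x : ℂ) ^ (s - 1 / 2 - 1)) := by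
    intro x hx c
    have hx : 0 < x := hx
    rw [Real.sqrt_div Real.pi_pos.le, ofReal_div, Real.sqrt_eq_rpow x, Complex.ofReal_cpow hx.le,
      show s - 1 / 2 - 1 = (s - 1) - 1 / 2 by ring, Complex.cpow_sub _ (1 / 2)
        (ofReal_ne_zero.2 hx.ne')]
    push_cast
    ring
  have hΓ := Complex.GammaIntegral_convergent (s := s - 1 / 2) (by simp; linarith)
  have hint : Integrable (Function.uncurry F)
      ((volume : Measure ℝ).prod (volume.restrict (Set.Ioi 0))) := by
    have hm : AEStronglyMeasurable (Function.uncurry F)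
        ((volume : Measure ℝ).prod (volume.restrict (Set.Ioi 0))) := by
      refine Measurable.aestronglyMeasurable ?_
      simp only [Function.uncurry_def, F]
      fun_prop
    rw [integrable_prod_iff' hm]
    constructor
    · filter_upwards [ae_restrict_mem measurableSet_Ioi] with x hx
      simp only [Function.uncurry_apply_pair, hsplit]
      exact (integrable_exp_neg_mul_sq hx).ofReal.const_mul _
    · refine (hΓ.norm.const_mul (Real.sqrt Real.pi)).congr ?_
      filter_upwards [ae_restrict_mem measurableSet_Ioi] with x hx
      simp only [Function.uncurry_apply_pair, hsplit, norm_mul]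
      rw [integral_const_mul]
      have : ∀ t : ℝ, ‖((Real.exp (-x * t ^ 2) : ℝ) : ℂ)‖ = Real.exp (-x * t ^ 2) := fun t => by
        rw [Complex.norm_real, Real.norm_of_nonneg (Real.exp_pos _).le]
      simp only [this]
      rw [integral_gaussian]
      have := congrArg norm (h3 x hx (Real.exp (-x) : ℂ))
      simp only [norm_mul, Complex.norm_real, Real.norm_of_nonneg (Real.sqrt_nonneg _)] at this ⊢
      rw [this]
  calc ∫ t : ℝ, Complex.Gamma s * ((1 + t ^ 2 : ℝ) : ℂ) ^ (-s)
      = ∫ t : ℝ, ∫ x in Set.Ioi 0, F t x := by simp only [h1]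
    _ = ∫ x in Set.Ioi 0, ∫ t : ℝ, F t x := integral_integral_swap hint
    _ = ∫ x in Set.Ioi (0 : ℝ),
          (Real.sqrt Real.pi : ℂ) * ((Real.exp (-x) : ℂ) * (x : ℂ) ^ (s - 1 / 2 - 1)) := by
        refine setIntegral_congr_fun measurableSet_Ioi fun x hx => ?_
        simp only [hsplit]
        rw [integral_const_mul, integral_complex_ofReal, integral_gaussian, h3 x hx]
    _ = _ := by
        rw [integral_const_mul, Complex.Gamma_eq_integral (by simp; linarith),
          Complex.GammaIntegral]

theorem integrable_half_add_normSq_cpow {h : ℝ} (hh : 0 < h) {s : ℂ} (hs : 1 < s.re) :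
    Integrable fun w : ℂ => (((h + ‖w‖ ^ 2) / 2 : ℝ) : ℂ) ^ (1 - 2 * s) := by
  have hJ := integrable_rpow_neg_one_add_norm_sq (E := ℂ) (μ := volume) (r := 2 * (2 * s.re - 1))
    (by rw [Complex.finrank_real_complex]; push_cast; linarith)
  set c := min h 1 / 2
  have hc : 0 < c := by positivity
  have hcont : Continuous fun w : ℂ => (((h + ‖w‖ ^ 2) / 2 : ℝ) : ℂ) ^ (1 - 2 * s) := by
    refine Continuous.cpow (by fun_prop) continuous_const fun t => ?_
    exact Complex.ofReal_mem_slitPlane.2 (by positivity)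
  refine (hJ.const_mul (c ^ (1 - 2 * s.re))).mono' hcont.aestronglyMeasurable
    (ae_of_all _ fun w => ?_)
  rw [Complex.norm_cpow_eq_rpow_re_of_pos (by positivity)]
  have e : (1 - 2 * s).re = 1 - 2 * s.re := by simp
  rw [e, show -(2 * (2 * s.re - 1)) / 2 = 1 - 2 * s.re by ring,
    ← Real.mul_rpow hc.le (by positivity)]
  refine Real.rpow_le_rpow_of_nonpos (by positivity) ?_ (by linarith)
  have h1 : min h 1 ≤ h := min_le_left _ _
  have h2 : min h 1 ≤ 1 := min_le_right _ _
  simp only [c]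
  nlinarith [sq_nonneg ‖w‖]

theorem integral_half_add_normSq_cpow {h : ℝ} (hh : 0 < h) {s : ℂ} (hs : 1 < s.re) :
    ∫ w : ℂ, (((h + ‖w‖ ^ 2) / 2 : ℝ) : ℂ) ^ (1 - 2 * s) =
      (4 : ℂ) ^ (s - 1) * Real.pi / (s - 1) * (h : ℂ) ^ (2 - 2 * s) := by
  set f : ℝ → ℂ := fun r => (((h + r ^ 2) / 2 : ℝ) : ℂ) ^ (1 - 2 * s)
  have hint : Integrable fun w : ℂ => f ‖w‖ := integrable_half_add_normSq_cpow hh hs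
  have hint' := (integrable_fun_norm_addHaar (E := ℂ) volume (f := f)).1 hint
  have hI := integral_fun_norm_addHaar (E := ℂ) volume f
  simp only [Complex.finrank_real_complex] at hint' hI
  have hs1 : s - 1 ≠ 0 := by
    intro h0; have := congrArg Complex.re h0; simp at this; linarith
  have hs2 : 2 - 2 * s ≠ 0 := by
    rw [show 2 - 2 * s = -2 * (s - 1) by ring]; exact mul_ne_zero (by norm_num) hs1
  -- After polar coordinates the radial integrand has this primitive, which vanishes at infinity;
  -- only its value at 0 contributes.
  set G : ℝ → ℂ := fun r => (((h + r ^ 2) / 2 : ℝ) : ℂ) ^ (2 - 2 * s) / (2 - 2 * s)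
  have hder : ∀ r : ℝ, HasDerivAt G ((r ^ (2 - 1) : ℝ) • f r) r := by
    intro r
    have h1 : HasDerivAt (fun z : ℂ => ((h : ℂ) + z ^ 2) / 2) (r : ℂ) (r : ℂ) := by
      refine ((((hasDerivAt_id (r : ℂ)).pow 2).const_add (h : ℂ)).div_const 2).congr_deriv ?_
      simp
    have hmem : ((h : ℂ) + (r : ℂ) ^ 2) / 2 ∈ Complex.slitPlane := by
      rw [show ((h : ℂ) + (r : ℂ) ^ 2) / 2 = ((h + r ^ 2) / 2 : ℝ) by push_cast; ring]
      exact Complex.ofReal_mem_slitPlane.2 (by positivity)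
    have h2 := ((h1.cpow_const (c := 2 - 2 * s) hmem).div_const (2 - 2 * s)).comp_ofReal
    have hG : G = fun y : ℝ => (((h : ℂ) + (y : ℂ) ^ 2) / 2) ^ (2 - 2 * s) / (2 - 2 * s) := by
      funext y; simp only [G]; push_cast; rfl
    rw [hG]
    refine h2.congr_deriv ?_
    rw [show 2 - 2 * s - 1 = 1 - 2 * s by ring]
    simp only [f, Complex.real_smul]
    push_cast
    rw [pow_one, mul_assoc, mul_div_cancel_left₀ _ hs2, mul_comm]
  have htend : Filter.Tendsto G Filter.atTop (nhds 0) := by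
    rw [tendsto_zero_iff_norm_tendsto_zero]
    have e : ∀ r : ℝ, ‖G r‖ = ((h + r ^ 2) / 2) ^ (-(2 * s.re - 2)) / ‖2 - 2 * s‖ := by
      intro r
      simp only [G, norm_div]
      rw [Complex.norm_cpow_eq_rpow_re_of_pos (by positivity)]
      congr 2
      simp
    simp only [e]
    rw [← zero_div ‖2 - 2 * s‖]
    refine Filter.Tendsto.div_const ?_ _
    refine (tendsto_rpow_neg_atTop (by linarith)).comp ?_
    refine Filter.Tendsto.atTop_div_const (by norm_num) ?_
    exact Filter.tendsto_atTop_add_const_left _ _ (Filter.tendsto_pow_atTop two_ne_zero)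
  have hF := integral_Ioi_of_hasDerivAt_of_tendsto' (a := 0) (fun r _ => hder r) hint' htend
  have hball : volume.real (Metric.ball (0 : ℂ) 1) = Real.pi := by
    rw [Measure.real, Complex.volume_ball]; simp
  rw [hF, hball] at hI
  rw [hI]
  have hh' : (h : ℂ) ≠ 0 := ofReal_ne_zero.2 hh.ne'
  have e2 : (((h + 0 ^ 2) / 2 : ℝ) : ℂ) ^ (2 - 2 * s) = (4 : ℂ) ^ (s - 1) * (h : ℂ) ^ (2 - 2 * s) := by
    rw [show (h + 0 ^ 2) / 2 = (2 : ℝ)⁻¹ * h by ring, ofReal_mul,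
      Complex.mul_cpow_ofReal_nonneg (by norm_num) hh.le]
    congr 1
    rw [show (4 : ℂ) = ((2 : ℝ) : ℂ) * ((2 : ℝ) : ℂ) by push_cast; norm_num,
      Complex.mul_cpow_ofReal_nonneg (by norm_num) (by norm_num),
      ← Complex.cpow_add _ _ (by norm_num), ofReal_inv, Complex.inv_cpow, ← Complex.cpow_neg]
    · congr 1; ring
    · rw [Complex.arg_ofReal_of_nonneg (by norm_num)]; exact Real.pi_pos.ne
  simp only [G, e2]
  simp only [nsmul_eq_mul, Complex.real_smul]
  rw [show 2 - 2 * s = -2 * (s - 1) by ring]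
  push_cast
  field_simp
  ring

/-! The integral of powers of the Poisson kernel. -/

theorem normSq_rho_param (Z : ℂ × ℂ) (w : ℂ) (t : ℝ) :
    ‖rho Z (param (w, t))‖ ^ 2 = ((height Z + ‖w - Z.2‖ ^ 2) / 2) ^ 2 +
      (t + ((starRingEnd ℂ) Z.1 - (starRingEnd ℂ) Z.2 * w).im) ^ 2 := by
  rw [← Complex.normSq_eq_norm_sq, Complex.normSq_apply, re_rho, height_param, norm_sub_rev]
  have : (rho Z (param (w, t))).im = t + ((starRingEnd ℂ) Z.1 - (starRingEnd ℂ) Z.2 * w).im := by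
    simp [rho, param, -ofReal_pow]
    ring
  rw [this]
  simp only [param]
  ring

/-- With a = Re ρ, |ρ|² = a²(1 + ((t + φ)/a)²) where neither a nor φ depends on t. The integral over
`t` thus becomes a translated and rescaled standard one. -/
theorem poisson_cpow_param {Z : ℂ × ℂ} (hZ : 0 < height Z) (s : ℂ) (w : ℂ) (t : ℝ) :
    (poisson Z (param (w, t)) : ℂ) ^ s =
      (height Z : ℂ) ^ s * (((height Z + ‖w - Z.2‖ ^ 2) / 2 : ℝ) : ℂ) ^ (-2 * s) *
      ((1 + ((t + ((starRingEnd ℂ) Z.1 - (starRingEnd ℂ) Z.2 * w).im) /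
        ((height Z + ‖w - Z.2‖ ^ 2) / 2)) ^ 2 : ℝ) : ℂ) ^ (-s) := by
  set a := (height Z + ‖w - Z.2‖ ^ 2) / 2
  set φ := ((starRingEnd ℂ) Z.1 - (starRingEnd ℂ) Z.2 * w).im
  have ha : 0 < a := by positivity
  have e : poisson Z (param (w, t)) = height Z * ((a * a) * (1 + ((t + φ) / a) ^ 2))⁻¹ := by
    rw [poisson, normSq_rho_param, div_eq_mul_inv]
    change height Z * (a ^ 2 + (t + φ) ^ 2)⁻¹ = _
    clear_value a φ
    congr 2
    field_simp
  rw [e, ofReal_mul, Complex.mul_cpow_ofReal_nonneg hZ.le (by positivity), ofReal_inv,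
    Complex.inv_cpow _ _ (by rw [Complex.arg_ofReal_of_nonneg (by positivity)]; exact Real.pi_pos.ne),
    ← Complex.cpow_neg, ofReal_mul, Complex.mul_cpow_ofReal_nonneg (by positivity) (by positivity),
    ofReal_mul, Complex.mul_cpow_ofReal_nonneg ha.le ha.le,
    ← Complex.cpow_add _ _ (ofReal_ne_zero.2 ha.ne'), show -s + -s = -2 * s by ring, mul_assoc]

theorem measurable_poisson : Measurable fun p : (ℂ × ℂ) × (ℂ × ℂ) => poisson p.1 p.2 := by
  have h1 := continuous_rho.measurable
  have h2 := continuous_height.measurable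
  unfold poisson
  fun_prop

theorem measurable_poisson_right (Z : ℂ × ℂ) : Measurable fun W => poisson Z W := by
  have h : Continuous fun W => rho Z W := by unfold rho; fun_prop
  have := h.measurable
  unfold poisson
  fun_prop

theorem integral_poisson_cpow_fiber {Z : ℂ × ℂ} (hZ : 0 < height Z) (s : ℂ) (w : ℂ) :
    ∫ t, (poisson Z (param (w, t)) : ℂ) ^ s =
      (height Z : ℂ) ^ s * (((height Z + ‖w - Z.2‖ ^ 2) / 2 : ℝ) : ℂ) ^ (1 - 2 * s) *
        ∫ u : ℝ, ((1 + u ^ 2 : ℝ) : ℂ) ^ (-s) := by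
  have ha : 0 < (height Z + ‖w - Z.2‖ ^ 2) / 2 := by positivity
  simp only [poisson_cpow_param hZ]
  rw [integral_const_mul]
  rw [integral_add_right_eq_self (μ := volume) (fun t : ℝ => ((1 + (t /
    ((height Z + ‖w - Z.2‖ ^ 2) / 2)) ^ 2 : ℝ) : ℂ) ^ (-s)),
    Measure.integral_comp_div (fun t : ℝ => ((1 + t ^ 2 : ℝ) : ℂ) ^ (-s)), abs_of_pos ha,
    Complex.real_smul, sub_eq_add_neg (1 : ℂ), Complex.cpow_add _ _ (ofReal_ne_zero.2 ha.ne'),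
    Complex.cpow_one, ← neg_mul]
  ring

theorem integrable_poisson_cpow {Z : ℂ × ℂ} (hZ : 0 < height Z) {s : ℂ} (hs : 1 < s.re) :
    Integrable (fun W => (poisson Z W : ℂ) ^ s) boundaryMeasure := by
  rw [boundaryMeasure_eq, measurableEmbedding_param.integrable_map_iff, Measure.volume_eq_prod]
  have hq := continuous_param.measurable
  have hm : AEStronglyMeasurable ((fun W => (poisson Z W : ℂ) ^ s) ∘ param)
      ((volume : Measure ℂ).prod (volume : Measure ℝ)) := by
    refine Measurable.aestronglyMeasurable ?_
    have := measurable_poisson_right Z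
    fun_prop
  have hK := integrable_one_add_sq_cpow (s := s) (by linarith)
  rw [integrable_prod_iff hm]
  constructor
  · refine ae_of_all _ fun w => ?_
    have ha : 0 < (height Z + ‖w - Z.2‖ ^ 2) / 2 := by positivity
    simp only [Function.comp, poisson_cpow_param hZ]
    exact ((hK.comp_div ha.ne').comp_add_right _).const_mul _
  · have h1 := ((integrable_half_add_normSq_cpow hZ hs).norm.comp_sub_right Z.2).const_mul
      (‖(height Z : ℂ) ^ s‖ * ∫ u : ℝ, ‖((1 + u ^ 2 : ℝ) : ℂ) ^ (-s)‖)
    refine h1.congr (ae_of_all _ fun w => ?_)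
    have ha : 0 < (height Z + ‖w - Z.2‖ ^ 2) / 2 := by positivity
    simp only [Function.comp, poisson_cpow_param hZ, norm_mul]
    rw [integral_const_mul]
    rw [integral_add_right_eq_self (μ := volume) (fun t : ℝ => ‖((1 + (t /
      ((height Z + ‖w - Z.2‖ ^ 2) / 2)) ^ 2 : ℝ) : ℂ) ^ (-s)‖),
      Measure.integral_comp_div (fun t : ℝ => ‖((1 + t ^ 2 : ℝ) : ℂ) ^ (-s)‖), abs_of_pos ha,
      smul_eq_mul, sub_eq_add_neg (1 : ℂ), Complex.cpow_add _ _ (ofReal_ne_zero.2 ha.ne'),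
      Complex.cpow_one, ← neg_mul, norm_mul, Complex.norm_real, Real.norm_of_nonneg ha.le]
    ring

/-- The constant in the integral formula. -/
noncomputable def intertwiningConst (s : ℂ) : ℂ :=
  (4 : ℂ) ^ (s - 1) * Real.pi / (s - 1) *
    ((Real.sqrt Real.pi : ℂ) * Complex.Gamma (s - 1 / 2) / Complex.Gamma s)

/-- The case W' = ∞ of the intertwining formula. The height enters as the factor ρ(Z)^s of the
kernel and as ρ(Z)^(2-2s) from the integral over `w`. -/
theorem integral_poisson_cpow {Z : ℂ × ℂ} (hZ : 0 < height Z) {s : ℂ} (hs : 1 < s.re) :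
    ∫ W, (poisson Z W : ℂ) ^ s ∂boundaryMeasure =
      intertwiningConst s * (height Z : ℂ) ^ (2 - s) := by
  have hint := integrable_poisson_cpow hZ hs
  rw [boundaryMeasure_eq, measurableEmbedding_param.integrable_map_iff,
    Measure.volume_eq_prod] at hint
  rw [boundaryMeasure_eq, measurableEmbedding_param.integral_map, Measure.volume_eq_prod,
    integral_prod (fun p => (poisson Z (param p) : ℂ) ^ s) hint]
  simp only [integral_poisson_cpow_fiber hZ, integral_one_add_sq_cpow (by linarith : 1 / 2 < s.re)]
  rw [integral_mul_const, integral_const_mul,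
    integral_sub_right_eq_self (μ := volume)
      (fun w : ℂ => (((height Z + ‖w‖ ^ 2) / 2 : ℝ) : ℂ) ^ (1 - 2 * s)) Z.2,
    integral_half_add_normSq_cpow hZ hs, intertwiningConst,
    show 2 - s = s + (2 - 2 * s) by ring, Complex.cpow_add _ _ (ofReal_ne_zero.2 hZ.ne')]
  ring

theorem ofReal_mul_sq_cpow {x n : ℝ} (hx : 0 ≤ x) (hn : 0 < n) (s : ℂ) :
    (((n ^ 4)⁻¹ : ℝ) : ℂ) * ((x * n ^ 2 : ℝ) : ℂ) ^ s = (x : ℂ) ^ s * (n : ℂ) ^ (-2 * (2 - s)) := by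
  have hn' : (n : ℂ) ≠ 0 := ofReal_ne_zero.2 hn.ne'
  rw [ofReal_mul, Complex.mul_cpow_ofReal_nonneg hx (by positivity),
    pow_two, ofReal_mul, Complex.mul_cpow_ofReal_nonneg hn.le hn.le,
    show -2 * (2 - s) = -((4 : ℕ) : ℂ) + (s + s) by push_cast; ring,
    Complex.cpow_add _ _ hn', Complex.cpow_add _ _ hn', Complex.cpow_neg, Complex.cpow_natCast]
  push_cast
  ring

theorem jacobian_smul_poisson {g : GL (Fin 3) ℂ} (hg : g ∈ U21) {Z W : ℂ × ℂ} (hZ : 0 < height Z)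
    (hW : height W = 0) (hj : autJ g W ≠ 0) (s : ℂ) :
    jacobian g W • (poisson (moebius g Z) (moebius g W) : ℂ) ^ s =
      (poisson Z W : ℂ) ^ s * (‖autJ g W‖ : ℂ) ^ (-2 * (2 - s)) := by
  have hn : 0 < ‖autJ g W‖ := by simpa using hj
  rw [← ofReal_mul_sq_cpow (poisson_pos hZ hW.ge).le hn, poisson_moebius hg hZ hj, NNReal.smul_def,
    Complex.real_smul]
  simp [jacobian]

/-- Pull the previous case back by `g = toInfty W'`, for which |j(g, V)| = |ρ(V, W')|. Jacobian and
Poisson factor combine to |ρ(W, W')|^(-4+2s), and the height of gZ is P(Z, W'). -/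
theorem integral_poisson_mul_kernel {Z W' : ℂ × ℂ} (hZ : 0 < height Z) (hW' : height W' = 0)
    {s : ℂ} (hs : 1 < s.re) :
    Integrable (fun W => (poisson Z W : ℂ) ^ s * (‖rho W W'‖ : ℂ) ^ (-2 * (2 - s)))
      boundaryMeasure ∧
    ∫ W, (poisson Z W : ℂ) ^ s * (‖rho W W'‖ : ℂ) ^ (-2 * (2 - s)) ∂boundaryMeasure =
      intertwiningConst s * (poisson Z W' : ℂ) ^ (2 - s) := by
  obtain ⟨g, hg, hgj⟩ : ∃ g ∈ U21, ∀ V, ‖autJ g V‖ = ‖rho V W'‖ :=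
    ⟨toInfty W', toInfty_mem hW', fun V => by rw [autJ_toInfty, norm_neg, norm_rho_comm]⟩
  have hZ' := height_moebius_pos hg hZ
  have hae : (fun W => jacobian g W • (poisson (moebius g Z) (moebius g W) : ℂ) ^ s)
      =ᵐ[boundaryMeasure]
      fun W => (poisson Z W : ℂ) ^ s * (‖rho W W'‖ : ℂ) ^ (-2 * (2 - s)) := by
    filter_upwards [ae_autJ_ne_zero hg, ae_height_eq_zero] with W h1 h2
    rw [jacobian_smul_poisson hg hZ h2 h1, hgj]
  have hm : Measurable fun W => (poisson (moebius g Z) W : ℂ) ^ s := by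
    have : Measurable fun W => poisson (moebius g Z) W := measurable_poisson_right _
    fun_prop
  constructor
  · rw [← integrable_congr hae]
    exact (integrable_moebius_iff hg hm).2 (integrable_poisson_cpow hZ' hs)
  · rw [← integral_congr_ae hae, integral_moebius hg hm, integral_poisson_cpow hZ' hs,
      height_moebius hg (autJ_ne_zero hg hZ), hgj]
    rfl

/-- At s = 2 the exponent of the height is 0, so the total visual mass does not depend on the
viewpoint. -/
theorem lintegral_poisson_sq : ∃ C : ℝ≥0∞, C ≠ ⊤ ∧ ∀ Z, 0 < height Z →
    ∫⁻ W, ENNReal.ofReal (poisson Z W ^ 2) ∂boundaryMeasure = C := by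
  refine ⟨ENNReal.ofReal (intertwiningConst 2).re, ENNReal.ofReal_ne_top, fun Z hZ => ?_⟩
  have hs : 1 < (2 : ℂ).re := by norm_num
  have h1 := integrable_poisson_cpow hZ hs
  have h2 := integral_poisson_cpow hZ hs
  have e : ∀ W, (poisson Z W : ℂ) ^ (2 : ℂ) = ((poisson Z W ^ 2 : ℝ) : ℂ) := fun W => by
    rw [ofReal_pow]; exact Complex.cpow_ofNat _ 2
  simp only [e, sub_self, Complex.cpow_zero, mul_one] at h1 h2
  rw [integral_complex_ofReal] at h2
  have h3 : Integrable (fun W => poisson Z W ^ 2) boundaryMeasure := h1.re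
  rw [← ofReal_integral_eq_lintegral_ofReal h3 (ae_of_all _ fun W => sq_nonneg _), ← h2, ofReal_re]

end SiegelU21

/-! ### Visual measures and the vanishing of the measure of the limit set. -/

namespace SiegelU21

open scoped ENNReal NNReal

variable {Γ : Subgroup (GL (Fin 3) ℂ)}

/-- The visual measure of the discontinuity set as seen from `Z`, up to a constant. -/
noncomputable def visualDisc (Γ : Subgroup (GL (Fin 3) ℂ)) (Z : ℂ × ℂ) : ℝ≥0∞ :=
  ∫⁻ W in finiteDisc Γ, ENNReal.ofReal (poisson Z W ^ 2) ∂boundaryMeasure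

theorem measurable_ofReal_poisson_sq (Z : ℂ × ℂ) :
    Measurable fun W => ENNReal.ofReal (poisson Z W ^ 2) := by
  have := measurable_poisson_right Z
  fun_prop

theorem moebius_mem_finiteDisc_iff (hΓ : Γ ≤ U21) {γ : GL (Fin 3) ℂ} (hγ : γ ∈ Γ) {W : ℂ × ℂ}
    (hj : autJ γ W ≠ 0) : moebius γ W ∈ finiteDisc Γ ↔ W ∈ finiteDisc Γ := by
  refine ⟨fun h => ?_, fun h => moebius_mem_finiteDisc hΓ hγ h hj⟩
  have hj' : autJ γ⁻¹ (moebius γ W) ≠ 0 := by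
    intro h; have := autJ_inv_moebius γ W hj; rw [h] at this; simp at this
  have := moebius_mem_finiteDisc hΓ (Γ.inv_mem hγ) h hj'
  rwa [moebius_inv_moebius γ W hj] at this

/-- The factor |j|⁴ from the squared Poisson kernel cancels the Jacobian, and Ω(Γ) is invariant. -/
theorem visualDisc_moebius (hΓ : Γ ≤ U21) {γ : GL (Fin 3) ℂ} (hγ : γ ∈ Γ) {Z : ℂ × ℂ}
    (hZ : 0 < height Z) : visualDisc Γ (moebius γ Z) = visualDisc Γ Z := by
  have hm := measurableSet_finiteDisc hΓ
  rw [visualDisc, visualDisc, ← lintegral_indicator hm, ← lintegral_indicator hm,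
    ← hasBoundaryJacobian (hΓ hγ) _ ((measurable_ofReal_poisson_sq _).indicator hm)]
  refine lintegral_congr_ae ?_
  filter_upwards [ae_autJ_ne_zero (hΓ hγ)] with W hj
  by_cases hW : W ∈ finiteDisc Γ
  · have hn : ‖autJ γ W‖ ≠ 0 := by simpa using hj
    rw [Set.indicator_of_mem hW,
      Set.indicator_of_mem ((moebius_mem_finiteDisc_iff hΓ hγ hj).2 hW), coe_jacobian,
      ← ENNReal.ofReal_mul (by positivity), poisson_moebius (hΓ hγ) hZ hj]
    congr 1
    field_simp
  · rw [Set.indicator_of_notMem hW,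
      Set.indicator_of_notMem (mt (moebius_mem_finiteDisc_iff hΓ hγ hj).1 hW), mul_zero]

/-- The complement of the orbit closure is a neighbourhood of `∞` in the one-point compactification,
which by definition has compact complement. -/
theorem isCompact_closure_orbit_of_infty_mem (hΓ : Γ ≤ U21) {Z : ℂ × ℂ} (hZ : 0 < height Z)
    (h : (∞ : OnePoint (ℂ × ℂ)) ∈ discontinuitySet Γ) :
    IsCompact (closure (Set.range fun γ : Γ => moebius γ Z)) := by
  set S := closure (Set.range fun γ : Γ => act γ (Z : OnePoint (ℂ × ℂ)))
  have h1 : (∞ : OnePoint (ℂ × ℂ)) ∈ Sᶜ := fun hc => h.2 ⟨h.1, Z, hZ, hc⟩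
  have h2 := ((OnePoint.isOpen_iff_of_mem h1).1 isClosed_closure.isOpen_compl).2
  have h3 : ((OnePoint.some : ℂ × ℂ → OnePoint (ℂ × ℂ)) ⁻¹' Sᶜ)ᶜ =
      closure (Set.range fun γ : Γ => moebius γ Z) := by
    ext W
    rw [← coe_mem_closure_orbit hΓ hZ]
    simp [S]
  rwa [h3] at h2

theorem height_zero : height (0 : ℂ × ℂ) = 0 := by simp [height_eq]

theorem norm_rho_zero (W : ℂ × ℂ) : ‖rho W 0‖ = ‖W.1‖ := by simp [rho]

theorem finiteDisc_nonempty (hΓ : Γ ≤ U21) (h : (discontinuitySet Γ).Nonempty) :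
    (finiteDisc Γ).Nonempty := by
  obtain ⟨x, hx⟩ := h
  induction x using OnePoint.rec with
  | coe W => exact ⟨W, hx⟩
  | infty =>
    rw [finiteDisc_eq hΓ]
    obtain ⟨R, hR⟩ :=
      (isCompact_closure_orbit_of_infty_mem hΓ height_basePoint_pos hx).isBounded.exists_norm_le
    refine ⟨param (0, |R| + 1), height_param _, fun hc => ?_⟩
    have h1 := (norm_fst_le _).trans (hR _ hc)
    have h2 : ‖(param (0, |R| + 1)).1‖ = |R| + 1 := by
      have h3 : (param (0, |R| + 1)).1 = ((|R| + 1 : ℝ) : ℂ) * I := by simp [param]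
      rw [h3, norm_mul, norm_I, mul_one, Complex.norm_real, Real.norm_of_nonneg (by positivity)]
    rw [h2] at h1
    linarith [le_abs_self R]

theorem measure_finiteDisc_pos (hΓ : Γ ≤ U21) (h : (discontinuitySet Γ).Nonempty) :
    0 < boundaryMeasure (finiteDisc Γ) := by
  obtain ⟨W, hW⟩ := finiteDisc_nonempty hΓ h
  rw [finiteDisc_eq hΓ] at *
  rw [boundaryMeasure_eq, measurableEmbedding_param.map_apply]
  have e : param ⁻¹' (siegelBoundary \ closure (Set.range fun γ : Γ => moebius γ basePoint)) =
      param ⁻¹' (closure (Set.range fun γ : Γ => moebius γ basePoint))ᶜ := by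
    ext p
    simp [siegelBoundary, height_param]
  rw [e]
  refine (isClosed_closure.isOpen_compl.preimage continuous_param).measure_pos _
    ⟨(W.2, W.1.im), ?_⟩
  rw [Set.mem_preimage, param_of_height_eq_zero hW.1]
  exact hW.2

theorem visualDisc_pos (hΓ : Γ ≤ U21) (h : (discontinuitySet Γ).Nonempty) {Z : ℂ × ℂ}
    (hZ : 0 < height Z) : visualDisc Γ Z ≠ 0 := by
  intro h0
  rw [visualDisc, setLIntegral_eq_zero_iff (measurableSet_finiteDisc hΓ)
    (measurable_ofReal_poisson_sq Z)] at h0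
  refine (measure_finiteDisc_pos hΓ h).ne' (measure_eq_zero_iff_ae_notMem.2 ?_)
  filter_upwards [h0] with W h1 h2
  have := h1 h2
  have hp := poisson_pos hZ (height_of_mem_finiteDisc h2).ge
  rw [ENNReal.ofReal_eq_zero] at this
  have : 0 < poisson Z W ^ 2 := by positivity
  linarith

/-- A lower bound for the visual measure of `Ω(Γ)` from a bound on the Poisson kernel on the
limit set. -/
theorem le_visualDisc_of_poisson_le (hΓ : Γ ≤ U21) {C : ℝ≥0∞} (hC : C ≠ ⊤)
    (hC' : ∀ Z, 0 < height Z →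
      ∫⁻ W, ENNReal.ofReal (poisson Z W ^ 2) ∂boundaryMeasure = C)
    {Z Z₀ : ℂ × ℂ} (hZ : 0 < height Z) (hZ₀ : 0 < height Z₀)
    (h : ∀ W, height W = 0 → W ∉ finiteDisc Γ → poisson Z W ≤ 1 / 2 * poisson Z₀ W) :
    C / 2 ≤ visualDisc Γ Z := by
  have hm := measurableSet_finiteDisc hΓ
  have h1 := lintegral_add_compl (μ := boundaryMeasure)
    (fun W => ENNReal.ofReal (poisson Z W ^ 2)) hm
  rw [hC' Z hZ] at h1
  have h2 : ∫⁻ W in (finiteDisc Γ)ᶜ, ENNReal.ofReal (poisson Z W ^ 2) ∂boundaryMeasure ≤ C / 2 := by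
    calc _ ≤ ∫⁻ W in (finiteDisc Γ)ᶜ, ENNReal.ofReal (poisson Z₀ W ^ 2) / 2 ∂boundaryMeasure := by
          refine setLIntegral_mono_ae' hm.compl ?_
          filter_upwards [ae_height_eq_zero] with W h3 h4
          have h5 := h W h3 h4
          have h6 := poisson_pos hZ h3.ge
          rw [show (2 : ℝ≥0∞) = ENNReal.ofReal 2 by simp,
            ← ENNReal.ofReal_div_of_pos (by norm_num)]
          refine ENNReal.ofReal_le_ofReal ?_
          nlinarith [poisson_pos hZ₀ h3.ge]
      _ ≤ ∫⁻ W, ENNReal.ofReal (poisson Z₀ W ^ 2) / 2 ∂boundaryMeasure :=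
          setLIntegral_le_lintegral _ _
      _ = C / 2 := by
          simp only [div_eq_mul_inv]
          rw [lintegral_mul_const _ (measurable_ofReal_poisson_sq Z₀), hC' Z₀ hZ₀]
  change visualDisc Γ Z + _ = C at h1
  have h3 : C / 2 + C / 2 ≤ visualDisc Γ Z + C / 2 := by
    rw [ENNReal.add_halves, ← h1]
    gcongr
    rw [h1]
    exact h2
  exact (ENNReal.add_le_add_iff_right (ENNReal.div_ne_top hC two_ne_zero)).1 h3

theorem eventually_poisson_le_near_finite (hΓ : Γ ≤ U21) {ω : ℂ × ℂ} (hω : ω ∈ finiteDisc Γ) :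
    ∀ᶠ Z in nhds ω, 0 < height Z → ∀ W, height W = 0 → W ∉ finiteDisc Γ →
      poisson Z W ≤ 1 / 2 * poisson basePoint W := by
  have hω0 := height_of_mem_finiteDisc hω
  obtain ⟨ε, hε, h⟩ : ∃ ε > 0, ∀ W, height W = 0 → W ∉ finiteDisc Γ → ε ≤ ‖rho ω W‖ := by
    rw [finiteDisc_eq hΓ] at hω
    obtain ⟨r, hr, hr'⟩ := Metric.isOpen_iff.1
      (isClosed_closure (s := Set.range fun γ : Γ => moebius γ basePoint)).isOpen_compl ω hω.2
    obtain ⟨ε, hε, hε'⟩ := exists_norm_rho_lt_imp_dist_lt hω0 hr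
    refine ⟨ε, hε, fun W hW hWΩ => ?_⟩
    by_contra! hlt
    rw [norm_rho_comm] at hlt
    refine hWΩ ?_
    rw [finiteDisc_eq hΓ]
    exact ⟨hW, hr' (hε' W hW.ge hlt)⟩
  set K := 3 * (‖rho basePoint ω‖ / ε + 1)
  have hK : 0 < K := by positivity
  -- With |ρ(Z, ω)| < ε/6 the triangle inequality absorbs half of |ρ(ω, W)|, leaving |ρ(ω, W)| ≤
  -- 6|ρ(Z, W)|. The other bound gives `height Z` ≤ 1/(72K²), which produces the factor 1/2.
  set η := min (ε / 6) (1 / (144 * K ^ 2))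
  have hη : 0 < η := by positivity
  obtain ⟨r, hr, hr'⟩ := exists_dist_lt_imp_norm_rho_lt ω hω0 hη
  filter_upwards [Metric.ball_mem_nhds ω hr] with Z hZr hZ W hW hWΩ
  have h1 := hr' Z hZr
  have h2 := h1.trans_le (min_le_left _ _)
  have h3 := h1.trans_le (min_le_right _ _)
  have h4 := height_le_norm_rho (Z := Z) hω0.ge
  have h5 := h W hW hWΩ
  have h6 := norm_rho_triangle (A := ω) (B := Z) (C := W) hω0.ge hZ.le hW.ge
  rw [norm_rho_comm Z ω] at h6
  have h7 := norm_rho_le_mul (A := basePoint) (B := ω) (V := W) height_basePoint_pos.le hω0.ge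
    hW.ge hε h5
  have h8 : ‖rho basePoint W‖ ≤ 6 * K * ‖rho Z W‖ := by
    have : ‖rho ω W‖ ≤ 6 * ‖rho Z W‖ := by linarith
    calc _ ≤ K * ‖rho ω W‖ := h7
      _ ≤ K * (6 * ‖rho Z W‖) := by gcongr
      _ = _ := by ring
  have h9 := norm_rho_pos hZ hW.ge
  have h10 := norm_rho_pos height_basePoint_pos hW.ge
  have h11 : height Z * (72 * K ^ 2) ≤ 1 := by
    have : height Z ≤ 2 * (1 / (144 * K ^ 2)) := by linarith
    calc _ ≤ 2 * (1 / (144 * K ^ 2)) * (72 * K ^ 2) := by gcongr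
      _ = 1 := by field_simp; norm_num
  rw [poisson, poisson, height_basePoint, div_le_iff₀ (by positivity),
    show 1 / 2 * (1 / ‖rho basePoint W‖ ^ 2) * ‖rho Z W‖ ^ 2 =
      (1 / 2 * ‖rho Z W‖ ^ 2) / ‖rho basePoint W‖ ^ 2 by ring, le_div_iff₀ (by positivity)]
  calc height Z * ‖rho basePoint W‖ ^ 2 ≤ height Z * (6 * K * ‖rho Z W‖) ^ 2 := by gcongr
    _ = (height Z * (72 * K ^ 2)) * (1 / 2 * ‖rho Z W‖ ^ 2) := by ring
    _ ≤ 1 * (1 / 2 * ‖rho Z W‖ ^ 2) := by gcongr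
    _ = _ := one_mul _

theorem norm_rho_basePoint_le {W : ℂ × ℂ} (hW : height W = 0) :
    ‖rho basePoint W‖ ≤ 3 * (1 / 2 + ‖W.1‖) := by
  have := norm_rho_triangle (A := basePoint) (B := 0) (C := W) height_basePoint_pos.le
    height_zero.ge hW.ge
  rw [norm_rho_zero, norm_rho_comm W 0, norm_rho_zero] at this
  simpa [basePoint] using this

theorem le_poisson_basePoint {W : ℂ × ℂ} (hW : height W = 0) {T : ℝ} (hT : ‖W.1‖ ≤ T) :
    1 / (3 * (1 / 2 + T)) ^ 2 ≤ poisson basePoint W := by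
  have h1 := norm_rho_basePoint_le hW
  have h2 := norm_rho_pos height_basePoint_pos hW.ge
  rw [poisson, height_basePoint]
  gcongr
  linarith

theorem exists_poisson_le_near_infty (hΓ : Γ ≤ U21) (h : (∞ : OnePoint (ℂ × ℂ)) ∈ discontinuitySet Γ) :
    ∃ T : ℝ, ∀ Z, T < ‖Z‖ → 0 < height Z → ∀ W, height W = 0 → W ∉ finiteDisc Γ →
      poisson Z W ≤ 1 / 2 * poisson basePoint W := by
  obtain ⟨R, hR⟩ :=
    (isCompact_closure_orbit_of_infty_mem hΓ height_basePoint_pos h).isBounded.exists_norm_le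
  obtain ⟨p, hp, hp'⟩ : ∃ p > 0, p = 1 / (3 * (1 / 2 + |R|)) ^ 2 := ⟨_, by positivity, rfl⟩
  -- The limit set is bounded, so this threshold forces |ρ(Z, W)| ≥ 4/p, whence P(Z, W) ≤ 2/|ρ(Z,
  -- W)| ≤ p/2. The extra 2 lets a bound on `‖Z.1‖` also bound `‖Z.2‖`, since `‖Z.2‖ ^ 2 < 2 *
  -- Z.1.re`.
  refine ⟨3 * (|R| + 4 / p) + 2, fun Z hZT hZ W hW hWΩ => ?_⟩
  have hWR : ‖W.1‖ ≤ |R| := by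
    rw [finiteDisc_eq hΓ] at hWΩ
    have : W ∈ closure (Set.range fun γ : Γ => moebius γ basePoint) := by
      by_contra hc; exact hWΩ ⟨hW, hc⟩
    exact (norm_fst_le W).trans ((hR W this).trans (le_abs_self R))
  have h1 := le_poisson_basePoint hW hWR
  rw [← hp'] at h1
  have h2 : 3 * (|R| + 4 / p) + 2 < ‖Z.1‖ := by
    by_contra! hle
    have hpos : 0 ≤ 3 * (|R| + 4 / p) := by positivity
    have h3 : ‖Z.2‖ ≤ 3 * (|R| + 4 / p) + 2 := by
      rw [height_eq] at hZ
      have h4 := Complex.re_le_norm Z.1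
      refine le_of_sq_le_sq ?_ (by positivity)
      nlinarith
    exact absurd (max_le hle h3) hZT.not_ge
  have h3 := norm_rho_triangle (A := Z) (B := W) (C := 0) hZ.le hW.ge height_zero.ge
  rw [norm_rho_zero, norm_rho_zero] at h3
  have h4 : 4 / p ≤ ‖rho Z W‖ := by linarith
  refine (poisson_le hZ hW.ge).trans ?_
  have h5 := norm_rho_pos hZ hW.ge
  rw [div_le_iff₀ hp] at h4
  rw [div_le_iff₀ h5]
  nlinarith

/-- A Harnack inequality: near an interior point the Poisson kernels are comparable, uniformly in
the boundary variable. -/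
theorem eventually_le_visualDisc_near {Z₁ : ℂ × ℂ} (hZ₁ : 0 < height Z₁) :
    ∃ c : ℝ, 0 < c ∧ ∀ᶠ Z in nhds Z₁, ENNReal.ofReal c * visualDisc Γ Z₁ ≤ visualDisc Γ Z := by
  set K := 3 * ((‖rho Z₁ Z₁‖ + 1) / (height Z₁ / 2) + 1)
  have hK : 0 < K := by positivity
  refine ⟨(1 / 2 / K ^ 2) ^ 2, by positivity, ?_⟩
  have hc1 : ContinuousAt (fun Z => ‖rho Z Z₁‖) Z₁ := by unfold rho; fun_prop
  have e1 := hc1.eventually (gt_mem_nhds (lt_add_one _))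
  have e2 := continuous_height.continuousAt.eventually (lt_mem_nhds (half_lt_self hZ₁))
  filter_upwards [e1, e2] with Z h1 h2
  have hZ : 0 < height Z := (half_pos hZ₁).trans h2
  rw [visualDisc, visualDisc, ← lintegral_const_mul _ (measurable_ofReal_poisson_sq Z₁)]
  refine lintegral_mono_ae ?_
  filter_upwards [ae_restrict_of_ae ae_height_eq_zero] with W hW
  rw [← ENNReal.ofReal_mul (by positivity), ← mul_pow]
  refine ENNReal.ofReal_le_ofReal ?_
  have hp := poisson_pos hZ₁ hW.ge
  refine pow_le_pow_left₀ (by positivity) ?_ 2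
  have h3 := norm_rho_le_mul (A := Z) (B := Z₁) (V := W) hZ.le hZ₁.le hW.ge (half_pos hZ₁)
    (by have := height_le_norm_rho (Z := Z₁) hW.ge; linarith)
  have h4 : ‖rho Z W‖ ≤ K * ‖rho Z₁ W‖ := by
    refine h3.trans ?_
    simp only [K]
    gcongr
  have h5 := norm_rho_pos hZ hW.ge
  have h6 := norm_rho_pos hZ₁ hW.ge
  rw [poisson, poisson, le_div_iff₀ (by positivity)]
  calc 1 / 2 / K ^ 2 * (height Z₁ / ‖rho Z₁ W‖ ^ 2) * ‖rho Z W‖ ^ 2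
      ≤ 1 / 2 / K ^ 2 * (height Z₁ / ‖rho Z₁ W‖ ^ 2) * (K * ‖rho Z₁ W‖) ^ 2 := by gcongr
    _ = height Z₁ / 2 := by field_simp
    _ ≤ _ := h2.le

/-- By invariance a bound on a compact set meeting every orbit suffices, so it may be proved
locally. Interior points are covered by Harnack. Near points of Ω(Γ), including `∞`, the limit set
receives at most half of the total mass. -/
theorem exists_le_visualDisc (hΓ : IsConvexCocompact Γ) :
    ∃ κ : ℝ≥0∞, κ ≠ 0 ∧ ∀ Z, 0 < height Z → κ ≤ visualDisc Γ Z := by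
  have hU := hΓ.le_U21
  obtain ⟨K, hK, hKsub, hKcov⟩ := hΓ.cocompact
  obtain ⟨C, hC, hC'⟩ := lintegral_poisson_sq
  have hC0 : C ≠ 0 := by
    intro h0
    refine visualDisc_pos hU hΓ.nonempty height_basePoint_pos (le_antisymm ?_ zero_le)
    rw [← h0, ← hC' basePoint height_basePoint_pos]
    exact setLIntegral_le_lintegral _ _
  have hC2 : C / 2 ≠ 0 := (ENNReal.half_pos hC0).ne'
  have key : ∃ κ : ℝ≥0∞, κ ≠ 0 ∧ ∀ Z : ℂ × ℂ, 0 < height Z → (Z : OnePoint (ℂ × ℂ)) ∈ K →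
      κ ≤ visualDisc Γ Z := by
    refine hK.induction_on
      (p := fun S => ∃ κ : ℝ≥0∞, κ ≠ 0 ∧ ∀ Z : ℂ × ℂ, 0 < height Z → (Z : OnePoint (ℂ × ℂ)) ∈ S →
        κ ≤ visualDisc Γ Z) ⟨1, one_ne_zero, fun Z _ h => h.elim⟩ ?_ ?_ ?_
    · rintro S T hST ⟨κ, h1, h2⟩
      exact ⟨κ, h1, fun Z hZ hS => h2 Z hZ (hST hS)⟩
    · rintro S T ⟨κ, h1, h2⟩ ⟨κ', h1', h2'⟩
      refine ⟨min κ κ', ?_, fun Z hZ h => ?_⟩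
      · rcases min_choice κ κ' with h | h <;> rw [h] <;> assumption
      · rcases h with h | h
        · exact (min_le_left _ _).trans (h2 Z hZ h)
        · exact (min_le_right _ _).trans (h2' Z hZ h)
    · intro x hx
      have near_coe : ∀ (V : ℂ × ℂ) (κ : ℝ≥0∞), κ ≠ 0 →
          (∀ᶠ Z in nhds V, 0 < height Z → κ ≤ visualDisc Γ Z) →
          ∃ t ∈ nhdsWithin (V : OnePoint (ℂ × ℂ)) K, ∃ κ : ℝ≥0∞, κ ≠ 0 ∧
            ∀ Z : ℂ × ℂ, 0 < height Z → (Z : OnePoint (ℂ × ℂ)) ∈ t → κ ≤ visualDisc Γ Z := by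
        intro V κ hκ hev
        refine ⟨OnePoint.some '' {Z | 0 < height Z → κ ≤ visualDisc Γ Z},
          mem_nhdsWithin_of_mem_nhds ?_, κ, hκ, ?_⟩
        · rw [OnePoint.nhds_coe_eq]
          exact Filter.image_mem_map hev
        · rintro Z hZ ⟨Z', h, he⟩
          rw [OnePoint.coe_injective he] at h
          exact h hZ
      induction x using OnePoint.rec with
      | coe V =>
        rcases hKsub hx with ⟨V', hV, he⟩ | hV
        · rw [OnePoint.coe_injective he] at hV
          obtain ⟨c, hc, h⟩ := eventually_le_visualDisc_near (Γ := Γ) hV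
          exact near_coe V _ (mul_ne_zero (by simpa using hc) (visualDisc_pos hU hΓ.nonempty hV))
            (h.mono fun Z hZ _ => hZ)
        · exact near_coe V _ hC2 ((eventually_poisson_le_near_finite hU hV).mono fun Z h hZ =>
            le_visualDisc_of_poisson_le hU hC hC' hZ height_basePoint_pos (h hZ))
      | infty =>
        have hV : (∞ : OnePoint (ℂ × ℂ)) ∈ discontinuitySet Γ := by
          rcases hKsub hx with ⟨V', _, he⟩ | hV
          · exact absurd he (OnePoint.coe_ne_infty V')
          · exact hV
        obtain ⟨T, hT⟩ := exists_poisson_le_near_infty hU hV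
        refine ⟨(OnePoint.some '' Metric.closedBall 0 T)ᶜ, mem_nhdsWithin_of_mem_nhds ?_,
          C / 2, hC2, fun Z hZ h => ?_⟩
        · refine (OnePoint.isOpen_compl_image_coe.2
            ⟨Metric.isClosed_closedBall, isCompact_closedBall _ _⟩).mem_nhds ?_
          simp
        · refine le_visualDisc_of_poisson_le hU hC hC' hZ height_basePoint_pos (hT Z ?_ hZ)
          by_contra! hle
          exact h ⟨Z, by simpa using hle, rfl⟩
  obtain ⟨κ, hκ, h⟩ := key
  refine ⟨κ, hκ, fun Z hZ => ?_⟩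
  obtain ⟨γ, hγ, hm⟩ := hKcov _ (Or.inl ⟨Z, hZ, rfl⟩)
  rw [act_coe_of_ne (autJ_ne_zero (hU hγ) hZ)] at hm
  rw [← visualDisc_moebius hU hγ hZ]
  exact h _ (height_moebius_pos (hU hγ) hZ) hm

/-! The limit set has measure zero. -/

/-- The point at height `h` above `W`. -/
noncomputable def raise (h : ℝ) (W : ℂ × ℂ) : ℂ × ℂ := (W.1 + (h / 2 : ℝ), W.2)

theorem height_raise (h : ℝ) (W : ℂ × ℂ) : height (raise h W) = height W + h := by
  simp [height_eq, raise]; ring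

theorem rho_raise (h : ℝ) (V W : ℂ × ℂ) : rho (raise h V) W = rho V W + (h / 2 : ℝ) := by
  simp only [rho, raise, map_add, Complex.conj_ofReal]; ring

theorem poisson_raise_comm (h : ℝ) {V W : ℂ × ℂ} (hV : height V = 0) (hW : height W = 0) :
    poisson (raise h V) W = poisson (raise h W) V := by
  rw [poisson, poisson, height_raise, height_raise, hV, hW, rho_raise, rho_raise, rho_symm V W]
  congr 2
  rw [← RCLike.norm_conj]
  simp only [map_add, Complex.conj_ofReal]

theorem poisson_raise_le {h : ℝ} (hh : 0 < h) {V W : ℂ × ℂ} (hV : height V = 0)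
    (hW : height W = 0) {ε : ℝ} (hε : 0 < ε) (h' : ε ≤ ‖rho V W‖) :
    poisson (raise h V) W ≤ h / ε ^ 2 := by
  have h1 : ‖rho V W‖ ≤ ‖rho V W + (h / 2 : ℝ)‖ := by
    have hre : 0 ≤ (rho V W).re := by rw [re_rho, hV, hW]; positivity
    rw [← abs_of_nonneg (norm_nonneg (rho V W)), ← abs_of_nonneg (norm_nonneg (rho V W + _)),
      ← sq_le_sq, ← Complex.normSq_eq_norm_sq, ← Complex.normSq_eq_norm_sq, Complex.normSq_apply,
      Complex.normSq_apply]
    simp only [add_re, add_im, ofReal_re, ofReal_im, add_zero]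
    nlinarith
  rw [poisson, height_raise, hV, zero_add, rho_raise]
  gcongr
  exact h'.trans h1

theorem measurable_poisson_raise (h : ℝ) :
    Measurable fun p : (ℂ × ℂ) × (ℂ × ℂ) => ENNReal.ofReal (poisson (raise h p.1) p.2 ^ 2) := by
  have h1 : Measurable fun p : (ℂ × ℂ) × (ℂ × ℂ) => (raise h p.1, p.2) := by
    unfold raise; fun_prop
  have := measurable_poisson.comp h1
  simp only [Function.comp_def] at this
  fun_prop

/-- Integrating the lower bound κ over points at height h above the piece A gives κ m(A) ≤ ∫_Ω p_h
after exchanging integrals. As h → 0, p_h tends to 0 pointwise on Ω(Γ), dominated by a multiple of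
P(`basePoint`, ·)². -/
theorem measure_limitSet_inter_closedBall (hΓ : IsConvexCocompact Γ) {R : ℝ} (hR : 0 ≤ R) :
    boundaryMeasure ((siegelBoundary \ finiteDisc Γ) ∩ Metric.closedBall 0 R) = 0 := by
  have hU := hΓ.le_U21
  have hmΩ := measurableSet_finiteDisc hU
  set A := (siegelBoundary \ finiteDisc Γ) ∩ Metric.closedBall 0 R
  have hmA : MeasurableSet A :=
    (isClosed_siegelBoundary.measurableSet.diff hmΩ).inter Metric.isClosed_closedBall.measurableSet
  obtain ⟨κ, hκ, hκ'⟩ := exists_le_visualDisc hΓ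
  obtain ⟨C, hC, hC'⟩ := lintegral_poisson_sq
  have hA1 : ∀ ξ ∈ A, ‖ξ.1‖ ≤ R := fun ξ hξ =>
    (norm_fst_le ξ).trans (by simpa using hξ.2)
  have hlow : ∀ {T : ℝ}, 0 ≤ T → ∃ p : ℝ, 0 < p ∧ ∀ W, height W = 0 → ‖W.1‖ ≤ T →
      p ≤ poisson basePoint W ^ 2 := fun {T} hT =>
    ⟨(1 / (3 * (1 / 2 + T)) ^ 2) ^ 2, by positivity, fun W hW hWT =>
      pow_le_pow_left₀ (by positivity) (le_poisson_basePoint hW hWT) 2⟩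
  have hAfin : boundaryMeasure A ≠ ⊤ := by
    obtain ⟨p, hp, hp'⟩ := hlow hR
    have h1 : ENNReal.ofReal p * boundaryMeasure A ≤ C := by
      rw [← setLIntegral_const, ← hC' basePoint height_basePoint_pos]
      refine (setLIntegral_mono' hmA fun ξ hξ => ?_).trans (setLIntegral_le_lintegral A _)
      exact ENNReal.ofReal_le_ofReal (hp' ξ hξ.1.1 (hA1 ξ hξ))
    intro htop
    rw [htop, ENNReal.mul_top (by simpa using hp)] at h1
    exact hC (top_le_iff.1 h1)
  set p : ℝ → ℂ × ℂ → ℝ≥0∞ := fun h W =>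
    ∫⁻ ξ in A, ENNReal.ofReal (poisson (raise h ξ) W ^ 2) ∂boundaryMeasure
  have hpm : ∀ h, Measurable (p h) := fun h => by
    have := (measurable_poisson_raise h).comp measurable_swap
    exact this.lintegral_prod_right' (ν := boundaryMeasure.restrict A)
  have hle : ∀ h : ℝ, 0 < h →
      κ * boundaryMeasure A ≤ ∫⁻ W in finiteDisc Γ, p h W ∂boundaryMeasure := by
    intro h hh
    rw [← setLIntegral_const]
    calc _ ≤ ∫⁻ ξ in A, ∫⁻ W in finiteDisc Γ,
          ENNReal.ofReal (poisson (raise h ξ) W ^ 2) ∂boundaryMeasure ∂boundaryMeasure := by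
          refine setLIntegral_mono' hmA fun ξ hξ => hκ' _ ?_
          have : height ξ = 0 := hξ.1.1
          rw [height_raise, this]; linarith
      _ = _ := lintegral_lintegral_swap (measurable_poisson_raise h).aemeasurable
  -- Below this radius symmetry of the raised kernel bounds p_h by the total mass C. Beyond it every
  -- ξ in A has |ρ(ξ, W)| ≥ |W₁|/6, and 1296 = 36 · 36 compares the resulting decay with the kernel
  -- at `basePoint`.
  obtain ⟨q, hq, hq'⟩ := hlow (T := 6 * R + 1) (by positivity)
  set M : ℝ≥0∞ := C / ENNReal.ofReal q + ENNReal.ofReal (1296 ^ 2) * boundaryMeasure A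
  have hM : M ≠ ⊤ := ENNReal.add_ne_top.2 ⟨ENNReal.div_ne_top hC (by simpa using hq),
    ENNReal.mul_ne_top ENNReal.ofReal_ne_top hAfin⟩
  have hbound : ∀ h : ℝ, 0 < h → h ≤ 1 → ∀ W, height W = 0 →
      p h W ≤ M * ENNReal.ofReal (poisson basePoint W ^ 2) := by
    intro h hh hh1 W hW
    by_cases hWT : ‖W.1‖ ≤ 6 * R + 1
    · have h1 : p h W ≤ C := by
        rw [← hC' (raise h W) (by rw [height_raise, hW]; linarith)]
        refine le_trans (le_of_eq ?_) (setLIntegral_le_lintegral A _)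
        refine setLIntegral_congr_fun hmA fun ξ hξ => ?_
        rw [poisson_raise_comm h hξ.1.1 hW]
      calc p h W ≤ C := h1
        _ = C / ENNReal.ofReal q * ENNReal.ofReal q :=
          (ENNReal.div_mul_cancel (by simpa using hq) ENNReal.ofReal_ne_top).symm
        _ ≤ _ := by
          gcongr
          · exact le_self_add
          · exact hq' W hW hWT
    · push Not at hWT
      calc p h W ≤ ∫⁻ ξ in A, ENNReal.ofReal (1296 ^ 2) *
            ENNReal.ofReal (poisson basePoint W ^ 2) ∂boundaryMeasure := by
            refine setLIntegral_mono' hmA fun ξ hξ => ?_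
            rw [← ENNReal.ofReal_mul (by positivity), ← mul_pow]
            refine ENNReal.ofReal_le_ofReal ?_
            have hξ0 : height ξ = 0 := hξ.1.1
            have hpos := poisson_pos (Z := raise h ξ) (W := W)
              (by rw [height_raise, hξ0]; linarith) hW.ge
            refine pow_le_pow_left₀ hpos.le ?_ 2
            have h2 := norm_rho_triangle (A := W) (B := ξ) (C := 0) hW.ge hξ0.ge height_zero.ge
            rw [norm_rho_zero, norm_rho_zero, norm_rho_comm] at h2
            have h3 := hA1 ξ hξ
            have hWpos : 0 < ‖W.1‖ := by linarith
            have h4 := poisson_raise_le hh hξ0 hW (ε := ‖W.1‖ / 6) (by positivity) (by linarith)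
            have h5 := le_poisson_basePoint hW le_rfl
            have h6 : 1 / (3 * (2 * ‖W.1‖)) ^ 2 ≤ 1 / (3 * (1 / 2 + ‖W.1‖)) ^ 2 := by
              gcongr
              linarith
            calc _ ≤ h / (‖W.1‖ / 6) ^ 2 := h4
              _ ≤ 1 / (‖W.1‖ / 6) ^ 2 := by gcongr
              _ = 1296 * (1 / (3 * (2 * ‖W.1‖)) ^ 2) := by field_simp; norm_num
              _ ≤ _ := by gcongr; exact h6.trans h5
        _ = ENNReal.ofReal (1296 ^ 2) * boundaryMeasure A *
            ENNReal.ofReal (poisson basePoint W ^ 2) := by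
            rw [setLIntegral_const]; ring
        _ ≤ _ := by
            gcongr
            exact le_add_self
  have hlim : Filter.Tendsto (fun n : ℕ => ∫⁻ W in finiteDisc Γ, p (1 / ((n : ℝ) + 1)) W
      ∂boundaryMeasure) Filter.atTop (nhds (∫⁻ W in finiteDisc Γ, 0 ∂boundaryMeasure)) := by
    refine tendsto_lintegral_of_dominated_convergence
      (fun W => M * ENNReal.ofReal (poisson basePoint W ^ 2)) (fun n => hpm _) (fun n => ?_) ?_ ?_
    · filter_upwards [ae_restrict_of_ae ae_height_eq_zero] with W hW
      refine hbound _ (by positivity) ?_ W hW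
      rw [div_le_one (by positivity)]
      have : (0 : ℝ) ≤ n := Nat.cast_nonneg n
      linarith
    · refine ((setLIntegral_le_lintegral _ _).trans_lt ?_).ne
      rw [lintegral_const_mul _ (measurable_ofReal_poisson_sq _), hC' _ height_basePoint_pos]
      exact ENNReal.mul_lt_top hM.lt_top hC.lt_top
    · filter_upwards [ae_restrict_mem hmΩ] with W hW
      have hW0 := height_of_mem_finiteDisc hW
      obtain ⟨ε, hε, hε'⟩ : ∃ ε > 0, ∀ ξ ∈ A, ε ≤ ‖rho ξ W‖ := by
        have hW2 := hW
        rw [finiteDisc_eq hU] at hW2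
        obtain ⟨r, hr, hr'⟩ := Metric.isOpen_iff.1
          (isClosed_closure (s := Set.range fun γ : Γ => moebius γ basePoint)).isOpen_compl W hW2.2
        obtain ⟨ε, hε, hε'⟩ := exists_norm_rho_lt_imp_dist_lt hW0 hr
        refine ⟨ε, hε, fun ξ hξ => ?_⟩
        by_contra! hlt
        refine hξ.1.2 ?_
        rw [finiteDisc_eq hU]
        exact ⟨hξ.1.1, hr' (hε' ξ (le_of_eq (Eq.symm hξ.1.1)) hlt)⟩
      have hub : ∀ n : ℕ, p (1 / ((n : ℝ) + 1)) W ≤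
          ENNReal.ofReal (((1 / ((n : ℝ) + 1)) / ε ^ 2) ^ 2) * boundaryMeasure A := by
        intro n
        rw [← setLIntegral_const]
        refine setLIntegral_mono' hmA fun ξ hξ => ENNReal.ofReal_le_ofReal ?_
        have hξ0 : height ξ = 0 := hξ.1.1
        have hn : 0 < 1 / ((n : ℝ) + 1) := by positivity
        refine pow_le_pow_left₀ (poisson_pos ?_ hW0.ge).le
          (poisson_raise_le hn hξ0 hW0 hε (hε' ξ hξ)) 2
        rw [height_raise, hξ0, zero_add]
        exact hn
      refine tendsto_of_tendsto_of_tendsto_of_le_of_le tendsto_const_nhds ?_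
        (fun n => zero_le) hub
      have h1 : Filter.Tendsto (fun n : ℕ => ((1 / ((n : ℝ) + 1)) / ε ^ 2) ^ 2) Filter.atTop
          (nhds 0) := by
        have := (tendsto_one_div_add_atTop_nhds_zero_nat (𝕜 := ℝ)).div_const (ε ^ 2)
        simpa using this.pow 2
      have h2 := ENNReal.tendsto_ofReal h1
      rw [ENNReal.ofReal_zero] at h2
      have h3 := ENNReal.Tendsto.mul_const (b := boundaryMeasure A) h2 (Or.inr hAfin)
      rwa [zero_mul] at h3
  rw [lintegral_zero] at hlim
  have h0 : κ * boundaryMeasure A ≤ 0 :=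
    ge_of_tendsto' hlim fun n => hle _ (by positivity)
  have := le_antisymm h0 zero_le
  exact (mul_eq_zero.1 this).resolve_left hκ

theorem ae_mem_finiteDisc (hΓ : IsConvexCocompact Γ) :
    ∀ᵐ W ∂boundaryMeasure, W ∈ finiteDisc Γ := by
  have h : ∀ᵐ W ∂boundaryMeasure, ∀ n : ℕ,
      W ∉ (siegelBoundary \ finiteDisc Γ) ∩ Metric.closedBall 0 (n : ℝ) :=
    ae_all_iff.2 fun n => measure_eq_zero_iff_ae_notMem.1
      (measure_limitSet_inter_closedBall hΓ (Nat.cast_nonneg n))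
  filter_upwards [h, ae_height_eq_zero] with W h1 h2
  by_contra hW
  obtain ⟨n, hn⟩ := exists_nat_ge ‖W‖
  exact h1 n ⟨⟨h2, hW⟩, by simpa using hn⟩

end SiegelU21

/-! ### Existence of a measurable fundamental domain. -/

namespace SiegelU21

variable {Γ : Subgroup (GL (Fin 3) ℂ)}

/-- The points of `Ω(Γ)` whose orbit does not contain `∞`. -/
def regularDisc (Γ : Subgroup (GL (Fin 3) ℂ)) : Set (ℂ × ℂ) :=
  {W | W ∈ finiteDisc Γ ∧ ∀ γ : Γ, autJ γ W ≠ 0}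

theorem ae_autJ_ne_zero_forall [Countable Γ] (hΓ : Γ ≤ U21) :
    ∀ᵐ W ∂boundaryMeasure, ∀ γ : Γ, autJ γ W ≠ 0 :=
  ae_all_iff.2 fun γ => ae_autJ_ne_zero (hΓ γ.2)

theorem measurableSet_regularDisc [Countable Γ] (hΓ : Γ ≤ U21) :
    MeasurableSet (regularDisc Γ) := by
  refine (measurableSet_finiteDisc hΓ).inter ?_
  have : {W : ℂ × ℂ | ∀ γ : Γ, autJ γ W ≠ 0} = ⋂ γ : Γ, {W | autJ γ W ≠ 0} := by
    ext W; simp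
  rw [show (fun W : ℂ × ℂ => ∀ γ : Γ, autJ γ W ≠ 0) = {W : ℂ × ℂ | ∀ γ : Γ, autJ γ W ≠ 0} from rfl,
    this]
  exact MeasurableSet.iInter fun γ =>
    (measurableSet_eq_fun (measurable_autJ _) measurable_const).compl

theorem moebius_mem_regularDisc (hΓ : Γ ≤ U21) (γ : Γ) {W : ℂ × ℂ} (hW : W ∈ regularDisc Γ) :
    moebius γ W ∈ regularDisc Γ := by
  refine ⟨moebius_mem_finiteDisc hΓ γ.2 hW.1 (hW.2 γ), fun β h => ?_⟩
  have := hW.2 (β * γ)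
  rw [Subgroup.coe_mul, autJ_mul _ _ _ (hW.2 γ), h, zero_mul] at this
  exact this rfl

/-- The quantity minimized over an orbit to select a point of the fundamental domain. -/
noncomputable def domainKey (W : ℂ × ℂ) (γ : GL (Fin 3) ℂ) : ℝ ×ₗ ℝ :=
  toLex (-poisson (moebius γ basePoint) W, embeddingReal (ℂ × ℂ) (moebius γ⁻¹ W))

theorem domainKey_le_iff {W : ℂ × ℂ} {β γ : GL (Fin 3) ℂ} :
    domainKey W β ≤ domainKey W γ ↔
      poisson (moebius γ basePoint) W < poisson (moebius β basePoint) W ∨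
      poisson (moebius γ basePoint) W = poisson (moebius β basePoint) W ∧
        embeddingReal (ℂ × ℂ) (moebius β⁻¹ W) ≤ embeddingReal (ℂ × ℂ) (moebius γ⁻¹ W) := by
  rw [domainKey, domainKey, Prod.Lex.toLex_le_toLex, neg_lt_neg_iff, neg_inj, eq_comm]

/-- Moving `W` by α multiplies all Poisson values by the same positive factor and translates the
index by α⁻¹, so the order of keys is equivariant. -/
theorem domainKey_moebius_le_iff (hΓ : Γ ≤ U21) {W : ℂ × ℂ} (hW : W ∈ regularDisc Γ)
    (α β γ : Γ) : domainKey (moebius α W) β ≤ domainKey (moebius α W) γ ↔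
      domainKey W ((α⁻¹ * β : Γ) : GL (Fin 3) ℂ) ≤ domainKey W ((α⁻¹ * γ : Γ) : GL (Fin 3) ℂ) := by
  have hp : 0 < ‖autJ α W‖ ^ 2 := by
    have : 0 < ‖autJ α W‖ := by simpa using hW.2 α
    positivity
  have h1 : ∀ δ : Γ, poisson (moebius δ basePoint) (moebius α W) =
      poisson (moebius ((α⁻¹ * δ : Γ) : GL (Fin 3) ℂ) basePoint) W * ‖autJ α W‖ ^ 2 := fun δ => by
    rw [poisson_moebius_right (hΓ α.2) (height_moebius_pos (hΓ δ.2) height_basePoint_pos) (hW.2 α),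
      Subgroup.coe_mul, moebius_mul _ _ _ (autJ_ne_zero (hΓ δ.2) height_basePoint_pos)]
    rfl
  have h2 : ∀ δ : Γ, moebius (δ : GL (Fin 3) ℂ)⁻¹ (moebius α W) =
      moebius ((α⁻¹ * δ : Γ) : GL (Fin 3) ℂ)⁻¹ W := fun δ => by
    rw [← moebius_mul _ _ _ (hW.2 α)]
    simp
  rw [domainKey_le_iff, domainKey_le_iff, h1, h1, h2, h2, mul_lt_mul_iff_left₀ hp,
    mul_left_inj' hp.ne']

/-- Summability leaves only finitely many γ whose Poisson value is at least that of the identity;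
the minimum is taken among them. -/
theorem exists_domainKey_min (hΓ : Γ ≤ U21) (hδ : criticalExponent Γ < 1) {W : ℂ × ℂ}
    (hW : W ∈ finiteDisc Γ) : ∃ γ : Γ, ∀ β : Γ, domainKey W γ ≤ domainKey W β := by
  have hpos := poisson_pos (Z := moebius ((1 : Γ) : GL (Fin 3) ℂ) basePoint) (W := W)
    (height_moebius_pos (hΓ (1 : Γ).2) height_basePoint_pos) (height_of_mem_finiteDisc hW).ge
  have hfin := eventually_poisson_lt hΓ hδ height_basePoint_pos hW hpos
  rw [Filter.eventually_cofinite] at hfin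
  obtain ⟨γ, hγ, hmin⟩ := Set.exists_min_image _ (fun γ : Γ => domainKey W γ) hfin
    ⟨1, lt_irrefl _⟩
  refine ⟨γ, fun β => ?_⟩
  by_cases hβ : poisson (moebius β basePoint) W <
    poisson (moebius ((1 : Γ) : GL (Fin 3) ℂ) basePoint) W
  · refine (hmin 1 (lt_irrefl _)).trans ?_
    rw [domainKey_le_iff]
    exact Or.inl hβ
  · exact hmin β hβ

theorem exists_isFundDomain [Countable Γ] (hΓ : IsConvexCocompact Γ)
    (hδ : criticalExponent Γ < 1) : ∃ D, IsFundDomain Γ D := by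
  have hU := hΓ.le_U21
  set D : Set (ℂ × ℂ) := {W | W ∈ regularDisc Γ ∧
    ∀ γ : Γ, domainKey W (1 : Γ) ≤ domainKey W γ}
  have hmem : ∀ W ∈ regularDisc Γ, ∀ α : Γ, act α (W : OnePoint (ℂ × ℂ)) ∈ OnePoint.some '' D ↔
      ∀ γ : Γ, domainKey W ((α⁻¹ : Γ) : GL (Fin 3) ℂ) ≤ domainKey W γ := by
    intro W hW α
    rw [act_mem_coe_image, and_iff_right (hW.2 α)]
    change (_ ∧ _) ↔ _
    rw [and_iff_right (moebius_mem_regularDisc hU α hW)]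
    simp only [domainKey_moebius_le_iff hU hW, mul_one]
    exact ⟨fun h γ => by simpa using h (α * γ), fun h γ => h _⟩
  refine ⟨D, ?_, ?_, ?_⟩
  · refine (measurableSet_regularDisc hU).inter ?_
    have : {W : ℂ × ℂ | ∀ γ : Γ, domainKey W (1 : Γ) ≤ domainKey W γ} =
        ⋂ γ : Γ, {W | domainKey W (1 : Γ) ≤ domainKey W γ} := by ext W; simp
    change MeasurableSet {W : ℂ × ℂ | ∀ γ : Γ, domainKey W (1 : Γ) ≤ domainKey W γ}
    rw [this]
    refine MeasurableSet.iInter fun γ => ?_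
    simp only [domainKey_le_iff]
    have hp : ∀ β : Γ, Measurable fun W => poisson (moebius β basePoint) W := fun β =>
      measurable_poisson_right _
    have hf : ∀ β : Γ, Measurable fun W =>
        embeddingReal (ℂ × ℂ) (moebius (β : GL (Fin 3) ℂ)⁻¹ W) := fun β =>
      (measurableEmbedding_embeddingReal _).measurable.comp (measurable_moebius _)
    exact (measurableSet_lt (hp _) (hp _)).union
      ((measurableSet_eq_fun (hp _) (hp _)).inter (measurableSet_le (hf _) (hf _)))
  · rintro _ ⟨W, hW, rfl⟩
    exact hW.1.1
  · filter_upwards [ae_autJ_ne_zero_forall hU] with W hj hW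
    have hreg : W ∈ regularDisc Γ := ⟨hW, hj⟩
    obtain ⟨γ, hγ⟩ := exists_domainKey_min hU hδ hW
    refine ⟨γ⁻¹, ?_, fun β hβ => ?_⟩
    · simp only
      rw [hmem W hreg, inv_inv]
      exact hγ
    · simp only at hβ
      rw [hmem W hreg] at hβ
      have e := le_antisymm (hβ γ) (hγ β⁻¹)
      -- Equal keys have equal second components, so the two group elements move `W` to the same
      -- point; freeness on Ω(Γ) then identifies them.
      have e2 := (measurableEmbedding_embeddingReal (ℂ × ℂ)).injective
        (congrArg (fun x => (ofLex x).2) e)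
      have e3 : moebius β W = moebius (γ⁻¹ : Γ) W := by simpa [domainKey] using e2
      have e4 : moebius ((γ * β : Γ) : GL (Fin 3) ℂ) W = W := by
        rw [Subgroup.coe_mul, moebius_mul _ _ _ (hj β), e3, ← moebius_mul _ _ _ (hj _)]
        simp [moebius_one]
      have e5 := hΓ.free _ (γ * β : Γ).2 W (Or.inr hW) (by rw [act_coe_of_ne (hj _), e4])
      have e6 : γ * β = 1 := Subtype.ext e5
      exact eq_inv_of_mul_eq_one_right e6

end SiegelU21

/-! ### Unfolding and the final summation. -/

namespace SiegelU21

open scoped ENNReal in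
theorem integrable_tsum_of_summable_integral_norm {α ι : Type*} [MeasurableSpace α] [Countable ι]
    {μ : Measure α} {F : ι → α → ℂ} (hF : ∀ i, Integrable (F i) μ)
    (hsum : Summable fun i => ∫ a, ‖F i a‖ ∂μ) (hF' : ∀ᵐ a ∂μ, Summable fun i => F i a) :
    Integrable (fun a => ∑' i, F i a) μ := by
  constructor
  · refine aestronglyMeasurable_of_tendsto_ae (Filter.atTop : Filter (Finset ι))
      (f := fun S a => ∑ i ∈ S, F i a) (fun S => ?_) ?_
    · exact (integrable_finsetSum S fun i _ => hF i).1
    · filter_upwards [hF'] with a ha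
      exact ha.hasSum
  · rw [hasFiniteIntegral_iff_enorm]
    calc ∫⁻ a, ‖∑' i, F i a‖ₑ ∂μ ≤ ∫⁻ a, ∑' i, ‖F i a‖ₑ ∂μ :=
          lintegral_mono fun a => enorm_tsum_le_tsum_enorm
      _ = ∑' i, ∫⁻ a, ‖F i a‖ₑ ∂μ := lintegral_tsum fun i => (hF i).1.enorm
      _ = ∑' i, ENNReal.ofReal (∫ a, ‖F i a‖ ∂μ) := by
          congr with i
          exact (ofReal_integral_norm_eq_lintegral_enorm (hF i)).symm
      _ = ENNReal.ofReal (∑' i, ∫ a, ‖F i a‖ ∂μ) :=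
          (ENNReal.ofReal_tsum_of_nonneg (fun i => integral_nonneg fun a => norm_nonneg _)
            hsum).symm
      _ < ⊤ := ENNReal.ofReal_lt_top

theorem hasSum_of_forall_eq {α ι : Type*} [AddCommMonoid α] [TopologicalSpace α] {f g : ι → α}
    {a : α} (h : ∀ i, g i = f i) (hf : HasSum f a) : HasSum g a :=
  (funext h : g = f) ▸ hf

variable {Γ : Subgroup (GL (Fin 3) ℂ)}

/-- Unfolding an integral over the boundary along the translates of a fundamental domain. -/
theorem hasSum_setIntegral_fundDomain [Countable Γ] (hΓ : IsConvexCocompact Γ) {D : Set (ℂ × ℂ)}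
    (hD : IsFundDomain Γ D) {F : ℂ × ℂ → ℂ} (hF : Measurable F)
    (hint : Integrable F boundaryMeasure) :
    HasSum (fun γ : Γ => ∫ W in D, jacobian γ W • F (moebius γ W) ∂boundaryMeasure)
      (∫ W, F W ∂boundaryMeasure) := by
  have hU := hΓ.le_U21
  -- These are the translates γ⁻¹D. They partition the whole boundary up to null sets because the
  -- limit set is null.
  set s : Γ → Set (ℂ × ℂ) := fun γ => {W | autJ γ W ≠ 0 ∧ moebius γ W ∈ D}
  have hs : ∀ γ, MeasurableSet (s γ) := fun γ =>
    (measurableSet_eq_fun (measurable_autJ γ) measurable_const).compl.inter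
      (measurable_moebius γ hD.measurableSet)
  have huniq : ∀ᵐ W ∂boundaryMeasure, ∃! γ : Γ, W ∈ s γ := by
    filter_upwards [hD.existsUnique, ae_mem_finiteDisc hΓ] with W h1 h2
    simp only [act_mem_coe_image] at h1
    exact h1 h2
  have hdisj : Pairwise (Function.onFun (AEDisjoint boundaryMeasure) s) := by
    intro β γ hne
    refine measure_eq_zero_iff_ae_notMem.2 ?_
    filter_upwards [huniq] with W hW hmem
    exact hne (hW.unique hmem.1 hmem.2)
  have huniv : boundaryMeasure.restrict (⋃ γ, s γ) = boundaryMeasure := by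
    refine Measure.restrict_eq_self_of_ae_mem ?_
    filter_upwards [huniq] with W hW
    exact Set.mem_iUnion.2 hW.exists
  have h := hasSum_integral_iUnion_ae (fun γ => (hs γ).nullMeasurableSet) hdisj
    (hint.integrableOn (s := ⋃ γ, s γ))
  -- Reindexing by inverses makes the pieces γD, which the change of variables by γ pulls back to D.
  rw [huniv, ← (Equiv.inv Γ).hasSum_iff] at h
  refine hasSum_of_forall_eq (fun γ => ?_) h
  have hinv : ((Equiv.inv Γ γ : Γ) : GL (Fin 3) ℂ) = (γ : GL (Fin 3) ℂ)⁻¹ := by simp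
  simp only [Function.comp]
  rw [← integral_indicator (hs _), ← integral_indicator hD.measurableSet,
    ← integral_moebius (hU γ.2) (hF.indicator (hs _))]
  refine integral_congr_ae ?_
  filter_upwards [ae_autJ_ne_zero (hU γ.2)] with W hj
  have hj' : autJ (γ : GL (Fin 3) ℂ)⁻¹ (moebius γ W) ≠ 0 := by
    intro h; have := autJ_inv_moebius γ W hj; rw [h] at this; simp at this
  have hiff : moebius γ W ∈ s (Equiv.inv Γ γ) ↔ W ∈ D := by
    change autJ ((Equiv.inv Γ γ : Γ) : GL (Fin 3) ℂ) _ ≠ 0 ∧ moebius _ _ ∈ D ↔ _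
    rw [hinv, moebius_inv_moebius γ W hj, and_iff_right hj']
  by_cases hW : W ∈ D
  · rw [Set.indicator_of_mem hW, Set.indicator_of_mem (hiff.2 hW)]
  · rw [Set.indicator_of_notMem hW, Set.indicator_of_notMem (mt hiff.1 hW), smul_zero]

/-- The unfolded summand. -/
noncomputable def unfoldTerm (Z W' : ℂ × ℂ) (s : ℂ) (W : ℂ × ℂ) : ℂ :=
  (poisson Z W : ℂ) ^ s * (‖rho W W'‖ : ℂ) ^ (-2 * (2 - s))

theorem measurable_unfoldTerm (Z W' : ℂ × ℂ) (s : ℂ) : Measurable (unfoldTerm Z W' s) := by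
  have h1 := measurable_poisson_right Z
  have h : Continuous fun W => rho W W' := by unfold rho; fun_prop
  have h2 := h.measurable
  unfold unfoldTerm
  fun_prop

theorem integrable_unfoldTerm {Z W' : ℂ × ℂ} (hZ : 0 < height Z) (hW' : height W' = 0)
    {s : ℂ} (hs : 1 < s.re) : Integrable (unfoldTerm Z W' s) boundaryMeasure :=
  (integral_poisson_mul_kernel hZ hW' hs).1

theorem integral_unfoldTerm {Z W' : ℂ × ℂ} (hZ : 0 < height Z) (hW' : height W' = 0)
    {s : ℂ} (hs : 1 < s.re) : ∫ W, unfoldTerm Z W' s W ∂boundaryMeasure =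
      intertwiningConst s * (poisson Z W' : ℂ) ^ (2 - s) :=
  (integral_poisson_mul_kernel hZ hW' hs).2

theorem ofReal_norm_unfoldTerm {Z W W' : ℂ × ℂ} (hZ : 0 < height Z) (hW : height W = 0)
    (hne : 0 < ‖rho W W'‖) (s : ℂ) :
    ((‖unfoldTerm Z W' s W‖ : ℝ) : ℂ) = unfoldTerm Z W' (s.re : ℂ) W := by
  have hp := poisson_pos hZ hW.ge
  have e : (-2 * (2 - s)).re = -2 * (2 - s.re) := by simp
  rw [unfoldTerm, unfoldTerm, norm_mul, Complex.norm_cpow_eq_rpow_re_of_pos hp,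
    Complex.norm_cpow_eq_rpow_re_of_pos hne, e, ofReal_mul, Complex.ofReal_cpow hp.le,
    Complex.ofReal_cpow hne.le]
  push_cast
  rfl

/-- Almost everywhere the absolute value is the same kernel at the real exponent Re s, so the
intertwining formula computes the L¹ norm as well. -/
theorem integral_norm_unfoldTerm {Z W' : ℂ × ℂ} (hZ : 0 < height Z) (hW' : height W' = 0)
    {s : ℂ} (hs : 1 < s.re) : ∫ W, ‖unfoldTerm Z W' s W‖ ∂boundaryMeasure =
      ‖intertwiningConst s.re‖ * poisson Z W' ^ (2 - s.re) := by
  have h := integral_unfoldTerm hZ hW' (s := (s.re : ℂ)) (by simpa using hs)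
  have hae : ∀ᵐ W ∂boundaryMeasure,
      ((‖unfoldTerm Z W' s W‖ : ℝ) : ℂ) = unfoldTerm Z W' (s.re : ℂ) W := by
    filter_upwards [ae_height_eq_zero, compl_mem_ae_iff.2 (measure_singleton W')] with W h1 h2
    refine ofReal_norm_unfoldTerm hZ h1 (norm_pos_iff.2 fun h0 => h2 ?_) s
    exact (rho_eq_zero_iff h1.ge hW').1 h0
  rw [← integral_congr_ae hae, integral_complex_ofReal] at h
  have h2 := congrArg norm h
  have hp := poisson_pos hZ hW'.ge
  rw [Complex.norm_real, Real.norm_of_nonneg (integral_nonneg fun _ => norm_nonneg _), norm_mul,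
    Complex.norm_cpow_eq_rpow_re_of_pos hp] at h2
  simpa using h2

/-- The summands of the unfolded integral, as functions on the fundamental domain. -/
noncomputable def pullbackTerm (Z W' : ℂ × ℂ) (s : ℂ) (β γ : GL (Fin 3) ℂ) (W : ℂ × ℂ) : ℂ :=
  jacobian γ W • unfoldTerm (moebius β Z) W' s (moebius γ W)

/-- Equivariance turns P(βZ, γW) into P(γ⁻¹βZ, W)|j|². The resulting power |j|^(2s-4) is precisely
the automorphy factor of the S-matrix at 2 - s. -/
theorem pullbackTerm_eq {Z W W' : ℂ × ℂ} {s : ℂ} {β γ : GL (Fin 3) ℂ} (hβ : β ∈ U21)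
    (hγ : γ ∈ U21) (hZ : 0 < height Z) (hW : height W = 0) (hj : autJ γ W ≠ 0) :
    pullbackTerm Z W' s β γ W =
      eisensteinTerm Z W s (γ⁻¹ * β) * sMatrixTerm W W' (2 - s) γ := by
  have hn : 0 < ‖autJ γ W‖ := by simpa using hj
  have hZ' := height_moebius_pos hβ hZ
  have hjac : ((jacobian γ W : ℝ) : ℂ) = (((‖autJ γ W‖ ^ 4)⁻¹ : ℝ) : ℂ) := by simp [jacobian]
  have hp := poisson_pos (height_moebius_pos (U21.inv_mem hγ) hZ') hW.ge
  rw [pullbackTerm, unfoldTerm, eisensteinTerm, sMatrixTerm, NNReal.smul_def, Complex.real_smul,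
    hjac, poisson_moebius_right hγ hZ' hj, ← mul_assoc, ofReal_mul_sq_cpow hp.le hn,
    moebius_mul _ _ _ (autJ_ne_zero hβ hZ)]
  ring

theorem hasSum_pullbackTerm (hΓ : IsConvexCocompact Γ) (hδ : criticalExponent Γ < 1)
    {s : ℂ} (hs : criticalExponent Γ < (s.re : EReal))
    (hs' : criticalExponent Γ < ((2 - s).re : EReal)) {Z W W' : ℂ × ℂ} (hZ : 0 < height Z)
    (hW : W ∈ finiteDisc Γ) (hW' : W' ∈ finiteDisc Γ) (hj : ∀ γ : Γ, autJ γ W ≠ 0) :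
    HasSum (fun p : Γ × Γ => pullbackTerm Z W' s p.1 p.2 W)
      (eisenstein Γ Z W s * sMatrix Γ W W' (2 - s)) := by
  have hU := hΓ.le_U21
  have h1 := summable_norm_eisensteinTerm hU hs hZ hW
  have h2 := summable_norm_sMatrixTerm hU hδ hs' hW hW'
  have h3 := (summable_mul_of_summable_norm h1 h2).hasSum
  rw [← tsum_mul_tsum_of_summable_norm h1 h2] at h3
  let e : Γ × Γ ≃ Γ × Γ :=
    { toFun := fun p => (p.2⁻¹ * p.1, p.2)
      invFun := fun p => (p.2 * p.1, p.2)
      left_inv := fun p => by simp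
      right_inv := fun p => by simp }
  rw [← e.hasSum_iff] at h3
  refine hasSum_of_forall_eq (fun p => ?_) h3
  rw [pullbackTerm_eq (hU p.1.2) (hU p.2.2) hZ (height_of_mem_finiteDisc hW) (hj _)]
  rfl

/-- For fixed β the sum over γ unfolds to a boundary integral. The same for absolute values gives a
constant times P(βZ, W')^(2-Re s), summable over β since 2 - Re s exceeds the critical exponent;
this justifies termwise integration. -/
theorem integral_eisenstein_mul_sMatrix [Countable Γ] (hΓ : IsConvexCocompact Γ)
    (hδ : criticalExponent Γ < 1) {s : ℂ} (hs : 1 < s.re)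
    (hs' : criticalExponent Γ < ((2 - s).re : EReal)) {Z W' : ℂ × ℂ} (hZ : 0 < height Z)
    (hW' : W' ∈ finiteDisc Γ) {D : Set (ℂ × ℂ)} (hD : IsFundDomain Γ D) :
    IntegrableOn (fun W => eisenstein Γ Z W s * sMatrix Γ W W' (2 - s)) D boundaryMeasure ∧
    ∫ W in D, eisenstein Γ Z W s * sMatrix Γ W W' (2 - s) ∂boundaryMeasure =
      intertwiningConst s * eisenstein Γ Z W' (2 - s) := by
  have hU := hΓ.le_U21
  have hW'0 := height_of_mem_finiteDisc hW'
  have hsδ : criticalExponent Γ < (s.re : EReal) := hδ.trans (by exact_mod_cast hs)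
  have hZβ : ∀ β : Γ, 0 < height (moebius β Z) := fun β => height_moebius_pos (hU β.2) hZ
  have hG : ∀ᵐ W ∂boundaryMeasure.restrict D,
      HasSum (fun p : Γ × Γ => pullbackTerm Z W' s p.1 p.2 W)
        (eisenstein Γ Z W s * sMatrix Γ W W' (2 - s)) := by
    filter_upwards [ae_restrict_mem hD.measurableSet,
      ae_restrict_of_ae (ae_autJ_ne_zero_forall hU)] with W h1 h2
    exact hasSum_pullbackTerm hΓ hδ hsδ hs' hZ (hD.subset ⟨W, h1, rfl⟩) hW' h2
  have hint : ∀ p : Γ × Γ, Integrable (pullbackTerm Z W' s p.1 p.2)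
      (boundaryMeasure.restrict D) := fun p =>
    ((integrable_moebius_iff (hU p.2.2) (measurable_unfoldTerm _ _ _)).2
      (integrable_unfoldTerm (hZβ p.1) hW'0 hs)).restrict
  have hfib : ∀ β : Γ, HasSum (fun γ : Γ => ∫ W in D, pullbackTerm Z W' s β γ W ∂boundaryMeasure)
      (intertwiningConst s * eisensteinTerm Z W' (2 - s) β) := by
    intro β
    have := hasSum_setIntegral_fundDomain hΓ hD (measurable_unfoldTerm (moebius β Z) W' s)
      (integrable_unfoldTerm (hZβ β) hW'0 hs)
    rwa [integral_unfoldTerm (hZβ β) hW'0 hs] at this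
  have hfibn : ∀ β : Γ, HasSum
      (fun γ : Γ => ∫ W in D, ‖pullbackTerm Z W' s β γ W‖ ∂boundaryMeasure)
      (‖intertwiningConst s.re‖ * poisson (moebius β Z) W' ^ (2 - s.re)) := by
    intro β
    have hm := (Complex.measurable_ofReal.comp
      (measurable_unfoldTerm (moebius β Z) W' s).norm)
    have h1 := hasSum_setIntegral_fundDomain hΓ hD hm
      (integrable_unfoldTerm (hZβ β) hW'0 hs).norm.ofReal
    simp only [Function.comp] at h1
    rw [integral_complex_ofReal, integral_norm_unfoldTerm (hZβ β) hW'0 hs] at h1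
    refine Complex.hasSum_ofReal.1 (hasSum_of_forall_eq (fun γ => ?_) h1)
    rw [← integral_complex_ofReal]
    congr with W
    rw [pullbackTerm, NNReal.smul_def, NNReal.smul_def, norm_smul, Complex.real_smul, ofReal_mul,
      NNReal.norm_eq]
  have hsum : Summable fun p : Γ × Γ =>
      ∫ W in D, ‖pullbackTerm Z W' s p.1 p.2 W‖ ∂boundaryMeasure := by
    rw [summable_prod_of_nonneg fun p => integral_nonneg fun W => norm_nonneg _]
    refine ⟨fun β => (hfibn β).summable, ?_⟩
    simp only [(hfibn _).tsum_eq]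
    refine Summable.mul_left _ ?_
    have := summable_poisson hU hs' hZ hW'
    simpa using this
  have hE : (fun W => ∑' p : Γ × Γ, pullbackTerm Z W' s p.1 p.2 W) =ᵐ[boundaryMeasure.restrict D]
      fun W => eisenstein Γ Z W s * sMatrix Γ W W' (2 - s) := hG.mono fun W h => h.tsum_eq
  refine ⟨(integrable_congr hE).1 (integrable_tsum_of_summable_integral_norm hint hsum
    (hG.mono fun W h => h.summable)), ?_⟩
  have h1 := hasSum_integral_of_summable_integral_norm hint hsum
  rw [integral_congr_ae hE] at h1
  have h2 := h1.prod_fiberwise hfib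
  rw [← h2.tsum_eq, tsum_mul_left]
  rfl

end SiegelU21

theorem theorem1p2 (Γ : Subgroup (GL (Fin 3) ℂ)) (hΓ : SiegelU21.IsConvexCocompact Γ)
    (hδ : SiegelU21.criticalExponent Γ < 1)
    (s : ℂ) (hs : 1 < s.re) (hs' : (s.re : EReal) < 2 - SiegelU21.criticalExponent Γ)
    (Z : ℂ × ℂ) (hZ : Z ∈ SiegelU21.siegel)
    (W' : ℂ × ℂ) (hW' : (W' : OnePoint (ℂ × ℂ)) ∈ SiegelU21.discontinuitySet Γ) :
    (∀ W : ℂ × ℂ, (W : OnePoint (ℂ × ℂ)) ∈ SiegelU21.discontinuitySet Γ →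
      (Summable fun γ : Γ => SiegelU21.eisensteinTerm Z W s γ) ∧
      (Summable fun γ : Γ => SiegelU21.sMatrixTerm W W' (2 - s) γ)) ∧
    (Summable fun γ : Γ => SiegelU21.eisensteinTerm Z W' (2 - s) γ) ∧
    (∃ D, SiegelU21.IsFundDomain Γ D) ∧
    ∀ D, SiegelU21.IsFundDomain Γ D →
      IntegrableOn
        (fun W => SiegelU21.eisenstein Γ Z W s * SiegelU21.sMatrix Γ W W' (2 - s))
        D SiegelU21.boundaryMeasure ∧
      ∫ W in D, SiegelU21.eisenstein Γ Z W s * SiegelU21.sMatrix Γ W W' (2 - s)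
          ∂SiegelU21.boundaryMeasure =
        (4 : ℂ) ^ (s - 1) * Real.pi / (s - 1) *
          ((Real.sqrt Real.pi : ℂ) * Complex.Gamma (s - 1 / 2) / Complex.Gamma s) *
          SiegelU21.eisenstein Γ Z W' (2 - s) := by
  have hU := hΓ.le_U21
  have hsδ : SiegelU21.criticalExponent Γ < (s.re : EReal) := hδ.trans (by exact_mod_cast hs)
  have hsδ' : SiegelU21.criticalExponent Γ < ((2 - s).re : EReal) := by
    have h0 := SiegelU21.criticalExponent_nonneg (Γ := Γ)
    generalize SiegelU21.criticalExponent Γ = d at *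
    -- The critical exponent lies in [0, 1), so the inequality can be rearranged over ℝ.
    lift d to ℝ using ⟨ne_top_of_lt hδ, ne_bot_of_le_ne_bot EReal.zero_ne_bot h0⟩
    have h1 : s.re < 2 - d := EReal.coe_lt_coe_iff.1 hs'
    have h2 : d < (2 - s).re := by simp; linarith
    exact_mod_cast h2
  have hcount : Countable Γ :=
    SiegelU21.countable_of_criticalExponent_lt hU (t := 1) (by exact_mod_cast hδ)
  refine ⟨fun W hW => ⟨?_, ?_⟩, ?_, SiegelU21.exists_isFundDomain hΓ hδ, fun D hD =>
    SiegelU21.integral_eisenstein_mul_sMatrix hΓ hδ hs hsδ' hZ hW' hD⟩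
  · exact (SiegelU21.summable_norm_eisensteinTerm hU hsδ hZ hW).of_norm
  · exact (SiegelU21.summable_norm_sMatrixTerm hU hδ hsδ' hW hW').of_norm
  · exact (SiegelU21.summable_norm_eisensteinTerm hU hsδ' hZ hW').of_norm
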